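/- Let $J(p,q)=(-q,p)$ on $\mathbb{R}^{2n}=\mathbb{R}^n_p\times\mathbb{R}^n_q$. Let $K\subset\mathbb{R}^{2n}$ be a convex body (compact, convex, with non-empty interior), and let $N_K(x)=\{v:\langle v,x-y\rangle\ge 0\ \forall y\in K\}$. A closed characteristic on $\partial K$ is a non-constant curve $\gamma\in W^{1,2}([0,T],\partial K)$, $T>0$, with $\gamma(0)=\gamma(T)$ and $-J\dot\gamma(t)\in N_K(\gamma(t))$ for almost every $t$. Its action is $\mathcal A(\gamma)=\frac12\int_0^T\langle -J\dot\gamma,\gamma\rangle\,dt$. The capacity $c_{\mathrm{EHZ}}(K)$ is the minimal action of a closed characteristic on $\partial K$, and a systole of $K$ is a closed characteristic on $\partial K$ of minimal action. Let $u$ be a unit vector, let $H=\{x:\langle x,u\rangle=h\}$ be a hyperplane that meets the interior of $K$, and put $K_1=K\cap\{\langle x,u\rangle\ge h\}$ and $K_2=K\cap\{\langle x,u\rangle\le h\}$. Call the cut additive if $c_{\mathrm{EHZ}}(K)=c_{\mathrm{EHZ}}(K_1)+c_{\mathrm{EHZ}}(K_2)$. 1. The cut is additive if and only if there are a systole $\gamma:[0,T]\to\partial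 K$ of $K$ and times $0\le t_1<t_2\le T$ with $\gamma(t_1),\gamma(t_2)\in H$ and $\gamma(t_2)-\gamma(t_1)\in\mathbb{R}_{>0}\,Ju$. 2. For every such $\gamma,t_1,t_2$, the restriction of $\gamma$ to $[t_1,t_2]$ followed by the segment $[\gamma(t_2),\gamma(t_1)]$ is a systole of $K_1$, and the complementary arc of $\gamma$, from $\gamma(t_2)$ to $\gamma(t_1)$, followed by the segment $[\gamma(t_1),\gamma(t_2)]$ is a systole of $K_2$. 3. If the cut is additive, then every pair of systoles $\gamma_1:[0,T_1]\to\partial K_1$, $\gamma_2:[0,T_2]\to\partial K_2$ can be glued, up to translations, to a systole of $K$, in the following sense. (a) After a suitable choice of the starting points of the closed curves $\gamma_1,\gamma_2$, there are integrable functions $\alpha_i:[0,T_i]\to[0,\infty)$, vanishing where $\gamma_i\notin H$, with $-J\dot\gamma_1+\alpha_1u\in N_K(\gamma_1)$ and $-J\dot\gamma_2-\alpha_2u\in N_K(\gamma_2)$ almost everywhere, and vectors $x_1,x_2$, such that $\eta_1(t)=x_1+\gamma_1(t)+\int_0^t\alpha_1\,Ju$ on $[0,T_1]$ followed by $\eta_2(t)=x_2+\gamma_2(t)-\int_0^t\alpha_2\,Ju$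 on $[0,T_2]$ is a systole $\gamma$ of $K$ (that is, the motions of $\gamma_1,\gamma_2$ along $H$ in the directions $-Ju$, $Ju$ are deleted and what remains is translated and concatenated). Moreover $\gamma(0),\gamma(T_1)\in H$ and $\gamma(T_1)-\gamma(0)\in\mathbb{R}_{>0}\,Ju$. (b) Suppose that there are $a_i\in[0,T_i]$ such that almost everywhere $-J\dot\gamma_i\in N_K(\gamma_i)$ on $[0,a_i]$, while $\dot\gamma_1\in-\mathbb{R}_{\ge0}Ju$ on $[a_1,T_1]$ and $\dot\gamma_2\in\mathbb{R}_{\ge0}Ju$ on $[a_2,T_2]$; that is, each $\gamma_i$ is an arc followed by a single chord. Then there are vectors $x_1,x_2$ such that $\gamma_1|_{[0,a_1]}+x_1$ followed by $\gamma_2|_{[0,a_2]}+x_2$ is a systole $\gamma$ of $K$, with $\gamma(0),\gamma(a_1)\in H$ and $\gamma(a_1)-\gamma(0)\in\mathbb{R}_{>0}\,Ju$. -/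

import Mathlib

open MeasureTheory Set
open scoped RealInnerProductSpace

noncomputable section

/-- `ℝ²ⁿ` with its Euclidean structure. The coordinates indexed by `Sum.inl` are
`p₁, …, pₙ` and those indexed by `Sum.inr` are `q₁, …, qₙ`. -/
abbrev PhaseSpace (n : ℕ) : Type := EuclideanSpace ℝ (Fin n ⊕ Fin n)

/-- The standard complex structure `J (p, q) = (-q, p)`, so that `ω(v, w) = ⟪J v, w⟫` for
`ω = ∑ dpᵢ ∧ dqᵢ`. -/
def stdJ (n : ℕ) : PhaseSpace n →L[ℝ] PhaseSpace n :=
  Matrix.toEuclideanCLM (n := Fin n ⊕ Fin n) (𝕜 := ℝ) (Matrix.J (Fin n) ℝ)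

/-- The normal cone of `K` at `x`. -/
def normalCone {n : ℕ} (K : Set (PhaseSpace n)) (x : PhaseSpace n) : Set (PhaseSpace n) :=
  {v | ∀ y ∈ K, 0 ≤ ⟪v, x - y⟫}

/-- The Sobolev class `W^{1,2}([0,T], ℝ²ⁿ)`: absolutely continuous curves with square integrable
derivative. Only the values of `γ` on `[0,T]` matter, here and below. -/
def IsW12 {n : ℕ} (T : ℝ) (γ : ℝ → PhaseSpace n) : Prop :=
  AbsolutelyContinuousOnInterval γ 0 T ∧ MemLp (deriv γ) 2 (volume.restrict (Icc 0 T))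

/-- `γ : [0,T] → ∂K` is a (generalized, non-constant) closed characteristic on `∂K`. -/
structure IsClosedCharacteristic {n : ℕ} (K : Set (PhaseSpace n)) (T : ℝ)
    (γ : ℝ → PhaseSpace n) : Prop where
  period_pos : 0 < T
  isW12 : IsW12 T γ
  closed : γ 0 = γ T
  mem_frontier : ∀ t ∈ Icc 0 T, γ t ∈ frontier K
  velocity_mem : ∀ᵐ t ∂(volume.restrict (Icc 0 T)), -(stdJ n (deriv γ t)) ∈ normalCone K (γ t)
  nonconstant : ∃ t ∈ Icc 0 T, γ t ≠ γ 0

/-- The symplectic action `½ ∫₀ᵀ ⟪-J γ', γ⟫ dt = ½ ∫ ∑ (pᵢ dqᵢ - qᵢ dpᵢ)` of a closed curve. -/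
def action {n : ℕ} (T : ℝ) (γ : ℝ → PhaseSpace n) : ℝ :=
  (1 / 2) * ∫ t in (0 : ℝ)..T, ⟪-(stdJ n (deriv γ t)), γ t⟫

/-- The Ekeland–Hofer–Zehnder capacity: the minimal action of a closed characteristic. -/
def ehzCapacity {n : ℕ} (K : Set (PhaseSpace n)) : ℝ :=
  sInf {a | ∃ T γ, IsClosedCharacteristic K T γ ∧ action T γ = a}

/-- `γ : [0,T] → ∂K` is a systole: an action-minimizing closed characteristic. -/
def IsSystole {n : ℕ} (K : Set (PhaseSpace n)) (T : ℝ) (γ : ℝ → PhaseSpace n) : Prop :=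
  IsClosedCharacteristic K T γ ∧
    ∀ T' γ', IsClosedCharacteristic K T' γ' → action T γ ≤ action T' γ'

/-- The hyperplane with normal `u` at height `h`. -/
def hyperplane {n : ℕ} (u : PhaseSpace n) (h : ℝ) : Set (PhaseSpace n) := {x | ⟪u, x⟫ = h}

/-- The piece `K₁` of `K`, on the side of the hyperplane into which `u` points. -/
def upperPiece {n : ℕ} (K : Set (PhaseSpace n)) (u : PhaseSpace n) (h : ℝ) :
    Set (PhaseSpace n) := K ∩ {x | h ≤ ⟪u, x⟫}

/-- The piece `K₂` of `K`, on the other side. -/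
def lowerPiece {n : ℕ} (K : Set (PhaseSpace n)) (u : PhaseSpace n) (h : ℝ) :
    Set (PhaseSpace n) := K ∩ {x | ⟪u, x⟫ ≤ h}

/-- Additivity of the capacity for the cut of `K` by the hyperplane. -/
def IsAdditiveCut {n : ℕ} (K : Set (PhaseSpace n)) (u : PhaseSpace n) (h : ℝ) : Prop :=
  ehzCapacity K = ehzCapacity (upperPiece K u h) + ehzCapacity (lowerPiece K u h)

/-- The curve on `[0,T]` meets the hyperplane at the times `t₁ < t₂`, and
`γ(t₂) - γ(t₁)` is a positive multiple of `J u`. -/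
def SplitsAt {n : ℕ} (u : PhaseSpace n) (h T : ℝ) (γ : ℝ → PhaseSpace n) (t₁ t₂ : ℝ) : Prop :=
  0 ≤ t₁ ∧ t₁ < t₂ ∧ t₂ ≤ T ∧ γ t₁ ∈ hyperplane u h ∧ γ t₂ ∈ hyperplane u h ∧
    ∃ c : ℝ, 0 < c ∧ γ t₂ - γ t₁ = c • stdJ n u

/-- Run through `α` on `[0,a]`, then through `β`, started at time `a`. -/
def concatAt {n : ℕ} (a : ℝ) (α β : ℝ → PhaseSpace n) : ℝ → PhaseSpace n :=
  fun s => if s ≤ a then α s else β (s - a)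

/-- The straight segment from `x` to `y`, on `[0,1]`. -/
def segmentPath {n : ℕ} (x y : PhaseSpace n) : ℝ → PhaseSpace n := fun s => x + s • (y - x)

/-- The closed curve `γ` on `[0,T]`, started at time `s ∈ [0,T]` instead of `0`. -/
def rotate {n : ℕ} (T s : ℝ) (γ : ℝ → PhaseSpace n) : ℝ → PhaseSpace n :=
  concatAt (T - s) (fun r => γ (s + r)) γ

/-- The arc of `γ` from `t₁` to `t₂`, closed by the segment `[γ(t₂), γ(t₁)]`;
a curve on `[0, (t₂ - t₁) + 1]`. -/
def innerLoop {n : ℕ} (γ : ℝ → PhaseSpace n) (t₁ t₂ : ℝ) : ℝ → PhaseSpace n :=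
  concatAt (t₂ - t₁) (fun r => γ (t₁ + r)) (segmentPath (γ t₂) (γ t₁))

/-- The complementary arc of `γ`, from `t₂` through `T ∼ 0` to `t₁`, closed by the segment
`[γ(t₁), γ(t₂)]`; a curve on `[0, (T - t₂ + t₁) + 1]`. -/
def outerLoop {n : ℕ} (T : ℝ) (γ : ℝ → PhaseSpace n) (t₁ t₂ : ℝ) : ℝ → PhaseSpace n :=
  concatAt (T - t₂ + t₁) (rotate T t₂ γ) (segmentPath (γ t₁) (γ t₂))

/-- On `[0,a]` the curve `γ` moves by the characteristic directions of `K`, and on `[a,T]` it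
moves along a straight line in the direction `-J u`. -/
def IsArcThenChord {n : ℕ} (K : Set (PhaseSpace n)) (u : PhaseSpace n) (T a : ℝ)
    (γ : ℝ → PhaseSpace n) : Prop :=
  a ∈ Icc 0 T ∧
  (∀ᵐ t ∂(volume.restrict (Icc 0 a)), -(stdJ n (deriv γ t)) ∈ normalCone K (γ t)) ∧
  (∀ᵐ t ∂(volume.restrict (Icc a T)), ∃ c : ℝ, 0 ≤ c ∧ deriv γ t = -(c • stdJ n u))

/-- `η` arises from `γ` by a translation and by deleting the motion of `γ` along the hyperplane
`H` in the direction `-J u`: the velocity of `γ` is `J w(t) - α(t) J u` where `w(t)` is normal to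
`K` at `γ(t)` and `α ≥ 0` vanishes off `H`, and the velocity of `η` is `J w(t)`. -/
def StripsTo {n : ℕ} (K H : Set (PhaseSpace n)) (u : PhaseSpace n) (T : ℝ)
    (γ η : ℝ → PhaseSpace n) : Prop :=
  ∃ (x : PhaseSpace n) (α : ℝ → ℝ),
    (∀ t, 0 ≤ α t) ∧ IntervalIntegrable α volume 0 T ∧
    (∀ t ∈ Icc 0 T, γ t ∉ H → α t = 0) ∧
    (∀ᵐ t ∂(volume.restrict (Icc 0 T)),
      -(stdJ n (deriv γ t)) + α t • u ∈ normalCone K (γ t)) ∧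
    ∀ t ∈ Icc 0 T, η t = x + γ t + (∫ r in (0 : ℝ)..t, α r) • stdJ n u

end

noncomputable section

open Filter Topology

/-! ### The standard complex structure -/

section ComplexStructure

variable {n : ℕ}

theorem stdJ_stdJ (x : PhaseSpace n) : stdJ n (stdJ n x) = -x := by
  have h : stdJ n * stdJ n = -1 := by
    rw [stdJ, ← map_mul, Matrix.J_squared, map_neg, map_one]
  have := congrArg (fun f : PhaseSpace n →L[ℝ] PhaseSpace n => f x) h
  simpa using this

theorem inner_stdJ_left (x y : PhaseSpace n) : ⟪stdJ n x, y⟫ = -⟪x, stdJ n y⟫ := by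
  have h : star (stdJ n) = -stdJ n := by
    rw [stdJ, ← map_star, Matrix.star_eq_conjTranspose, Matrix.conjTranspose_eq_transpose_of_trivial,
      Matrix.J_transpose, map_neg]
  rw [← ContinuousLinearMap.adjoint_inner_right, ← ContinuousLinearMap.star_eq_adjoint, h]
  simp

theorem inner_stdJ_right (x y : PhaseSpace n) : ⟪x, stdJ n y⟫ = -⟪stdJ n x, y⟫ := by
  rw [inner_stdJ_left, neg_neg]

theorem inner_stdJ_stdJ (x y : PhaseSpace n) : ⟪stdJ n x, stdJ n y⟫ = ⟪x, y⟫ := by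
  rw [inner_stdJ_left, stdJ_stdJ, inner_neg_right, neg_neg]

theorem inner_stdJ_self (x : PhaseSpace n) : ⟪stdJ n x, x⟫ = 0 := by
  have := inner_stdJ_left x x
  rw [real_inner_comm (stdJ n x) x] at this
  linarith [real_inner_comm (stdJ n x) x]

theorem inner_self_stdJ (x : PhaseSpace n) : ⟪x, stdJ n x⟫ = 0 := by
  rw [real_inner_comm, inner_stdJ_self]

theorem norm_stdJ (x : PhaseSpace n) : ‖stdJ n x‖ = ‖x‖ := by
  rw [norm_eq_sqrt_real_inner, norm_eq_sqrt_real_inner, inner_stdJ_stdJ]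

end ComplexStructure

/-! ### Absolutely continuous curves -/

section AbsolutelyContinuous

open AbsolutelyContinuousOnInterval in
theorem AbsolutelyContinuousOnInterval.of_dist_le {X Y Z : Type*} [PseudoMetricSpace X]
    [PseudoMetricSpace Y] [PseudoMetricSpace Z] {f : ℝ → X} {g : ℝ → Y} {k : ℝ → Z} {a b C : ℝ}
    (hg : AbsolutelyContinuousOnInterval g a b) (hk : AbsolutelyContinuousOnInterval k a b)
    (hle : ∀ s ∈ uIcc a b, ∀ t ∈ uIcc a b,
      dist (f s) (f t) ≤ C * (dist (g s) (g t) + dist (k s) (k t))) :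
    AbsolutelyContinuousOnInterval f a b := by
  have h1 := (Tendsto.add hg hk).const_mul C
  rw [add_zero, mul_zero] at h1
  refine squeeze_zero' (Eventually.of_forall fun E => Finset.sum_nonneg fun _ _ => dist_nonneg)
    ?_ h1
  have hmem : ∀ᶠ E : ℕ × (ℕ → ℝ × ℝ) in totalLengthFilter ⊓ 𝓟 (disjWithin a b),
      E ∈ disjWithin a b := eventually_inf_principal.mpr (by simp)
  filter_upwards [hmem] with E hE
  rw [← Finset.sum_add_distrib, Finset.mul_sum]
  exact Finset.sum_le_sum fun i hi => hle _ (hE.1 i hi).1 _ (hE.1 i hi).2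

theorem AbsolutelyContinuousOnInterval.primitive {E : Type*} [NormedAddCommGroup E]
    [NormedSpace ℝ E] {f : ℝ → E} {a b c : ℝ} (hf : IntervalIntegrable f volume a b)
    (hc : c ∈ uIcc a b) : AbsolutelyContinuousOnInterval (fun x => ∫ t in c..x, f t) a b := by
  have h := hf.norm.absolutelyContinuousOnInterval_intervalIntegral hc
  refine h.of_dist_le h (C := 1) fun s hs t ht => ?_
  have hint : ∀ x ∈ uIcc a b, IntervalIntegrable f volume c x := fun x hx =>
    hf.mono_set (uIcc_subset_uIcc hc hx)
  rw [dist_eq_norm, dist_eq_norm,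
    intervalIntegral.integral_interval_sub_left (hint s hs) (hint t ht),
    intervalIntegral.integral_interval_sub_left (hint s hs).norm (hint t ht).norm]
  have := intervalIntegral.norm_integral_le_abs_integral_norm (f := f) (a := t) (b := s)
    (μ := volume)
  rw [Real.norm_eq_abs]
  linarith [abs_nonneg (∫ x in t..s, ‖f x‖)]

end AbsolutelyContinuous

/-! ### Curves and their velocities -/

variable {n : ℕ}

/-- `γ` is a `W^{1,2}` curve on `[0,T]` with velocity `v`. -/
structure HasVelocity (T : ℝ) (γ v : ℝ → PhaseSpace n) : Prop where
  nonneg : 0 ≤ T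
  memLp : MemLp v 2 (volume.restrict (Icc 0 T))
  eq_add : ∀ t ∈ Icc 0 T, γ t = γ 0 + ∫ r in (0 : ℝ)..t, v r

theorem ae_Icc_of_ae_mem {T : ℝ} {P : ℝ → Prop} (h : ∀ᵐ t, t ∈ Icc 0 T → P t) :
    ∀ᵐ t ∂(volume.restrict (Icc 0 T)), P t := (ae_restrict_iff' measurableSet_Icc).2 h

theorem integral_congr_ae_Icc {E : Type*} [NormedAddCommGroup E] [NormedSpace ℝ E] {T : ℝ}
    (hT : 0 ≤ T) {f g : ℝ → E} (h : ∀ᵐ t ∂(volume.restrict (Icc 0 T)), f t = g t) :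
    ∫ t in (0 : ℝ)..T, f t = ∫ t in (0 : ℝ)..T, g t := by
  refine intervalIntegral.integral_congr_ae_restrict ?_
  rw [uIoc_of_le hT]
  exact ae_restrict_of_ae_restrict_of_subset Ioc_subset_Icc_self h

theorem intervalIntegrable_of_memLp {E : Type*} [NormedAddCommGroup E] {T : ℝ} (hT : 0 ≤ T)
    {v : ℝ → E} (h : MemLp v 2 (volume.restrict (Icc 0 T))) :
    IntervalIntegrable v volume 0 T := by
  rw [intervalIntegrable_iff_integrableOn_Icc_of_le hT]
  exact h.integrable (by norm_num)

namespace HasVelocity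

variable {T : ℝ} {γ v : ℝ → PhaseSpace n}

theorem intervalIntegrable (h : HasVelocity T γ v) : IntervalIntegrable v volume 0 T :=
  intervalIntegrable_of_memLp h.nonneg h.memLp

theorem intervalIntegrable_sub (h : HasVelocity T γ v) {a b : ℝ} (ha : a ∈ Icc 0 T)
    (hb : b ∈ Icc 0 T) : IntervalIntegrable v volume a b :=
  h.intervalIntegrable.mono_set
    (uIcc_subset_uIcc (by rwa [uIcc_of_le h.nonneg]) (by rwa [uIcc_of_le h.nonneg]))

theorem sub_eq (h : HasVelocity T γ v) {a b : ℝ} (ha : a ∈ Icc 0 T) (hb : b ∈ Icc 0 T) :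
    γ b - γ a = ∫ t in a..b, v t := by
  have h0 : (0 : ℝ) ∈ Icc 0 T := ⟨le_rfl, h.nonneg⟩
  rw [h.eq_add a ha, h.eq_add b hb, ← intervalIntegral.integral_interval_sub_left
    (h.intervalIntegrable_sub h0 hb) (h.intervalIntegrable_sub h0 ha)]
  abel

theorem absolutelyContinuous (h : HasVelocity T γ v) : AbsolutelyContinuousOnInterval γ 0 T := by
  have h1 := AbsolutelyContinuousOnInterval.primitive h.intervalIntegrable left_mem_uIcc
  refine h1.of_dist_le h1 (C := 1) fun s hs t ht => ?_
  rw [uIcc_of_le h.nonneg] at hs ht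
  rw [h.eq_add s hs, h.eq_add t ht, dist_add_left]
  linarith [dist_nonneg (x := ∫ x in (0 : ℝ)..s, v x) (y := ∫ x in (0 : ℝ)..t, v x)]

theorem continuousOn (h : HasVelocity T γ v) : ContinuousOn γ (Icc 0 T) := by
  simpa [uIcc_of_le h.nonneg] using h.absolutelyContinuous.continuousOn

theorem ae_hasDerivAt (h : HasVelocity T γ v) :
    ∀ᵐ t ∂(volume.restrict (Icc 0 T)), HasDerivAt γ (v t) t := by
  refine ae_Icc_of_ae_mem ?_
  have hne : ∀ a : ℝ, ∀ᵐ t : ℝ, t ≠ a := fun a => by simp [ae_iff, measure_singleton]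
  filter_upwards [h.intervalIntegrable.ae_hasDerivAt_integral, hne 0, hne T] with t ht h0 hT hmem
  have h1 := (ht (by rwa [uIcc_of_le h.nonneg]) 0 left_mem_uIcc).const_add (γ 0)
  refine h1.congr_of_eventuallyEq ?_
  filter_upwards [Icc_mem_nhds (lt_of_le_of_ne hmem.1 h0.symm) (lt_of_le_of_ne hmem.2 hT)] with s hs
  exact h.eq_add s hs

theorem ae_deriv_eq (h : HasVelocity T γ v) :
    ∀ᵐ t ∂(volume.restrict (Icc 0 T)), deriv γ t = v t :=
  h.ae_hasDerivAt.mono fun _ ht => ht.deriv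

theorem isW12 (h : HasVelocity T γ v) : IsW12 T γ :=
  ⟨h.absolutelyContinuous, h.memLp.ae_eq (h.ae_deriv_eq.mono fun _ ht => ht.symm)⟩

theorem action_eq (h : HasVelocity T γ v) :
    action T γ = (1 / 2) * ∫ t in (0 : ℝ)..T, ⟪-(stdJ n (v t)), γ t⟫ := by
  rw [action]
  congr 1
  exact integral_congr_ae_Icc h.nonneg (h.ae_deriv_eq.mono fun t ht => by rw [ht])

theorem primitive (hT : 0 ≤ T) (hv : MemLp v 2 (volume.restrict (Icc 0 T))) (x : PhaseSpace n) :
    HasVelocity T (fun t => x + ∫ r in (0 : ℝ)..t, v r) v :=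
  ⟨hT, hv, fun t _ => by simp⟩

theorem add {y v' : ℝ → PhaseSpace n} (h : HasVelocity T γ v) (h' : HasVelocity T y v') :
    HasVelocity T (fun t => γ t + y t) (fun t => v t + v' t) := by
  refine ⟨h.nonneg, h.memLp.add h'.memLp, fun t ht => ?_⟩
  have h0 : (0 : ℝ) ∈ Icc 0 T := ⟨le_rfl, h.nonneg⟩
  rw [intervalIntegral.integral_add (h.intervalIntegrable_sub h0 ht)
    (h'.intervalIntegrable_sub h0 ht), h.eq_add t ht, h'.eq_add t ht]
  abel

theorem const_smul (h : HasVelocity T γ v) (c : ℝ) :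
    HasVelocity T (fun t => c • γ t) (fun t => c • v t) := by
  refine ⟨h.nonneg, h.memLp.const_smul c, fun t ht => ?_⟩
  rw [intervalIntegral.integral_smul, h.eq_add t ht, smul_add]

theorem add_const (h : HasVelocity T γ v) (x : PhaseSpace n) :
    HasVelocity T (fun t => γ t + x) v := by
  refine ⟨h.nonneg, h.memLp, fun t ht => ?_⟩
  rw [h.eq_add t ht]
  abel

theorem neg_stdJ_memLp (h : HasVelocity T γ v) :
    MemLp (fun t => -(stdJ n (v t))) 2 (volume.restrict (Icc 0 T)) :=
  ((stdJ n).comp_memLp' h.memLp).neg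

theorem intervalIntegrable_inner {w y : ℝ → PhaseSpace n} {a b : ℝ}
    (hw : IntervalIntegrable w volume a b) (hy : ContinuousOn y (uIcc a b)) :
    IntervalIntegrable (fun t => ⟪w t, y t⟫) volume a b := by
  have h1 : ∀ i, IntervalIntegrable (fun t => w t i * y t i) volume a b := fun i => by
    refine IntervalIntegrable.mul_continuousOn ?_ ?_
    · exact ⟨(EuclideanSpace.proj (𝕜 := ℝ) i).integrable_comp hw.1,
        (EuclideanSpace.proj (𝕜 := ℝ) i).integrable_comp hw.2⟩
    · exact (EuclideanSpace.proj (𝕜 := ℝ) i).continuous.comp_continuousOn hy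
  have h2 := IntervalIntegrable.sum Finset.univ fun i _ => h1 i
  refine h2.congr_ae (Eventually.of_forall fun t => ?_)
  simp [PiLp.inner_apply, mul_comm]

/-- Integration by parts. -/
theorem integral_inner_add {y v' : ℝ → PhaseSpace n} (h : HasVelocity T γ v)
    (h' : HasVelocity T y v') :
    (∫ t in (0 : ℝ)..T, ⟪v t, y t⟫) + ∫ t in (0 : ℝ)..T, ⟪v' t, γ t⟫ =
      ⟪γ T, y T⟫ - ⟪γ 0, y 0⟫ := by
  have hc := h.absolutelyContinuous.continuousOn
  have hc' := h'.absolutelyContinuous.continuousOn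
  obtain ⟨C, hC⟩ := isCompact_uIcc.exists_bound_of_continuousOn hc
  obtain ⟨C', hC'⟩ := isCompact_uIcc.exists_bound_of_continuousOn hc'
  have hAC : AbsolutelyContinuousOnInterval (fun t => ⟪γ t, y t⟫) 0 T := by
    refine h.absolutelyContinuous.of_dist_le h'.absolutelyContinuous (C := max C C')
      fun s hs t ht => ?_
    have e : ⟪γ s, y s⟫ - ⟪γ t, y t⟫ = ⟪γ s - γ t, y s⟫ + ⟪γ t, y s - y t⟫ := by
      rw [inner_sub_left, inner_sub_right]; ring
    rw [Real.dist_eq, e, dist_eq_norm, dist_eq_norm]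
    have h1 := abs_real_inner_le_norm (γ s - γ t) (y s)
    have h2 := abs_real_inner_le_norm (γ t) (y s - y t)
    have h3 : ‖y s‖ ≤ max C C' := (hC' s hs).trans (le_max_right _ _)
    have h4 : ‖γ t‖ ≤ max C C' := (hC t ht).trans (le_max_left _ _)
    have h5 := mul_le_mul_of_nonneg_left h3 (norm_nonneg (γ s - γ t))
    have h6 := mul_le_mul_of_nonneg_right h4 (norm_nonneg (y s - y t))
    have h7 := abs_add_le ⟪γ s - γ t, y s⟫ ⟪γ t, y s - y t⟫
    linarith
  rw [← hAC.integral_deriv_eq_sub, ← intervalIntegral.integral_add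
    (intervalIntegrable_inner h.intervalIntegrable hc')
    (intervalIntegrable_inner h'.intervalIntegrable hc)]
  refine integral_congr_ae_Icc h.nonneg ?_
  filter_upwards [h.ae_hasDerivAt, h'.ae_hasDerivAt] with t ht ht'
  rw [(ht.inner ℝ ht').deriv, real_inner_comm (γ t) (v' t), add_comm]

/-- For closed curves the area form is symmetric. -/
theorem integral_inner_neg_stdJ_comm {y v' : ℝ → PhaseSpace n} (h : HasVelocity T γ v)
    (h' : HasVelocity T y v') (hc : γ 0 = γ T) (hc' : y 0 = y T) :
    ∫ t in (0 : ℝ)..T, ⟪-(stdJ n (v t)), y t⟫ = ∫ t in (0 : ℝ)..T, ⟪-(stdJ n (v' t)), γ t⟫ := by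
  have hJ : HasVelocity T (fun t => stdJ n (γ t)) (fun t => stdJ n (v t)) := by
    refine ⟨h.nonneg, (stdJ n).comp_memLp' h.memLp, fun t ht => ?_⟩
    have h0 : (0 : ℝ) ∈ Icc 0 T := ⟨le_rfl, h.nonneg⟩
    rw [(stdJ n).intervalIntegral_comp_comm (h.intervalIntegrable_sub h0 ht), h.eq_add t ht,
      map_add]
  have := hJ.integral_inner_add h'
  rw [← hc, ← hc', sub_self] at this
  simp only [inner_stdJ_right, inner_neg_left] at this ⊢
  rw [intervalIntegral.integral_neg] at this ⊢
  rw [intervalIntegral.integral_neg]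
  linarith

end HasVelocity

theorem IsW12.hasVelocity {T : ℝ} {γ : ℝ → PhaseSpace n} (hT : 0 ≤ T) (h : IsW12 T γ) :
    HasVelocity T γ (deriv γ) := by
  refine ⟨hT, h.2, ?_⟩
  have hint := intervalIntegrable_of_memLp hT h.2
  have hg : AbsolutelyContinuousOnInterval (fun t => γ t - ∫ r in (0 : ℝ)..t, deriv γ r) 0 T :=
    h.1.sub (AbsolutelyContinuousOnInterval.primitive hint left_mem_uIcc)
  obtain ⟨C, hC⟩ := hg.const_of_ae_hasDerivAt_zero (by
    filter_upwards [h.1.boundedVariationOn.ae_differentiableAt_of_mem_uIcc,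
      hint.ae_hasDerivAt_integral] with t h1 h2 ht
    have h3 := (h1 ht).hasDerivAt.sub (h2 ht 0 left_mem_uIcc)
    rw [sub_self] at h3
    exact h3)
  intro t ht
  rw [uIcc_of_le hT] at hC
  have h0 := hC 0 ⟨le_rfl, hT⟩
  have h1 := hC t ht
  simp only [intervalIntegral.integral_same, sub_zero] at h0
  rw [h0, ← h1]
  abel

/-! ### Support functions and normal cones -/

/-- The support function of `K`. -/
def supportFn (K : Set (PhaseSpace n)) (w : PhaseSpace n) : ℝ := sSup ((fun y => ⟪w, y⟫) '' K)

section SupportFn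

variable {K : Set (PhaseSpace n)}

theorem inner_le_supportFn (hKc : IsCompact K) (w : PhaseSpace n) {y : PhaseSpace n}
    (hy : y ∈ K) : ⟪w, y⟫ ≤ supportFn K w :=
  le_csSup (hKc.image (by fun_prop)).bddAbove ⟨y, hy, rfl⟩

theorem supportFn_le (hne : K.Nonempty) {w : PhaseSpace n} {c : ℝ} (h : ∀ y ∈ K, ⟪w, y⟫ ≤ c) :
    supportFn K w ≤ c :=
  csSup_le (hne.image _) (by rintro _ ⟨y, hy, rfl⟩; exact h y hy)

theorem supportFn_zero (hne : K.Nonempty) : supportFn K 0 = 0 := by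
  obtain ⟨y, hy⟩ := hne
  have : (fun y => ⟪(0 : PhaseSpace n), y⟫) '' K = {0} := by
    ext a
    simp only [inner_zero_left, mem_image, mem_singleton_iff]
    exact ⟨fun ⟨_, _, h⟩ => h.symm, fun h => ⟨y, hy, h.symm⟩⟩
  rw [supportFn, this, csSup_singleton]

theorem supportFn_add_le (hKc : IsCompact K) (hne : K.Nonempty) (v w : PhaseSpace n) :
    supportFn K (v + w) ≤ supportFn K v + supportFn K w :=
  supportFn_le hne fun y hy => by
    rw [inner_add_left]
    exact add_le_add (inner_le_supportFn hKc v hy) (inner_le_supportFn hKc w hy)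

theorem supportFn_smul_le (hKc : IsCompact K) (hne : K.Nonempty) {c : ℝ} (hc : 0 ≤ c)
    (w : PhaseSpace n) : supportFn K (c • w) ≤ c * supportFn K w :=
  supportFn_le hne fun y hy => by
    rw [real_inner_smul_left]
    exact mul_le_mul_of_nonneg_left (inner_le_supportFn hKc w hy) hc

theorem supportFn_mono {K' : Set (PhaseSpace n)} (hKc : IsCompact K) (hne : K'.Nonempty)
    (h : K' ⊆ K) (w : PhaseSpace n) : supportFn K' w ≤ supportFn K w :=
  supportFn_le hne fun _ hy => inner_le_supportFn hKc w (h hy)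

theorem supportFn_eq_of_mem_normalCone (hKc : IsCompact K) {x w : PhaseSpace n} (hx : x ∈ K)
    (hw : w ∈ normalCone K x) : supportFn K w = ⟪w, x⟫ := by
  refine le_antisymm (supportFn_le ⟨x, hx⟩ fun y hy => ?_) (inner_le_supportFn hKc w hx)
  have := hw y hy
  rw [inner_sub_right] at this
  linarith

theorem mem_normalCone_of_supportFn_le (hKc : IsCompact K) {x w : PhaseSpace n}
    (hw : supportFn K w ≤ ⟪w, x⟫) : w ∈ normalCone K x := fun y hy => by
  rw [inner_sub_right]
  linarith [inner_le_supportFn hKc w hy]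

theorem exists_lipschitzWith_supportFn (hKc : IsCompact K) (hne : K.Nonempty) :
    ∃ C, LipschitzWith C (supportFn K) := by
  obtain ⟨R, hR⟩ := hKc.exists_bound_of_continuousOn continuousOn_id
  have hR0 : 0 ≤ R := by
    obtain ⟨y, hy⟩ := hne
    exact (norm_nonneg _).trans (hR y hy)
  refine ⟨⟨R, hR0⟩, LipschitzWith.of_le_add_mul _ fun v w => supportFn_le hne fun y hy => ?_⟩
  have h1 := inner_le_supportFn hKc w hy
  have h2 : ⟪v - w, y⟫ ≤ ‖v - w‖ * R :=
    (real_inner_le_norm _ _).trans (mul_le_mul_of_nonneg_left (hR y hy) (norm_nonneg _))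
  rw [inner_sub_left] at h2
  rw [dist_eq_norm]
  change _ ≤ _ + R * _
  linarith

theorem memLp_supportFn (hKc : IsCompact K) (hne : K.Nonempty) {w : ℝ → PhaseSpace n} {T : ℝ}
    (hw : MemLp w 2 (volume.restrict (Icc 0 T))) :
    MemLp (fun t => supportFn K (w t)) 2 (volume.restrict (Icc 0 T)) := by
  obtain ⟨C, hC⟩ := exists_lipschitzWith_supportFn hKc hne
  exact hC.comp_memLp (supportFn_zero hne) hw

theorem mul_norm_le_of_forall_inner_le {p d : PhaseSpace n} {r c : ℝ}
    (hr : 0 ≤ r) (hB : Metric.closedBall p r ⊆ K) (h : ∀ y ∈ K, ⟪d, y - p⟫ ≤ c) : r * ‖d‖ ≤ c := by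
  rcases eq_or_ne d 0 with rfl | hd
  · simpa using h p (hB (Metric.mem_closedBall_self hr))
  have hd' : ‖d‖ ≠ 0 := norm_ne_zero_iff.2 hd
  have hy : p + (r / ‖d‖) • d ∈ K := hB (by
    rw [Metric.mem_closedBall, dist_eq_norm, add_sub_cancel_left, norm_smul, Real.norm_eq_abs,
      abs_of_nonneg (by positivity), div_mul_cancel₀ _ hd'])
  have := h _ hy
  rw [add_sub_cancel_left, real_inner_smul_right, real_inner_self_eq_norm_sq] at this
  calc r * ‖d‖ = r / ‖d‖ * ‖d‖ ^ 2 := by field_simp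
    _ ≤ c := this

theorem mul_norm_le_supportFn_sub {p : PhaseSpace n} {r : ℝ} (hKc : IsCompact K) (hr : 0 ≤ r)
    (hB : Metric.closedBall p r ⊆ K) (w : PhaseSpace n) :
    r * ‖w‖ ≤ supportFn K w - ⟪w, p⟫ :=
  mul_norm_le_of_forall_inner_le hr hB fun y hy => by
    rw [inner_sub_right]
    linarith [inner_le_supportFn hKc w hy]

theorem exists_closedBall_subset_of_mem_interior {p : PhaseSpace n} (hp : p ∈ interior K) :
    ∃ r, 0 < r ∧ Metric.closedBall p r ⊆ K :=
  (Metric.nhds_basis_closedBall.mem_iff).1 (mem_interior_iff_mem_nhds.1 hp)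

theorem eq_zero_of_mem_normalCone_of_mem_interior {x w : PhaseSpace n} (hx : x ∈ interior K)
    (hw : w ∈ normalCone K x) : w = 0 := by
  obtain ⟨r, hr, hB⟩ := exists_closedBall_subset_of_mem_interior hx
  have := mul_norm_le_of_forall_inner_le (d := w) (c := 0) hr.le hB fun y hy => by
    have := hw y hy
    rw [← neg_sub, inner_neg_right] at this
    linarith
  have h2 : ‖w‖ ≤ 0 := by nlinarith [norm_nonneg w]
  simpa using h2

end SupportFn

/-! ### The length of a curve with respect to the support function -/

/-- The length of a curve with velocity `v`, measured by the support function of `K`. -/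
def supportLength (K : Set (PhaseSpace n)) (T : ℝ) (v : ℝ → PhaseSpace n) : ℝ :=
  ∫ t in (0 : ℝ)..T, supportFn K (-(stdJ n (v t)))

namespace HasVelocity

variable {K : Set (PhaseSpace n)} {T : ℝ} {γ v : ℝ → PhaseSpace n}

theorem intervalIntegrable_supportFn (h : HasVelocity T γ v) (hKc : IsCompact K)
    (hne : K.Nonempty) : IntervalIntegrable (fun t => supportFn K (-(stdJ n (v t)))) volume 0 T :=
  intervalIntegrable_of_memLp h.nonneg (memLp_supportFn hKc hne h.neg_stdJ_memLp)

theorem intervalIntegrable_neg_stdJ (h : HasVelocity T γ v) :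
    IntervalIntegrable (fun t => -(stdJ n (v t))) volume 0 T :=
  intervalIntegrable_of_memLp h.nonneg h.neg_stdJ_memLp

theorem intervalIntegrable_inner_const (h : HasVelocity T γ v) (x : PhaseSpace n) :
    IntervalIntegrable (fun t => ⟪-(stdJ n (v t)), x⟫) volume 0 T :=
  intervalIntegrable_inner h.intervalIntegrable_neg_stdJ continuousOn_const

theorem intervalIntegrable_inner_curve (h : HasVelocity T γ v) {y : ℝ → PhaseSpace n}
    (hy : ContinuousOn y (Icc 0 T)) :
    IntervalIntegrable (fun t => ⟪-(stdJ n (v t)), y t⟫) volume 0 T :=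
  intervalIntegrable_inner h.intervalIntegrable_neg_stdJ (by rwa [uIcc_of_le h.nonneg])

theorem integral_inner_const_sub (h : HasVelocity T γ v) (x : PhaseSpace n) {a b : ℝ}
    (ha : a ∈ Icc 0 T) (hb : b ∈ Icc 0 T) :
    ∫ t in a..b, ⟪-(stdJ n (v t)), x⟫ = ⟪-(stdJ n (γ b - γ a)), x⟫ := by
  have h1 := (innerSL ℝ x ∘L (-stdJ n)).intervalIntegral_comp_comm
    (h.intervalIntegrable_sub ha hb)
  rw [← h.sub_eq ha hb] at h1
  have e : ∀ d, (innerSL ℝ x ∘L (-stdJ n)) d = ⟪-(stdJ n d), x⟫ := fun d => by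
    simp [real_inner_comm x]
  simpa only [e] using h1

theorem integral_inner_const (h : HasVelocity T γ v) (x : PhaseSpace n) :
    ∫ t in (0 : ℝ)..T, ⟪-(stdJ n (v t)), x⟫ = ⟪-(stdJ n (γ T - γ 0)), x⟫ :=
  h.integral_inner_const_sub x ⟨le_rfl, h.nonneg⟩ ⟨h.nonneg, le_rfl⟩

theorem integral_inner_const_of_closed (h : HasVelocity T γ v) (hc : γ 0 = γ T)
    (x : PhaseSpace n) : ∫ t in (0 : ℝ)..T, ⟪-(stdJ n (v t)), x⟫ = 0 := by
  rw [h.integral_inner_const, hc]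
  simp

theorem supportLength_eq (h : HasVelocity T γ v) (hc : γ 0 = γ T) (hKc : IsCompact K)
    (hne : K.Nonempty) (p : PhaseSpace n) :
    supportLength K T v =
      ∫ t in (0 : ℝ)..T, (supportFn K (-(stdJ n (v t))) - ⟪-(stdJ n (v t)), p⟫) := by
  rw [intervalIntegral.integral_sub (h.intervalIntegrable_supportFn hKc hne)
    (h.intervalIntegrable_inner_const p), h.integral_inner_const_of_closed hc, sub_zero,
    supportLength]

theorem mul_integral_norm_le (h : HasVelocity T γ v) (hc : γ 0 = γ T) (hKc : IsCompact K)
    {p : PhaseSpace n} {r : ℝ} (hr : 0 ≤ r) (hB : Metric.closedBall p r ⊆ K) :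
    r * ∫ t in (0 : ℝ)..T, ‖v t‖ ≤ supportLength K T v := by
  have hne : K.Nonempty := ⟨p, hB (Metric.mem_closedBall_self hr)⟩
  rw [h.supportLength_eq hc hKc hne p, ← intervalIntegral.integral_const_mul]
  refine intervalIntegral.integral_mono_on h.nonneg (h.intervalIntegrable.norm.const_mul r)
    ((h.intervalIntegrable_supportFn hKc hne).sub (h.intervalIntegrable_inner_const p))
    fun t _ => ?_
  have := mul_norm_le_supportFn_sub hKc hr hB (-(stdJ n (v t)))
  rwa [norm_neg, norm_stdJ] at this

theorem norm_sub_le (h : HasVelocity T γ v) {a b : ℝ} (ha : a ∈ Icc 0 T) (hb : b ∈ Icc 0 T)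
    (hab : a ≤ b) : ‖γ b - γ a‖ ≤ ∫ t in a..b, ‖v t‖ := by
  rw [h.sub_eq ha hb]
  exact intervalIntegral.norm_integral_le_integral_norm hab

theorem integral_norm_mono (h : HasVelocity T γ v) {a b a' b' : ℝ} (ha : 0 ≤ a) (haa : a ≤ a')
    (hab : a' ≤ b') (hbb : b' ≤ b) (hb : b ≤ T) :
    ∫ t in a'..b', ‖v t‖ ≤ ∫ t in a..b, ‖v t‖ :=
  intervalIntegral.integral_mono_interval haa hab hbb (Eventually.of_forall fun _ => norm_nonneg _)
    (h.intervalIntegrable_sub ⟨ha, by linarith⟩ ⟨by linarith, hb⟩).norm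

theorem supportLength_nonneg (h : HasVelocity T γ v) (hc : γ 0 = γ T) (hKc : IsCompact K)
    (hi : (interior K).Nonempty) : 0 ≤ supportLength K T v := by
  obtain ⟨p, hp⟩ := hi
  obtain ⟨r, hr, hB⟩ := exists_closedBall_subset_of_mem_interior hp
  exact (mul_nonneg hr.le (intervalIntegral.integral_nonneg h.nonneg
    fun _ _ => norm_nonneg _)).trans (h.mul_integral_norm_le hc hKc hr.le hB)

theorem supportLength_pos (h : HasVelocity T γ v) (hc : γ 0 = γ T) (hKc : IsCompact K)
    (hi : (interior K).Nonempty) (hnc : ∃ t ∈ Icc 0 T, γ t ≠ γ 0) : 0 < supportLength K T v := by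
  obtain ⟨p, hp⟩ := hi
  obtain ⟨r, hr, hB⟩ := exists_closedBall_subset_of_mem_interior hp
  refine lt_of_lt_of_le (mul_pos hr ?_) (h.mul_integral_norm_le hc hKc hr.le hB)
  obtain ⟨t, ht, hne⟩ := hnc
  have h1 := h.norm_sub_le ⟨le_rfl, h.nonneg⟩ ht ht.1
  have h2 := h.integral_norm_mono le_rfl le_rfl ht.1 ht.2 le_rfl
  exact (norm_pos_iff.2 (sub_ne_zero.2 hne)).trans_le (h1.trans h2)

theorem action_add_const (h : HasVelocity T γ v) (hc : γ 0 = γ T) (x : PhaseSpace n) :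
    action T (fun t => γ t + x) = action T γ := by
  rw [(h.add_const x).action_eq, h.action_eq]
  simp only [inner_add_right]
  rw [intervalIntegral.integral_add (h.intervalIntegrable_inner_curve h.continuousOn)
    (h.intervalIntegrable_inner_const x), h.integral_inner_const_of_closed hc, add_zero]

end HasVelocity

namespace IsClosedCharacteristic

variable {K : Set (PhaseSpace n)} {T : ℝ} {γ : ℝ → PhaseSpace n}

theorem hasVelocity (h : IsClosedCharacteristic K T γ) : HasVelocity T γ (deriv γ) :=
  h.isW12.hasVelocity h.period_pos.le

theorem mem (h : IsClosedCharacteristic K T γ) (hKc : IsCompact K) {t : ℝ} (ht : t ∈ Icc 0 T) :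
    γ t ∈ K := hKc.isClosed.frontier_subset (h.mem_frontier t ht)

theorem supportLength_eq (h : IsClosedCharacteristic K T γ) (hKc : IsCompact K) :
    supportLength K T (deriv γ) = 2 * action T γ := by
  rw [action, ← mul_assoc, supportLength]
  norm_num only [one_mul]
  refine integral_congr_ae_Icc h.period_pos.le ?_
  filter_upwards [h.velocity_mem, ae_restrict_mem measurableSet_Icc] with t ht hmem
  rw [supportFn_eq_of_mem_normalCone hKc (h.mem hKc hmem) ht]

theorem action_pos (h : IsClosedCharacteristic K T γ) (hKc : IsCompact K)
    (hi : (interior K).Nonempty) : 0 < action T γ := by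
  have := h.hasVelocity.supportLength_pos h.closed hKc hi h.nonconstant
  rw [h.supportLength_eq hKc] at this
  linarith

end IsClosedCharacteristic

/-! ### The isoperimetric inequality for closed curves -/

theorem eq_of_abs_sub_le_mul_sq {f : ℝ → ℝ} {C : ℝ}
    (h : ∀ s t, 0 ≤ s → s ≤ t → t ≤ 1 → |f t - f s| ≤ C * (t - s) ^ 2) : f 1 = f 0 := by
  have hN : ∀ N : ℕ, |f 1 - f 0| ≤ C * (1 / ((N : ℝ) + 1)) := fun N => by
    have hpos : (0 : ℝ) < N + 1 := by positivity
    have hk : ∀ k : ℕ, k ≤ N + 1 →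
        |f (k / ((N : ℝ) + 1)) - f 0| ≤ k * (C * (1 / ((N : ℝ) + 1)) ^ 2) := by
      intro k
      induction k with
      | zero => intro _; simp
      | succ k ih =>
        intro hkN
        have h1 := ih (by omega)
        have hkN' : ((k : ℝ) + 1) ≤ N + 1 := by exact_mod_cast hkN
        have h2 := h (k / ((N : ℝ) + 1)) ((k + 1) / ((N : ℝ) + 1)) (by positivity) (by gcongr; simp)
          (by rw [div_le_one hpos]; exact hkN')
        have e : ((k : ℝ) + 1) / (N + 1) - k / (N + 1) = 1 / (N + 1) := by ring
        rw [e] at h2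
        push_cast
        have h3 := abs_sub_le (f ((k + 1) / ((N : ℝ) + 1))) (f (k / ((N : ℝ) + 1))) (f 0)
        linarith
    have := hk (N + 1) le_rfl
    push_cast at this
    rw [div_self hpos.ne'] at this
    calc _ ≤ _ := this
      _ = _ := by field_simp
  have hlim : Tendsto (fun N : ℕ => C * (1 / ((N : ℝ) + 1))) atTop (𝓝 (C * 0)) :=
    tendsto_one_div_add_atTop_nhds_zero_nat.const_mul C
  have := ge_of_tendsto' hlim hN
  rw [mul_zero] at this
  exact sub_eq_zero.1 (abs_nonpos_iff.1 this)

namespace HasVelocity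

variable {K : Set (PhaseSpace n)} {T : ℝ} {γ v : ℝ → PhaseSpace n}

theorem abs_integral_inner_sub_le (h : HasVelocity T γ v) (x : PhaseSpace n) {a b C : ℝ}
    (ha : 0 ≤ a) (hab : a ≤ b) (hb : b ≤ T) (hC : ∫ t in a..b, ‖v t‖ ≤ C) :
    |(∫ t in a..b, ⟪-(stdJ n (v t)), γ t - x⟫) - ⟪-(stdJ n (γ b - γ a)), γ a - x⟫| ≤ C ^ 2 := by
  have ha' : a ∈ Icc 0 T := ⟨ha, hab.trans hb⟩
  have hb' : b ∈ Icc 0 T := ⟨ha.trans hab, hb⟩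
  have hsub : uIcc a b ⊆ Icc 0 T := by
    rw [uIcc_of_le hab]; exact Icc_subset_Icc ha hb
  have hJ : IntervalIntegrable (fun t => -(stdJ n (v t))) volume a b :=
    h.intervalIntegrable_neg_stdJ.mono_set (by rwa [uIcc_of_le h.nonneg])
  have hcont : ContinuousOn γ (uIcc a b) := h.continuousOn.mono hsub
  rw [← h.integral_inner_const_sub _ ha' hb', ← intervalIntegral.integral_sub
    (intervalIntegrable_inner (y := fun t => γ t - x) hJ (hcont.sub continuousOn_const))
    (intervalIntegrable_inner hJ continuousOn_const)]
  have hvi := (h.intervalIntegrable_sub ha' hb').norm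
  have hC0 : 0 ≤ C := (intervalIntegral.integral_nonneg hab fun _ _ => norm_nonneg _).trans hC
  have h1 : ∀ t ∈ Icc a b,
      ‖⟪-(stdJ n (v t)), γ t - x⟫ - ⟪-(stdJ n (v t)), γ a - x⟫‖ ≤ ‖v t‖ * C := fun t ht => by
    rw [← inner_sub_right, sub_sub_sub_cancel_right]
    refine (norm_inner_le_norm _ _).trans ?_
    rw [norm_neg, norm_stdJ]
    refine mul_le_mul_of_nonneg_left ?_ (norm_nonneg _)
    have h2 := h.norm_sub_le ha' ⟨ha.trans ht.1, ht.2.trans hb⟩ ht.1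
    exact h2.trans ((h.integral_norm_mono ha le_rfl ht.1 ht.2 hb).trans hC)
  rw [← Real.norm_eq_abs]
  calc _ ≤ ∫ t in a..b, ‖v t‖ * C :=
        intervalIntegral.norm_integral_le_of_norm_le hab
          (Eventually.of_forall fun t ht => h1 t (Ioc_subset_Icc_self ht)) (hvi.mul_const C)
    _ = (∫ t in a..b, ‖v t‖) * C := intervalIntegral.integral_mul_const _ _
    _ ≤ C * C := mul_le_mul_of_nonneg_right hC hC0
    _ = C ^ 2 := by ring

end HasVelocity

theorem LipschitzWith.hasVelocity {C : NNReal} {γ : ℝ → PhaseSpace n} (h : LipschitzWith C γ)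
    {T : ℝ} (hT : 0 ≤ T) : HasVelocity T γ (deriv γ) := by
  refine IsW12.hasVelocity hT ⟨(h.lipschitzOnWith (s := uIcc 0 T)).absolutelyContinuousOnInterval,
    ?_⟩
  exact MemLp.of_bound (aestronglyMeasurable_deriv _ _) C
    (Eventually.of_forall fun t => norm_deriv_le_of_lipschitz h)

/-- The closed curves on `[0,1]` based at `0` whose speed, measured by the support function of
`K - p`, is at most `1`. -/
def unitLoops (K : Set (PhaseSpace n)) (p : PhaseSpace n) :
    Set (BoundedContinuousFunction (Icc (0 : ℝ) 1) (PhaseSpace n)) :=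
  {f | f ⟨0, by simp⟩ = 0 ∧ f ⟨1, by simp⟩ = 0 ∧
    ∀ s t : Icc (0 : ℝ) 1, s ≤ t → ∀ y ∈ K, ⟪-(stdJ n (f t - f s)), y - p⟫ ≤ (t : ℝ) - s}

/-- The curve on `ℝ` that extends `f` by constants. -/
def extendCurve (f : BoundedContinuousFunction (Icc (0 : ℝ) 1) (PhaseSpace n)) :
    ℝ → PhaseSpace n := IccExtend (zero_le_one (α := ℝ)) f

theorem extendCurve_of_mem (f : BoundedContinuousFunction (Icc (0 : ℝ) 1) (PhaseSpace n)) {t : ℝ}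
    (ht : t ∈ Icc (0 : ℝ) 1) : extendCurve f t = f ⟨t, ht⟩ := IccExtend_of_mem _ _ ht

section UnitLoops

variable {K : Set (PhaseSpace n)} {p : PhaseSpace n} {r : ℝ}

theorem norm_sub_le_of_mem_unitLoops (hr : 0 < r) (hB : Metric.closedBall p r ⊆ K)
    {f : BoundedContinuousFunction (Icc (0 : ℝ) 1) (PhaseSpace n)} (hf : f ∈ unitLoops K p)
    (s t : Icc (0 : ℝ) 1) : ‖f t - f s‖ ≤ r⁻¹ * |(t : ℝ) - s| := by
  wlog hst : s ≤ t generalizing s t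
  · rw [norm_sub_rev, abs_sub_comm]
    exact this t s (le_of_not_ge hst)
  have h1 := mul_norm_le_of_forall_inner_le hr.le hB (hf.2.2 s t hst)
  rw [norm_neg, norm_stdJ] at h1
  rw [abs_of_nonneg (sub_nonneg.2 (Subtype.coe_le_coe.2 hst)), inv_mul_eq_div, le_div_iff₀ hr]
  linarith

theorem lipschitzWith_of_mem_unitLoops (hr : 0 < r) (hB : Metric.closedBall p r ⊆ K)
    {f : BoundedContinuousFunction (Icc (0 : ℝ) 1) (PhaseSpace n)} (hf : f ∈ unitLoops K p) :
    LipschitzWith (Real.toNNReal r⁻¹) f := by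
  refine LipschitzWith.of_dist_le_mul fun s t => ?_
  rw [dist_eq_norm, Real.coe_toNNReal _ (by positivity), Subtype.dist_eq, Real.dist_eq]
  exact norm_sub_le_of_mem_unitLoops hr hB hf t s

theorem lipschitzWith_extendCurve (hr : 0 < r) (hB : Metric.closedBall p r ⊆ K)
    {f : BoundedContinuousFunction (Icc (0 : ℝ) 1) (PhaseSpace n)} (hf : f ∈ unitLoops K p) :
    LipschitzWith (Real.toNNReal r⁻¹) (extendCurve f) := by
  have := (lipschitzWith_of_mem_unitLoops hr hB hf).comp
    (LipschitzWith.projIcc (zero_le_one (α := ℝ)))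
  rw [mul_one] at this
  exact this

theorem extendCurve_closed {f : BoundedContinuousFunction (Icc (0 : ℝ) 1) (PhaseSpace n)}
    (hf : f ∈ unitLoops K p) : extendCurve f 0 = extendCurve f 1 := by
  rw [extendCurve_of_mem f (by simp), extendCurve_of_mem f (by simp), hf.1, hf.2.1]

theorem isCompact_unitLoops (hr : 0 < r) (hB : Metric.closedBall p r ⊆ K) :
    IsCompact (unitLoops K p) := by
  have hev : ∀ s : Icc (0 : ℝ) 1, Continuous
      fun f : BoundedContinuousFunction (Icc (0 : ℝ) 1) (PhaseSpace n) => f s :=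
    fun s => continuous_eval_const s
  refine BoundedContinuousFunction.arzela_ascoli₂ (Metric.closedBall 0 r⁻¹)
    (isCompact_closedBall _ _) _ ?_ ?_ ?_
  · refine (isClosed_eq (hev _) continuous_const).inter
      ((isClosed_eq (hev _) continuous_const).inter ?_)
    change IsClosed {f : BoundedContinuousFunction (Icc (0 : ℝ) 1) (PhaseSpace n) |
      ∀ s t : Icc (0 : ℝ) 1, s ≤ t → ∀ y ∈ K, ⟪-(stdJ n (f t - f s)), y - p⟫ ≤ (t : ℝ) - s}
    simp only [ofPred_forall]
    refine isClosed_iInter fun s => isClosed_iInter fun t => isClosed_iInter fun _ =>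
      isClosed_iInter fun y => isClosed_iInter fun _ => isClosed_le ?_ continuous_const
    have h1 := hev s
    have h2 := hev t
    fun_prop
  · intro f t hf
    have h1 := norm_sub_le_of_mem_unitLoops hr hB hf ⟨0, by simp⟩ t
    rw [hf.1, sub_zero] at h1
    rw [mem_closedBall_zero_iff]
    refine h1.trans (mul_le_of_le_one_right (by positivity) ?_)
    simp only [sub_zero]
    rw [abs_of_nonneg t.2.1]
    exact t.2.2
  · exact (LipschitzWith.uniformEquicontinuous _ _ fun f : unitLoops K p =>
      lipschitzWith_of_mem_unitLoops hr hB f.2).equicontinuous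

theorem abs_action_sub_le (hr : 0 < r) (hB : Metric.closedBall p r ⊆ K)
    {f g : BoundedContinuousFunction (Icc (0 : ℝ) 1) (PhaseSpace n)} (hf : f ∈ unitLoops K p)
    (hg : g ∈ unitLoops K p) :
    |action 1 (extendCurve f) - action 1 (extendCurve g)| ≤ r⁻¹ * dist f g := by
  have lf := lipschitzWith_extendCurve hr hB hf
  have lg := lipschitzWith_extendCurve hr hB hg
  have vf := lf.hasVelocity zero_le_one
  have vg := lg.hasVelocity zero_le_one
  have key : ∀ k ∈ unitLoops K p,
      |∫ t in (0 : ℝ)..1, ⟪-(stdJ n (deriv (extendCurve k) t)), extendCurve f t - extendCurve g t⟫|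
        ≤ r⁻¹ * dist f g := fun k hk => by
    have lk := lipschitzWith_extendCurve hr hB hk
    have := intervalIntegral.norm_integral_le_of_norm_le_const (a := 0) (b := 1)
      (C := r⁻¹ * dist f g)
      (f := fun t => ⟪-(stdJ n (deriv (extendCurve k) t)), extendCurve f t - extendCurve g t⟫) ?_
    · simpa using this
    intro t _
    refine (norm_inner_le_norm _ _).trans ?_
    rw [norm_neg, norm_stdJ]
    have h1 := norm_deriv_le_of_lipschitz (x₀ := t) lk
    rw [Real.coe_toNNReal _ (by positivity)] at h1
    have h2 : ‖extendCurve f t - extendCurve g t‖ ≤ dist f g := by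
      rw [← dist_eq_norm]
      exact BoundedContinuousFunction.dist_coe_le_dist _
    exact mul_le_mul h1 h2 (norm_nonneg _) (by positivity)
  have hff := vf.intervalIntegrable_inner_curve vf.continuousOn
  have hfg := vf.intervalIntegrable_inner_curve vg.continuousOn
  have hgf := vg.intervalIntegrable_inner_curve vf.continuousOn
  have hgg := vg.intervalIntegrable_inner_curve vg.continuousOn
  have h1 := key f hf
  have h2 := key g hg
  simp only [inner_sub_right] at h1 h2
  rw [intervalIntegral.integral_sub hff hfg] at h1
  rw [intervalIntegral.integral_sub hgf hgg] at h2
  have h3 := vf.integral_inner_neg_stdJ_comm vg (extendCurve_closed hf) (extendCurve_closed hg)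
  rw [action, action, abs_le]
  rw [abs_le] at h1 h2
  constructor <;> linarith [h1.1, h1.2, h2.1, h2.2]

theorem exists_isMaxOn_action_unitLoops (hr : 0 < r) (hB : Metric.closedBall p r ⊆ K) :
    ∃ f ∈ unitLoops K p, ∀ g ∈ unitLoops K p,
      action 1 (extendCurve g) ≤ action 1 (extendCurve f) := by
  have hcont : ContinuousOn (fun f => action 1 (extendCurve f)) (unitLoops K p) := by
    refine (LipschitzOnWith.of_dist_le_mul (K := Real.toNNReal r⁻¹) fun f hf g hg => ?_).continuousOn
    rw [Real.coe_toNNReal _ (by positivity), Real.dist_eq]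
    exact abs_action_sub_le hr hB hf hg
  exact (isCompact_unitLoops hr hB).exists_isMaxOn
    ⟨0, rfl, rfl, fun s t hst y _ => by simpa using hst⟩ hcont

/-- A closed curve can be reparametrized and rescaled to unit speed. -/
theorem exists_unitLoop {T : ℝ} {γ v : ℝ → PhaseSpace n} (hKc : IsCompact K) (hr : 0 < r)
    (hB : Metric.closedBall p r ⊆ K) (h : HasVelocity T γ v) (hc : γ 0 = γ T)
    (hL : 0 < supportLength K T v) :
    ∃ f ∈ unitLoops K p, action T γ = supportLength K T v ^ 2 * action 1 (extendCurve f) := by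
  have hne : K.Nonempty := ⟨p, hB (Metric.mem_closedBall_self hr.le)⟩
  set L := supportLength K T v with hLdef
  set g : ℝ → ℝ := fun t => supportFn K (-(stdJ n (v t))) - ⟪-(stdJ n (v t)), p⟫ with hg
  have hgi : IntervalIntegrable g volume 0 T :=
    (h.intervalIntegrable_supportFn hKc hne).sub (h.intervalIntegrable_inner_const p)
  have hgv : ∀ t, r * ‖v t‖ ≤ g t := fun t => by
    have := mul_norm_le_supportFn_sub hKc hr.le hB (-(stdJ n (v t)))
    rwa [norm_neg, norm_stdJ] at this
  set S : ℝ → ℝ := fun t => ∫ x in (0 : ℝ)..t, g x with hS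
  have h0T : (0 : ℝ) ∈ Icc 0 T := ⟨le_rfl, h.nonneg⟩
  have hgsub : ∀ {a b}, a ∈ Icc 0 T → b ∈ Icc 0 T → IntervalIntegrable g volume a b :=
    fun ha hb => hgi.mono_set
      (uIcc_subset_uIcc (by rwa [uIcc_of_le h.nonneg]) (by rwa [uIcc_of_le h.nonneg]))
  have hSsub : ∀ {a b}, a ∈ Icc 0 T → b ∈ Icc 0 T → S b - S a = ∫ x in a..b, g x :=
    fun ha hb => intervalIntegral.integral_interval_sub_left (hgsub h0T hb) (hgsub h0T ha)
  have hS0 : S 0 = 0 := by simp [hS]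
  have hST : S T = L := by
    rw [hLdef, h.supportLength_eq hc hKc hne p]
  have hScont : ContinuousOn S (Icc 0 T) := by
    have := intervalIntegral.continuousOn_primitive_interval' hgi left_mem_uIcc
    rwa [uIcc_of_le h.nonneg] at this
  have hnorm : ∀ {a b}, a ∈ Icc 0 T → b ∈ Icc 0 T → a ≤ b →
      ∫ t in a..b, ‖v t‖ ≤ r⁻¹ * (S b - S a) := fun {a b} ha hb hab => by
    rw [hSsub ha hb, ← intervalIntegral.integral_const_mul]
    refine intervalIntegral.integral_mono_on hab (h.intervalIntegrable_sub ha hb).norm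
      ((hgsub ha hb).const_mul _) fun t _ => ?_
    rw [inv_mul_eq_div, le_div_iff₀ hr]
    linarith [hgv t]
  have hSmono : ∀ {a b}, a ∈ Icc 0 T → b ∈ Icc 0 T → a ≤ b → S a ≤ S b := fun {a b} ha hb hab => by
    have h1 := hSsub ha hb
    have h2 : 0 ≤ ∫ x in a..b, g x := intervalIntegral.integral_nonneg hab
      fun t _ => (mul_nonneg hr.le (norm_nonneg _)).trans (hgv t)
    linarith
  have hinner : ∀ {a b}, a ∈ Icc 0 T → b ∈ Icc 0 T → a ≤ b → ∀ y ∈ K,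
      ⟪-(stdJ n (γ b - γ a)), y - p⟫ ≤ S b - S a := fun {a b} ha hb hab y hy => by
    rw [hSsub ha hb, ← h.integral_inner_const_sub _ ha hb]
    refine intervalIntegral.integral_mono_on hab
      ((h.intervalIntegrable_inner_const _).mono_set
        (uIcc_subset_uIcc (by rwa [uIcc_of_le h.nonneg]) (by rwa [uIcc_of_le h.nonneg])))
      (hgsub ha hb) fun t _ => ?_
    rw [inner_sub_right]
    exact sub_le_sub_right (inner_le_supportFn hKc _ hy) _
  have hexists : ∀ σ : ℝ, ∃ t ∈ Icc 0 T, σ ∈ Icc (0 : ℝ) 1 → S t = L * σ := fun σ => by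
    by_cases hσ : σ ∈ Icc (0 : ℝ) 1
    · have := intermediate_value_Icc h.nonneg hScont
      rw [hS0, hST] at this
      obtain ⟨t, ht, hts⟩ := this ⟨mul_nonneg hL.le hσ.1, mul_le_of_le_one_right hL.le hσ.2⟩
      exact ⟨t, ht, fun _ => hts⟩
    · exact ⟨0, h0T, fun h => absurd h hσ⟩
  choose τ hτmem hτ using hexists
  have hτmono : ∀ {σ σ'}, σ ∈ Icc (0 : ℝ) 1 → σ' ∈ Icc (0 : ℝ) 1 → σ ≤ σ' → τ σ ≤ τ σ' :=
    fun {σ σ'} hσ hσ' hle => by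
    by_contra hlt
    push Not at hlt
    have h1 := hSmono (hτmem σ') (hτmem σ) hlt.le
    rw [hτ σ hσ, hτ σ' hσ'] at h1
    have h2 : σ = σ' := le_antisymm hle (le_of_mul_le_mul_left h1 hL)
    rw [h2] at hlt
    exact lt_irrefl _ hlt
  set ζ : ℝ → PhaseSpace n := fun σ => L⁻¹ • (γ (τ σ) - γ 0) with hζ
  have hζinner : ∀ {σ σ'}, σ ∈ Icc (0 : ℝ) 1 → σ' ∈ Icc (0 : ℝ) 1 → σ ≤ σ' → ∀ y ∈ K,
      ⟪-(stdJ n (ζ σ' - ζ σ)), y - p⟫ ≤ σ' - σ := fun {σ σ'} hσ hσ' hle y hy => by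
    have h1 := hinner (hτmem σ) (hτmem σ') (hτmono hσ hσ' hle) y hy
    rw [hτ σ hσ, hτ σ' hσ'] at h1
    have e : -(stdJ n (ζ σ' - ζ σ)) = L⁻¹ • -(stdJ n (γ (τ σ') - γ (τ σ))) := by
      rw [hζ, ← smul_sub, map_smul, sub_sub_sub_cancel_right, smul_neg]
    rw [e, real_inner_smul_left, inv_mul_eq_div, div_le_iff₀ hL]
    linarith
  have hlip : LipschitzWith (Real.toNNReal r⁻¹) (fun s : Icc (0 : ℝ) 1 => ζ s) := by
    refine LipschitzWith.of_dist_le_mul fun s t => ?_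
    rw [dist_eq_norm, Real.coe_toNNReal _ (by positivity), Subtype.dist_eq, Real.dist_eq]
    wlog hst : t ≤ s generalizing s t
    · rw [norm_sub_rev, abs_sub_comm]
      exact this t s (le_of_not_ge hst)
    have h1 := mul_norm_le_of_forall_inner_le hr.le hB (hζinner t.2 s.2 hst)
    rw [norm_neg, norm_stdJ] at h1
    rw [abs_of_nonneg (sub_nonneg.2 (Subtype.coe_le_coe.2 hst)), inv_mul_eq_div, le_div_iff₀ hr]
    linarith
  set f : BoundedContinuousFunction (Icc (0 : ℝ) 1) (PhaseSpace n) :=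
    BoundedContinuousFunction.mkOfCompact ⟨fun s : Icc (0 : ℝ) 1 => ζ s, hlip.continuous⟩ with hf
  have hfζ : ∀ s, f s = ζ s := fun s => rfl
  have hγeq : ∀ {a b}, a ∈ Icc 0 T → b ∈ Icc 0 T → a ≤ b → S a = S b → γ a = γ b :=
    fun {a b} ha hb hab hs => by
    have h1 := (h.norm_sub_le ha hb hab).trans (hnorm ha hb hab)
    rw [hs, sub_self, mul_zero, norm_le_zero_iff, sub_eq_zero] at h1
    exact h1.symm
  have hτ0 : γ (τ 0) = γ 0 := (hγeq h0T (hτmem 0) (hτmem 0).1 (by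
    rw [hτ 0 (by simp), hS0, mul_zero])).symm
  have hTT : T ∈ Icc 0 T := ⟨h.nonneg, le_rfl⟩
  have hτ1 : γ (τ 1) = γ T := hγeq (hτmem 1) hTT (hτmem 1).2 (by
    rw [hτ 1 (by simp), hST, mul_one])
  have hfmem : f ∈ unitLoops K p := by
    refine ⟨?_, ?_, fun s t hst y hy => ?_⟩
    · rw [hfζ, hζ]
      simp [hτ0]
    · rw [hfζ, hζ]
      simp [hτ1, hc]
    · rw [hfζ, hfζ]
      exact hζinner s.2 t.2 hst y hy
  refine ⟨f, hfmem, ?_⟩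
  have lf := lipschitzWith_extendCurve hr hB hfmem
  have vf := lf.hasVelocity (zero_le_one (α := ℝ))
  have hfe : ∀ σ ∈ Icc (0 : ℝ) 1, extendCurve f σ = ζ σ := fun σ hσ => by
    rw [extendCurve_of_mem f hσ, hfζ]
  have hIi : IntervalIntegrable (fun t => ⟪-(stdJ n (v t)), γ t - γ 0⟫) volume 0 T :=
    h.intervalIntegrable_inner_curve (h.continuousOn.sub continuousOn_const)
  have hZi : IntervalIntegrable (fun t => ⟪-(stdJ n (deriv (extendCurve f) t)),
      extendCurve f t - 0⟫) volume 0 1 :=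
    vf.intervalIntegrable_inner_curve (vf.continuousOn.sub continuousOn_const)
  set D : ℝ → ℝ := fun σ => (∫ t in (0 : ℝ)..(τ σ), ⟪-(stdJ n (v t)), γ t - γ 0⟫) -
    L ^ 2 * ∫ t in (0 : ℝ)..σ, ⟪-(stdJ n (deriv (extendCurve f) t)), extendCurve f t - 0⟫ with hD
  have hDle : ∀ s t, 0 ≤ s → s ≤ t → t ≤ 1 →
      |D t - D s| ≤ (2 * (L * r⁻¹) ^ 2) * (t - s) ^ 2 := by
    intro s t hs hst ht
    have hs' : s ∈ Icc (0 : ℝ) 1 := ⟨hs, hst.trans ht⟩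
    have ht' : t ∈ Icc (0 : ℝ) 1 := ⟨hs.trans hst, ht⟩
    have e1 := hnorm (hτmem s) (hτmem t) (hτmono hs' ht' hst)
    rw [hτ s hs', hτ t ht'] at e1
    have b1 := h.abs_integral_inner_sub_le (γ 0) (hτmem s).1 (hτmono hs' ht' hst) (hτmem t).2 e1
    have e2 : ∫ x in s..t, ‖deriv (extendCurve f) x‖ ≤ r⁻¹ * (t - s) := by
      have := intervalIntegral.norm_integral_le_of_norm_le_const (a := s) (b := t)
        (f := fun x => ‖deriv (extendCurve f) x‖) (C := r⁻¹) fun x _ => by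
          have h1 := norm_deriv_le_of_lipschitz (x₀ := x) lf
          rw [Real.coe_toNNReal _ (by positivity)] at h1
          rwa [norm_norm]
      rw [abs_of_nonneg (sub_nonneg.2 hst)] at this
      exact (le_abs_self _).trans this
    have b2 := vf.abs_integral_inner_sub_le 0 hs hst ht e2
    have hmem : ∀ x ∈ Icc (0 : ℝ) T, x ∈ uIcc 0 T := fun x hx => by rwa [uIcc_of_le h.nonneg]
    have hmem1 : ∀ x ∈ Icc (0 : ℝ) 1, x ∈ uIcc (0 : ℝ) 1 := fun x hx => by
      rwa [uIcc_of_le zero_le_one]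
    have i1 := intervalIntegral.integral_interval_sub_left
      (hIi.mono_set (uIcc_subset_uIcc (hmem _ h0T) (hmem _ (hτmem t))))
      (hIi.mono_set (uIcc_subset_uIcc (hmem _ h0T) (hmem _ (hτmem s))))
    have i2 := intervalIntegral.integral_interval_sub_left
      (hZi.mono_set (uIcc_subset_uIcc left_mem_uIcc (hmem1 _ ht')))
      (hZi.mono_set (uIcc_subset_uIcc left_mem_uIcc (hmem1 _ hs')))
    have e3 : ⟪-(stdJ n (γ (τ t) - γ (τ s))), γ (τ s) - γ 0⟫ =
        L ^ 2 * ⟪-(stdJ n (extendCurve f t - extendCurve f s)), extendCurve f s - 0⟫ := by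
      have a1 : γ (τ t) - γ (τ s) = L • (extendCurve f t - extendCurve f s) := by
        rw [hfe t ht', hfe s hs', hζ, ← smul_sub, smul_inv_smul₀ hL.ne']
        abel
      have a2 : γ (τ s) - γ 0 = L • (extendCurve f s - 0) := by
        rw [hfe s hs', hζ, sub_zero, smul_inv_smul₀ hL.ne']
      rw [a1, a2, map_smul, ← smul_neg, real_inner_smul_left, real_inner_smul_right]
      ring
    have e4 : D t - D s = (∫ x in (τ s)..(τ t), ⟪-(stdJ n (v x)), γ x - γ 0⟫) -
        L ^ 2 * ∫ x in s..t, ⟪-(stdJ n (deriv (extendCurve f) x)), extendCurve f x - 0⟫ := by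
      rw [← i1, ← i2, hD]
      ring
    rw [e4]
    rw [e3] at b1
    rw [abs_le] at b1 b2 ⊢
    have hL2 : 0 ≤ L ^ 2 := by positivity
    have c1 := mul_le_mul_of_nonneg_left b2.1 hL2
    have c2 := mul_le_mul_of_nonneg_left b2.2 hL2
    have e5 : (r⁻¹ * (L * t - L * s)) ^ 2 = (L * r⁻¹) ^ 2 * (t - s) ^ 2 := by ring
    have e6 : L ^ 2 * (r⁻¹ * (t - s)) ^ 2 = (L * r⁻¹) ^ 2 * (t - s) ^ 2 := by ring
    rw [e5] at b1
    constructor <;> nlinarith [b1.1, b1.2]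
  have hfin := eq_of_abs_sub_le_mul_sq hDle
  have hz : ∀ x ∈ uIcc 0 (τ 0), ⟪-(stdJ n (v x)), γ x - γ 0⟫ = 0 := fun x hx => by
    rw [uIcc_of_le (hτmem 0).1] at hx
    have hx' : x ∈ Icc 0 T := ⟨hx.1, hx.2.trans (hτmem 0).2⟩
    rw [← hγeq h0T hx' hx.1, sub_self, inner_zero_right]
    refine le_antisymm (hSmono h0T hx' hx.1) ?_
    have := hSmono hx' (hτmem 0) hx.2
    rw [hτ 0 (by simp)] at this
    linarith
  have hz1 : ∀ x ∈ uIcc (τ 1) T, ⟪-(stdJ n (v x)), γ x - γ 0⟫ = 0 := fun x hx => by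
    rw [uIcc_of_le (hτmem 1).2] at hx
    have hx' : x ∈ Icc 0 T := ⟨(hτmem 1).1.trans hx.1, hx.2⟩
    rw [hc, hγeq hx' hTT hx.2, sub_self, inner_zero_right]
    refine le_antisymm (hSmono hx' hTT hx.2) ?_
    have := hSmono (hτmem 1) hx' hx.1
    rw [hτ 1 (by simp)] at this
    linarith
  have hD0 : D 0 = 0 := by
    simp only [hD, intervalIntegral.integral_same, mul_zero, sub_zero]
    rw [intervalIntegral.integral_congr (g := fun _ => 0) hz, intervalIntegral.integral_zero]
  have hmemT : ∀ x ∈ Icc (0 : ℝ) T, x ∈ uIcc 0 T := fun x hx => by rwa [uIcc_of_le h.nonneg]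
  have hsplit := intervalIntegral.integral_add_adjacent_intervals
    (hIi.mono_set (uIcc_subset_uIcc (hmemT _ h0T) (hmemT _ (hτmem 1))))
    (hIi.mono_set (uIcc_subset_uIcc (hmemT _ (hτmem 1)) (hmemT _ hTT)))
  rw [intervalIntegral.integral_congr (g := fun _ => 0) hz1, intervalIntegral.integral_zero,
    add_zero] at hsplit
  have hact : action T γ = (1 / 2) * ∫ t in (0 : ℝ)..T, ⟪-(stdJ n (v t)), γ t - γ 0⟫ := by
    rw [h.action_eq]
    simp only [inner_sub_right]
    rw [intervalIntegral.integral_sub (h.intervalIntegrable_inner_curve h.continuousOn)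
      (h.intervalIntegrable_inner_const _), h.integral_inner_const_of_closed hc, sub_zero]
  rw [hD0] at hfin
  simp only [hD, sub_zero] at hfin
  rw [hact, ← hsplit, action]
  linarith

end UnitLoops

theorem memLp_two_of_continuousOn {E : Type*} [NormedAddCommGroup E] {T : ℝ} {v : ℝ → E}
    (hv : ContinuousOn v (Icc 0 T)) : MemLp v 2 (volume.restrict (Icc 0 T)) := by
  obtain ⟨C, hC⟩ := isCompact_Icc.exists_bound_of_continuousOn hv
  exact MemLp.of_bound (hv.aestronglyMeasurable_of_isCompact isCompact_Icc measurableSet_Icc) C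
    ((ae_restrict_mem measurableSet_Icc).mono hC)

theorem HasVelocity.of_hasDerivAt {T : ℝ} (hT : 0 ≤ T) {γ v : ℝ → PhaseSpace n}
    (h : ∀ t, HasDerivAt γ (v t) t) (hv : Continuous v) : HasVelocity T γ v := by
  refine ⟨hT, memLp_two_of_continuousOn hv.continuousOn, fun t _ => ?_⟩
  rw [intervalIntegral.integral_eq_sub_of_hasDerivAt (fun x _ => h x) (hv.intervalIntegrable _ _)]
  abel

theorem exists_loop_action_pos [Nontrivial (PhaseSpace n)] :
    ∃ γ v : ℝ → PhaseSpace n, HasVelocity (2 * Real.pi) γ v ∧ γ 0 = γ (2 * Real.pi) ∧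
      0 < action (2 * Real.pi) γ := by
  obtain ⟨u, hu⟩ := exists_ne (0 : PhaseSpace n)
  set γ : ℝ → PhaseSpace n := fun t => Real.cos t • u + Real.sin t • stdJ n u with hγ
  set v : ℝ → PhaseSpace n := fun t => -Real.sin t • u + Real.cos t • stdJ n u with hv
  have h : HasVelocity (2 * Real.pi) γ v := by
    refine HasVelocity.of_hasDerivAt (by positivity) (fun t => ?_) (by fun_prop)
    exact ((Real.hasDerivAt_cos t).smul_const u).add
      ((Real.hasDerivAt_sin t).smul_const (stdJ n u))
  refine ⟨γ, v, h, by simp [hγ], ?_⟩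
  rw [h.action_eq]
  have e : ∀ t, ⟪-(stdJ n (v t)), γ t⟫ = ‖u‖ ^ 2 := fun t => by
    have e1 : -(stdJ n (v t)) = γ t := by
      simp only [hv, hγ, map_add, map_smul, stdJ_stdJ]
      module
    rw [e1, hγ]
    simp only [inner_add_left, inner_add_right, real_inner_smul_left, real_inner_smul_right,
      inner_stdJ_stdJ, inner_stdJ_self, inner_self_stdJ]
    rw [real_inner_self_eq_norm_sq]
    linear_combination ‖u‖ ^ 2 * Real.sin_sq_add_cos_sq t
  simp only [e]
  have : 0 < ‖u‖ := norm_pos_iff.2 hu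
  rw [intervalIntegral.integral_const, smul_eq_mul, sub_zero]
  positivity

section Isoperimetric

variable {K : Set (PhaseSpace n)}

theorem HasVelocity.action_const_smul {T : ℝ} {γ v : ℝ → PhaseSpace n} (h : HasVelocity T γ v)
    (c : ℝ) : action T (fun t => c • γ t) = c ^ 2 * action T γ := by
  have e : ∀ t, ⟪-(stdJ n (c • v t)), c • γ t⟫ = c ^ 2 * ⟪-(stdJ n (v t)), γ t⟫ := fun t => by
    rw [map_smul, ← smul_neg, real_inner_smul_left, real_inner_smul_right]
    ring
  rw [(h.const_smul c).action_eq, h.action_eq]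
  simp only [e]
  rw [intervalIntegral.integral_const_mul]
  ring

theorem HasVelocity.supportLength_const_smul_le {T : ℝ} {γ v : ℝ → PhaseSpace n}
    (h : HasVelocity T γ v) (hKc : IsCompact K) (hne : K.Nonempty) {c : ℝ} (hc : 0 ≤ c) :
    supportLength K T (fun t => c • v t) ≤ c * supportLength K T v := by
  rw [supportLength, supportLength, ← intervalIntegral.integral_const_mul]
  refine intervalIntegral.integral_mono_on h.nonneg
    ((h.const_smul c).intervalIntegrable_supportFn hKc hne)
    ((h.intervalIntegrable_supportFn hKc hne).const_mul c) fun t _ => ?_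
  rw [map_smul, ← smul_neg]
  exact supportFn_smul_le hKc hne hc _

theorem supportLength_unitLoop_le {p : PhaseSpace n} {r : ℝ} (hKc : IsCompact K) (hr : 0 < r)
    (hB : Metric.closedBall p r ⊆ K)
    {f : BoundedContinuousFunction (Icc (0 : ℝ) 1) (PhaseSpace n)} (hf : f ∈ unitLoops K p) :
    supportLength K 1 (deriv (extendCurve f)) ≤ 1 := by
  have hne : K.Nonempty := ⟨p, hB (Metric.mem_closedBall_self hr.le)⟩
  have vf := (lipschitzWith_extendCurve hr hB hf).hasVelocity (zero_le_one (α := ℝ))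
  have hmono : ∀ y ∈ K, Monotone fun t => t - ⟪-(stdJ n (extendCurve f t)), y - p⟫ := by
    intro y hy s t hst
    have h1 := hf.2.2 (projIcc 0 1 zero_le_one s) (projIcc 0 1 zero_le_one t)
      (monotone_projIcc _ hst) y hy
    have h2 : ((projIcc 0 1 zero_le_one t : Icc (0 : ℝ) 1) : ℝ) - projIcc 0 1 zero_le_one s ≤
        t - s := by
      have := (LipschitzWith.projIcc (zero_le_one (α := ℝ))).dist_le_mul t s
      rw [NNReal.coe_one, one_mul, Subtype.dist_eq, Real.dist_eq, Real.dist_eq,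
        abs_of_nonneg (sub_nonneg.2 hst)] at this
      exact (le_abs_self _).trans this
    have h3 : ⟪-(stdJ n (extendCurve f t - extendCurve f s)), y - p⟫ ≤ t - s := h1.trans h2
    rw [map_sub, neg_sub, inner_sub_left] at h3
    simp only [inner_neg_left]
    linarith
  rw [vf.supportLength_eq (extendCurve_closed hf) hKc hne p]
  have hle : ∀ᵐ t ∂(volume.restrict (Icc (0 : ℝ) 1)),
      supportFn K (-(stdJ n (deriv (extendCurve f) t))) -
        ⟪-(stdJ n (deriv (extendCurve f) t)), p⟫ ≤ 1 := by
    filter_upwards [vf.ae_hasDerivAt] with t ht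
    have : supportFn K (-(stdJ n (deriv (extendCurve f) t))) ≤
        1 + ⟪-(stdJ n (deriv (extendCurve f) t)), p⟫ := supportFn_le hne fun y hy => by
      have h1 := (hasDerivAt_id t).sub
        (((-stdJ n).hasFDerivAt.comp_hasDerivAt t ht).inner ℝ (hasDerivAt_const t (y - p)))
      have h2 := (hmono y hy).deriv_nonneg (x := t)
      have h3 := h1.deriv
      simp only [inner_zero_right, zero_add] at h3
      have h4 : (1 : ℝ) - ⟪(-stdJ n) (deriv (extendCurve f) t), y - p⟫ = deriv
        (fun t => t - ⟪-(stdJ n (extendCurve f t)), y - p⟫) t := h3.symm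
      rw [← h4, inner_sub_right] at h2
      have h5 : (-stdJ n) (deriv (extendCurve f) t) = -(stdJ n (deriv (extendCurve f) t)) := rfl
      rw [h5] at h2
      linarith
    linarith
  calc _ ≤ ∫ _ in (0 : ℝ)..1, (1 : ℝ) := by
        refine intervalIntegral.integral_mono_ae_restrict zero_le_one
          ((vf.intervalIntegrable_supportFn hKc hne).sub (vf.intervalIntegrable_inner_const p))
          (by simp) hle
    _ = 1 := by simp

theorem exists_isoperimetric_constant [Nontrivial (PhaseSpace n)] (hKc : IsCompact K)
    (hi : (interior K).Nonempty) :
    ∃ m : ℝ, 0 < m ∧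
      (∀ T (γ v : ℝ → PhaseSpace n), HasVelocity T γ v → γ 0 = γ T →
        4 * m * action T γ ≤ supportLength K T v ^ 2) ∧
      ∃ γ v : ℝ → PhaseSpace n, HasVelocity 1 γ v ∧ γ 0 = γ 1 ∧
        supportLength K 1 v ≤ 2 * m ∧ action 1 γ = m := by
  obtain ⟨p, hp⟩ := hi
  obtain ⟨r, hr, hB⟩ := exists_closedBall_subset_of_mem_interior hp
  have hne : K.Nonempty := ⟨p, hB (Metric.mem_closedBall_self hr.le)⟩
  obtain ⟨f, hf, hmax⟩ := exists_isMaxOn_action_unitLoops (K := K) hr hB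
  set M := action 1 (extendCurve f) with hM
  have hle : ∀ T (γ v : ℝ → PhaseSpace n), HasVelocity T γ v → γ 0 = γ T →
      action T γ ≤ supportLength K T v ^ 2 * M := by
    intro T γ v h hc
    rcases (h.supportLength_nonneg hc hKc ⟨p, hp⟩).eq_or_lt with h0 | hpos
    · have hconst : ∀ t ∈ Icc 0 T, γ t = γ 0 := fun t ht => by
        by_contra hne
        exact (h.supportLength_pos hc hKc ⟨p, hp⟩ ⟨t, ht, hne⟩).ne h0
      have : action T γ = 0 := by
        rw [h.action_eq, intervalIntegral.integral_congr
          (g := fun t => ⟪-(stdJ n (v t)), γ 0⟫) fun t ht => by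
            rw [uIcc_of_le h.nonneg] at ht
            simp only [hconst t ht],
          h.integral_inner_const_of_closed hc, mul_zero]
      rw [this, ← h0]
      simp
    · obtain ⟨g, hg, hgeq⟩ := exists_unitLoop hKc hr hB h hc hpos
      rw [hgeq]
      exact mul_le_mul_of_nonneg_left (hmax g hg) (by positivity)
  have hMpos : 0 < M := by
    obtain ⟨γ, v, h, hc, hA⟩ := exists_loop_action_pos (n := n)
    have := hA.trans_le (hle _ γ v h hc)
    by_contra hneg
    push Not at hneg
    nlinarith [sq_nonneg (supportLength K (2 * Real.pi) v)]
  have vf := (lipschitzWith_extendCurve hr hB hf).hasVelocity (zero_le_one (α := ℝ))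
  refine ⟨1 / (4 * M), by positivity, fun T γ v h hc => ?_,
    fun t => (1 / (2 * M)) • extendCurve f t, _, vf.const_smul (1 / (2 * M)), ?_, ?_, ?_⟩
  · have := hle T γ v h hc
    have e : 4 * (1 / (4 * M)) * action T γ = action T γ / M := by field_simp
    rwa [e, div_le_iff₀ hMpos]
  · simp only [extendCurve_closed hf]
  · refine (vf.supportLength_const_smul_le hKc hne (by positivity)).trans ?_
    have := mul_le_mul_of_nonneg_left (supportLength_unitLoop_le hKc hr hB hf)
      (show 0 ≤ 1 / (2 * M) by positivity)
    refine this.trans (le_of_eq ?_)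
    field_simp
    norm_num
  · rw [vf.action_const_smul, ← hM]
    field_simp
    norm_num

end Isoperimetric

/-! ### Extremal curves are characteristics -/

section Extremal

variable {K : Set (PhaseSpace n)}

theorem exists_metric_projection (hK : Convex ℝ K) (hKc : IsCompact K) (hne : K.Nonempty) :
    ∃ P : PhaseSpace n → PhaseSpace n, Continuous P ∧ (∀ x, P x ∈ K) ∧
      ∀ x, ∀ y ∈ K, ⟪x - P x, y - P x⟫ ≤ 0 := by
  have h1 : ∀ x : PhaseSpace n, ∃ v ∈ K, ∀ y ∈ K, ⟪x - v, y - v⟫ ≤ 0 := fun x => by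
    obtain ⟨v, hv, hmin⟩ := exists_norm_eq_iInf_of_complete_convex hne hKc.isComplete hK x
    exact ⟨v, hv, (norm_eq_iInf_iff_real_inner_le_zero hK hv).1 hmin⟩
  choose P hP hvar using h1
  refine ⟨P, ?_, hP, hvar⟩
  have hlip : LipschitzWith 1 P := LipschitzWith.of_dist_le_mul fun x y => by
    rw [NNReal.coe_one, one_mul, dist_eq_norm, dist_eq_norm]
    have a1 := hvar x (P y) (hP y)
    have a2 := hvar y (P x) (hP x)
    have a3 : ‖P x - P y‖ ^ 2 ≤ ⟪x - y, P x - P y⟫ := by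
      rw [← real_inner_self_eq_norm_sq]
      simp only [inner_sub_left, inner_sub_right] at a1 a2 ⊢
      linarith
    have a4 := a3.trans (real_inner_le_norm _ _)
    by_contra hlt
    push Not at hlt
    nlinarith [norm_nonneg (x - y), norm_nonneg (P x - P y)]
  exact hlip.continuous

/-- First variation at an extremal closed curve. -/
theorem integral_inner_le_supportLength {m T : ℝ} {γ v γ' v' : ℝ → PhaseSpace n} (hm : 0 < m)
    (hKc : IsCompact K) (hi : (interior K).Nonempty)
    (hiso : ∀ T (γ v : ℝ → PhaseSpace n), HasVelocity T γ v → γ 0 = γ T →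
        4 * m * action T γ ≤ supportLength K T v ^ 2)
    (h : HasVelocity T γ v) (hc : γ 0 = γ T) (hL : supportLength K T v ≤ 2 * m)
    (hA : action T γ = m) (h' : HasVelocity T γ' v') (hc' : γ' 0 = γ' T) :
    ∫ t in (0 : ℝ)..T, ⟪-(stdJ n (v' t)), γ t⟫ ≤ supportLength K T v' := by
  have hne : K.Nonempty := hi.mono interior_subset
  set B := ∫ t in (0 : ℝ)..T, ⟪-(stdJ n (v' t)), γ t⟫ with hB
  set L' := supportLength K T v'
  have hL'0 : 0 ≤ L' := h'.supportLength_nonneg hc' hKc hi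
  set A' := action T γ' with hA'
  have key : ∀ ε : ℝ, 0 < ε → ε < 1 →
      4 * m * ((1 - ε) * B + ε * A') ≤ 4 * m * (1 - ε) * L' + ε * L' ^ 2 := by
    intro ε h0 h1
    have hε := (h.const_smul (1 - ε)).add (h'.const_smul ε)
    have hsum := hiso T _ _ hε (by simp only [hc, hc'])
    have hlen : supportLength K T (fun t => (1 - ε) • v t + ε • v' t) ≤
        (1 - ε) * (2 * m) + ε * L' := by
      have s1 := h.supportLength_const_smul_le hKc hne (sub_nonneg.2 h1.le)
      have s2 := h'.supportLength_const_smul_le hKc hne h0.le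
      have s3 : supportLength K T (fun t => (1 - ε) • v t + ε • v' t) ≤
          supportLength K T (fun t => (1 - ε) • v t) + supportLength K T (fun t => ε • v' t) := by
        simp only [supportLength]
        have i1 := (h.const_smul (1 - ε)).intervalIntegrable_supportFn hKc hne
        have i2 := (h'.const_smul ε).intervalIntegrable_supportFn hKc hne
        rw [← intervalIntegral.integral_add i1 i2]
        refine intervalIntegral.integral_mono_on h.nonneg
          (hε.intervalIntegrable_supportFn hKc hne) (i1.add i2) fun t _ => ?_
        rw [map_add, neg_add]
        exact supportFn_add_le hKc hne _ _
      have := mul_le_mul_of_nonneg_left hL (sub_nonneg.2 h1.le)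
      linarith
    have hact : action T (fun t => (1 - ε) • γ t + ε • γ' t) =
        (1 - ε) ^ 2 * m + ε * (1 - ε) * B + ε ^ 2 * A' := by
      have i1 := h.intervalIntegrable_inner_curve h.continuousOn
      have i2 := h.intervalIntegrable_inner_curve h'.continuousOn
      have i3 := h'.intervalIntegrable_inner_curve h.continuousOn
      have i4 := h'.intervalIntegrable_inner_curve h'.continuousOn
      have hs := h.integral_inner_neg_stdJ_comm h' hc hc'
      rw [← hB] at hs
      rw [← hA, hA', h.action_eq, h'.action_eq, hε.action_eq]
      have e : ∀ t, ⟪-(stdJ n ((1 - ε) • v t + ε • v' t)), (1 - ε) • γ t + ε • γ' t⟫ =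
          (1 - ε) ^ 2 * ⟪-(stdJ n (v t)), γ t⟫ + (1 - ε) * ε * ⟪-(stdJ n (v t)), γ' t⟫ +
          ((1 - ε) * ε * ⟪-(stdJ n (v' t)), γ t⟫ + ε ^ 2 * ⟪-(stdJ n (v' t)), γ' t⟫) := fun t => by
        simp only [map_add, map_smul, inner_add_left, inner_add_right, real_inner_smul_left,
          real_inner_smul_right, inner_neg_left]
        ring
      simp only [e]
      rw [intervalIntegral.integral_add ((i1.const_mul _).add (i2.const_mul _))
        ((i3.const_mul _).add (i4.const_mul _)),
        intervalIntegral.integral_add (i1.const_mul _) (i2.const_mul _),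
        intervalIntegral.integral_add (i3.const_mul _) (i4.const_mul _)]
      simp only [intervalIntegral.integral_const_mul]
      rw [hs]
      ring
    rw [hact] at hsum
    have hlen0 := hε.supportLength_nonneg (by simp only [hc, hc']) hKc hi
    have hsq : supportLength K T (fun t => (1 - ε) • v t + ε • v' t) ^ 2 ≤
        ((1 - ε) * (2 * m) + ε * L') ^ 2 := pow_le_pow_left₀ hlen0 hlen 2
    have h3 := hsum.trans hsq
    have h4 : ε * (4 * m * ((1 - ε) * B + ε * A')) ≤
        ε * (4 * m * (1 - ε) * L' + ε * L' ^ 2) := by nlinarith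
    exact le_of_mul_le_mul_left h4 h0
  have hlim1 : Tendsto (fun ε : ℝ => 4 * m * ((1 - ε) * B + ε * A')) (𝓝[>] 0)
      (𝓝 (4 * m * ((1 - 0) * B + 0 * A'))) :=
    (Continuous.tendsto (by fun_prop) 0).mono_left nhdsWithin_le_nhds
  have hlim2 : Tendsto (fun ε : ℝ => 4 * m * (1 - ε) * L' + ε * L' ^ 2) (𝓝[>] 0)
      (𝓝 (4 * m * (1 - 0) * L' + 0 * L' ^ 2)) :=
    (Continuous.tendsto (by fun_prop) 0).mono_left nhdsWithin_le_nhds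
  have hfin := le_of_tendsto_of_tendsto hlim1 hlim2 (by
    filter_upwards [Ioo_mem_nhdsGT (zero_lt_one (α := ℝ))] with ε hε
    exact key ε hε.1 hε.2)
  nlinarith

/-- A curve `γ` with `∫ ⟪w, γ⟫ ≤ ∫ h_K(w)` for all `w` of mean zero has a translate in `K`. -/
theorem exists_translate_subset {T : ℝ} {γ : ℝ → PhaseSpace n} (hT : 0 < T) (hK : Convex ℝ K)
    (hKc : IsCompact K) (hne : K.Nonempty) (hγ : ContinuousOn γ (Icc 0 T))
    (hvar : ∀ w : ℝ → PhaseSpace n, Continuous w → ∫ t in (0 : ℝ)..T, w t = 0 →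
      ∫ t in (0 : ℝ)..T, ⟪w t, γ t⟫ ≤ ∫ t in (0 : ℝ)..T, supportFn K (w t)) :
    ∃ x, ∀ t ∈ Icc 0 T, γ t + x ∈ K := by
  obtain ⟨P, hPc, hPm, hP⟩ := exists_metric_projection hK hKc hne
  obtain ⟨R, hR⟩ := hKc.exists_bound_of_continuousOn continuousOn_id
  set z : ℝ → PhaseSpace n := IccExtend hT.le ((Icc 0 T).domRestrict γ) with hz
  have hzc : Continuous z := hγ.domRestrict.Icc_extend'
  have hzγ : ∀ t ∈ Icc 0 T, z t = γ t := fun t ht => by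
    rw [hz, IccExtend_of_mem _ _ ht]; rfl
  obtain ⟨C, hC⟩ := isCompact_Icc.exists_bound_of_continuousOn (s := Icc 0 T) hzc.continuousOn
  have hPmin : ∀ x, ∀ y ∈ K, ‖x - P x‖ ^ 2 ≤ ‖x - y‖ ^ 2 := fun x y hy => by
    have h1 := hP x y hy
    have h2 : x - y = (x - P x) - (y - P x) := by abel
    rw [h2, norm_sub_sq_real (x - P x)]
    nlinarith [sq_nonneg ‖y - P x‖]
  set F : PhaseSpace n → ℝ := fun x =>
    ∫ t in (0 : ℝ)..T, ‖(x + z t) - P (x + z t)‖ ^ 2 with hF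
  have hFc : Continuous F := by
    refine intervalIntegral.continuous_parametric_intervalIntegral_of_continuous' ?_ 0 T
    fun_prop
  have hFlim : Tendsto F (cocompact (PhaseSpace n)) atTop := by
    have hlow : ∀ᶠ x in cocompact (PhaseSpace n), T * (‖x‖ - (C + R)) ≤ F x := by
      have : ∀ᶠ x : PhaseSpace n in cocompact (PhaseSpace n), C + R + 1 ≤ ‖x‖ :=
        tendsto_norm_cocompact_atTop.eventually_ge_atTop _
      filter_upwards [this] with x hx
      have e : T * (‖x‖ - (C + R)) = ∫ _ in (0 : ℝ)..T, (‖x‖ - (C + R)) := by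
        rw [intervalIntegral.integral_const, smul_eq_mul, sub_zero]
      rw [e]
      refine intervalIntegral.integral_mono_on hT.le (by simp)
        (Continuous.intervalIntegrable (by fun_prop) _ _) fun t ht => ?_
      have h1 : ‖x‖ ≤ ‖(x + z t) - P (x + z t)‖ + ‖z t‖ + ‖P (x + z t)‖ := by
        have : x = ((x + z t) - P (x + z t)) - z t + P (x + z t) := by abel
        calc ‖x‖ = ‖((x + z t) - P (x + z t)) - z t + P (x + z t)‖ := by rw [← this]
          _ ≤ _ := (norm_add_le _ _).trans (add_le_add_left (norm_sub_le _ _) _)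
      have h2 := hC t ht
      have h3 := hR _ (hPm (x + z t))
      simp only [id] at h3
      nlinarith
    refine tendsto_atTop_mono' _ hlow ?_
    exact (tendsto_atTop_add_const_right _ (-(C + R)) tendsto_norm_cocompact_atTop).const_mul_atTop
      hT
  obtain ⟨x, hx⟩ := hFc.exists_forall_le hFlim
  set q : ℝ → PhaseSpace n := fun t => (x + z t) - P (x + z t) with hq
  have hqc : Continuous q := by fun_prop
  have hqi : ∀ y : PhaseSpace n, ∫ t in (0 : ℝ)..T, ⟪q t, y⟫ = ⟪∫ t in (0 : ℝ)..T, q t, y⟫ :=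
    fun y => by
    have h1 := (innerSL ℝ y).intervalIntegral_comp_comm (hqc.intervalIntegrable (μ := volume) 0 T)
    simpa [real_inner_comm y] using h1
  have hq0 : ∫ t in (0 : ℝ)..T, q t = 0 := by
    set Q := ∫ t in (0 : ℝ)..T, q t with hQ
    have h1 := hx (x + (-1 / T) • Q)
    have h2 : F (x + (-1 / T) • Q) ≤ ∫ t in (0 : ℝ)..T, ‖q t + (-1 / T) • Q‖ ^ 2 := by
      refine intervalIntegral.integral_mono_on hT.le
        (Continuous.intervalIntegrable (by fun_prop) _ _)
        (Continuous.intervalIntegrable (by fun_prop) _ _) fun t _ => ?_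
      have := hPmin (x + (-1 / T) • Q + z t) (P (x + z t)) (hPm _)
      have e : q t + (-1 / T) • Q = x + (-1 / T) • Q + z t - P (x + z t) := by
        simp only [hq]; abel
      rwa [e]
    have h3 : ∫ t in (0 : ℝ)..T, ‖q t + (-1 / T) • Q‖ ^ 2 = F x - ‖Q‖ ^ 2 / T := by
      have e : ∀ t, ‖q t + (-1 / T) • Q‖ ^ 2 =
          ‖q t‖ ^ 2 + ((2 * (-1 / T)) * ⟪q t, Q⟫ + (1 / T) ^ 2 * ‖Q‖ ^ 2) := fun t => by
        rw [norm_add_sq_real, real_inner_smul_right, norm_smul, mul_pow, Real.norm_eq_abs, sq_abs]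
        ring
      simp only [e]
      rw [intervalIntegral.integral_add (Continuous.intervalIntegrable (by fun_prop) _ _)
        (Continuous.intervalIntegrable (by fun_prop) _ _),
        intervalIntegral.integral_add (Continuous.intervalIntegrable (by fun_prop) _ _)
        (Continuous.intervalIntegrable (by fun_prop) _ _), intervalIntegral.integral_const_mul,
        hqi Q, real_inner_self_eq_norm_sq, intervalIntegral.integral_const]
      simp only [hF, hq, smul_eq_mul, sub_zero]
      field_simp
      ring
    have h4 : ‖Q‖ ^ 2 / T ≤ 0 := by linarith
    have h5 : ‖Q‖ ^ 2 ≤ 0 := by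
      rw [div_le_iff₀ hT] at h4
      simpa using h4
    have h6 : ‖Q‖ = 0 := by nlinarith [norm_nonneg Q]
    simpa using h6
  have hle := hvar q hqc hq0
  have hsupp : ∀ t, supportFn K (q t) = ⟪q t, P (x + z t)⟫ := fun t => by
    refine supportFn_eq_of_mem_normalCone hKc (hPm _) fun y hy => ?_
    have := hP (x + z t) y hy
    rw [← neg_sub (P (x + z t)) y, inner_neg_right] at this
    simp only [hq]
    linarith
  have hint : ∫ t in (0 : ℝ)..T, ⟪q t, γ t⟫ =
      (∫ t in (0 : ℝ)..T, ‖q t‖ ^ 2) + ∫ t in (0 : ℝ)..T, supportFn K (q t) := by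
    have e1 : ∫ t in (0 : ℝ)..T, ⟪q t, γ t⟫ = ∫ t in (0 : ℝ)..T, ⟪q t, x + z t⟫ := by
      have e0 : ∫ t in (0 : ℝ)..T, ⟪q t, γ t⟫ = ∫ t in (0 : ℝ)..T, ⟪q t, z t⟫ :=
        intervalIntegral.integral_congr fun t ht => by
          rw [uIcc_of_le hT.le] at ht
          simp only [hzγ t ht]
      simp only [inner_add_right]
      rw [intervalIntegral.integral_add (Continuous.intervalIntegrable (by fun_prop) _ _)
        (Continuous.intervalIntegrable (by fun_prop) _ _), hqi x, hq0, inner_zero_left, zero_add, e0]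
    rw [e1]
    simp only [hsupp]
    rw [← intervalIntegral.integral_add (Continuous.intervalIntegrable (by fun_prop) _ _)
      (Continuous.intervalIntegrable (by fun_prop) _ _)]
    refine intervalIntegral.integral_congr fun t _ => ?_
    rw [← real_inner_self_eq_norm_sq, ← inner_add_right]
    congr 1
    simp only [hq]
    abel
  rw [hint] at hle
  refine ⟨x, fun t ht => ?_⟩
  by_contra hnot
  have hqt : q t ≠ 0 := fun h0 => hnot (by
    rw [hq, sub_eq_zero] at h0
    rw [add_comm, ← hzγ t ht, h0]
    exact hPm _)
  have : 0 < ∫ t in (0 : ℝ)..T, ‖q t‖ ^ 2 :=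
    intervalIntegral.integral_pos hT (by fun_prop) (fun _ _ => by positivity)
      ⟨t, ht, by have := norm_pos_iff.2 hqt; positivity⟩
  linarith

theorem exists_translate_isClosedCharacteristic {m T : ℝ} {γ v : ℝ → PhaseSpace n} (hm : 0 < m)
    (hK : Convex ℝ K) (hKc : IsCompact K) (hi : (interior K).Nonempty)
    (hiso : ∀ T (γ v : ℝ → PhaseSpace n), HasVelocity T γ v → γ 0 = γ T →
        4 * m * action T γ ≤ supportLength K T v ^ 2)
    (h : HasVelocity T γ v) (hc : γ 0 = γ T) (hL : supportLength K T v ≤ 2 * m)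
    (hA : action T γ = m) :
    ∃ x, IsClosedCharacteristic K T (fun t => γ t + x) := by
  have hne : K.Nonempty := hi.mono interior_subset
  have hT : 0 < T := by
    refine h.nonneg.lt_of_ne fun h0 => ?_
    subst h0
    simp only [action, intervalIntegral.integral_same, mul_zero] at hA
    exact hm.ne hA
  obtain ⟨x, hx⟩ := exists_translate_subset hT hK hKc hne h.continuousOn (by
    intro w hw hw0
    have hv' := HasVelocity.primitive hT.le (v := fun t => stdJ n (w t))
      (memLp_two_of_continuousOn (by fun_prop)) 0
    have hw1 : ∀ t, -(stdJ n (stdJ n (w t))) = w t := fun t => by rw [stdJ_stdJ, neg_neg]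
    have := integral_inner_le_supportLength hm hKc hi hiso h hc hL hA hv' (by
      rw [(stdJ n).intervalIntegral_comp_comm (hw.intervalIntegrable 0 T), hw0]
      simp)
    simpa only [supportLength, hw1] using this)
  have hγx := h.add_const x
  have hnn : ∀ t ∈ Icc 0 T,
      0 ≤ supportFn K (-(stdJ n (v t))) - ⟪-(stdJ n (v t)), γ t + x⟫ := fun t ht =>
    sub_nonneg.2 (inner_le_supportFn hKc _ (hx t ht))
  have hi1 := h.intervalIntegrable_supportFn hKc hne
  have hi2 := h.intervalIntegrable_inner_curve hγx.continuousOn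
  have hint : ∫ t in (0 : ℝ)..T,
      (supportFn K (-(stdJ n (v t))) - ⟪-(stdJ n (v t)), γ t + x⟫) = 0 := by
    refine le_antisymm ?_ (intervalIntegral.integral_nonneg hT.le hnn)
    rw [intervalIntegral.integral_sub hi1 hi2]
    have h1 := hγx.action_eq
    rw [h.action_add_const hc, hA] at h1
    have h2 : supportLength K T v = ∫ t in (0 : ℝ)..T, supportFn K (-(stdJ n (v t))) := rfl
    linarith
  have hae : ∀ᵐ t ∂(volume.restrict (Icc 0 T)), -(stdJ n (v t)) ∈ normalCone K (γ t + x) := by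
    rw [intervalIntegral.integral_of_le hT.le, ← integral_Icc_eq_integral_Ioc,
      integral_eq_zero_iff_of_nonneg_ae ((ae_restrict_mem measurableSet_Icc).mono hnn)
      ((intervalIntegrable_iff_integrableOn_Icc_of_le hT.le).1 (hi1.sub hi2))] at hint
    filter_upwards [hint] with t ht
    refine mem_normalCone_of_supportFn_le hKc ?_
    simp only [Pi.zero_apply] at ht
    linarith
  have hnc : ∃ t ∈ Icc 0 T, γ t ≠ γ 0 := by
    by_contra hcon
    push Not at hcon
    have : action T γ = 0 := by
      rw [h.action_eq, intervalIntegral.integral_congr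
        (g := fun t => ⟪-(stdJ n (v t)), γ 0⟫) fun t ht => by
          rw [uIcc_of_le h.nonneg] at ht
          simp only [hcon t ht],
        h.integral_inner_const_of_closed hc, mul_zero]
    linarith
  refine ⟨x, hT, hγx.isW12, by simp only [hc], fun t₀ ht₀ => ?_, ?_, ?_⟩
  · refine ⟨subset_closure (hx t₀ ht₀), fun hint₀ => ?_⟩
    have hconst : ∀ t ∈ Icc 0 T, γ t = γ t₀ := by
      have hpre : IsPreconnected (Icc 0 T) := isPreconnected_Icc
      have : PreconnectedSpace (Icc 0 T) := Subtype.preconnectedSpace hpre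
      have hcr : Continuous fun s : Icc 0 T => γ s := h.continuousOn.domRestrict
      have hclopen : IsClopen {s : Icc 0 T | γ s = γ t₀} := by
        refine ⟨isClosed_eq hcr continuous_const, isOpen_iff_mem_nhds.2 fun s hs => ?_⟩
        have hs' : γ s + x ∈ interior K := by
          have : γ s = γ t₀ := hs
          rw [this]; exact hint₀
        have hnhds : ∀ᶠ y : Icc 0 T in 𝓝 s, γ (y : ℝ) + x ∈ interior K :=
          (hcr.add continuous_const).continuousAt.eventually_mem
            (isOpen_interior.mem_nhds hs')
        obtain ⟨ε, hε, hball⟩ := Metric.eventually_nhds_iff.1 hnhds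
        refine Metric.mem_nhds_iff.2 ⟨ε, hε, fun y hy => ?_⟩
        change γ y = γ t₀
        have hss : γ s = γ t₀ := hs
        rw [← hss, ← sub_eq_zero, h.sub_eq s.2 y.2]
        refine (intervalIntegral.integral_congr_ae (g := fun _ => 0) ?_).trans
          intervalIntegral.integral_zero
        rw [ae_restrict_iff' measurableSet_Icc] at hae
        filter_upwards [hae] with t ht htm
        have htI : t ∈ uIcc (s : ℝ) y := uIoc_subset_uIcc htm
        have htT : t ∈ Icc 0 T := (ordConnected_Icc.uIcc_subset s.2 y.2) htI
        have hdist : dist (⟨t, htT⟩ : Icc 0 T) s < ε := by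
          have h1 : dist y s < ε := hy
          rw [Subtype.dist_eq, Real.dist_eq] at h1 ⊢
          exact (abs_sub_left_of_mem_uIcc htI).trans_lt h1
        have h0 := eq_zero_of_mem_normalCone_of_mem_interior (hball hdist) (ht htT)
        have h2 : ‖v t‖ = 0 := by rw [← norm_stdJ, ← norm_neg, h0, norm_zero]
        simpa using h2
      have huniv := hclopen.eq_univ ⟨⟨t₀, ht₀⟩, rfl⟩
      intro t ht
      have : (⟨t, ht⟩ : Icc 0 T) ∈ {s : Icc 0 T | γ s = γ t₀} := huniv ▸ mem_univ _
      exact this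
    obtain ⟨t, ht, hne'⟩ := hnc
    exact hne' ((hconst t ht).trans (hconst 0 ⟨le_rfl, hT.le⟩).symm)
  · filter_upwards [hae, hγx.ae_deriv_eq] with t h1 h2
    rwa [h2]
  · obtain ⟨t, ht, hne'⟩ := hnc
    exact ⟨t, ht, fun heq => hne' (add_right_cancel heq)⟩

end Extremal

/-! ### The capacity as an isoperimetric constant -/

section Capacity

variable {K : Set (PhaseSpace n)} [Nontrivial (PhaseSpace n)]

theorem ehzCapacity_spec (hK : Convex ℝ K) (hKc : IsCompact K) (hi : (interior K).Nonempty) :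
    0 < ehzCapacity K ∧
      (∀ T (γ v : ℝ → PhaseSpace n), HasVelocity T γ v → γ 0 = γ T →
        4 * ehzCapacity K * action T γ ≤ supportLength K T v ^ 2) ∧
      ∃ T γ, IsSystole K T γ ∧ action T γ = ehzCapacity K := by
  obtain ⟨m, hm, hiso, γ, v, h, hc, hL, hA⟩ := exists_isoperimetric_constant hKc hi
  obtain ⟨x, hx⟩ := exists_translate_isClosedCharacteristic hm hK hKc hi hiso h hc hL hA
  have hle : ∀ T' γ', IsClosedCharacteristic K T' γ' → m ≤ action T' γ' := fun T' γ' hγ' => by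
    have h1 := hiso T' γ' _ hγ'.hasVelocity hγ'.closed
    have h2 := hγ'.action_pos hKc hi
    rw [hγ'.supportLength_eq hKc] at h1
    nlinarith
  have hAx : action 1 (fun t => γ t + x) = m := by rw [h.action_add_const hc, hA]
  have hcap : ehzCapacity K = m := by
    refine IsLeast.csInf_eq ⟨⟨1, _, hx, hAx⟩, ?_⟩
    rintro a ⟨T', γ', hγ', rfl⟩
    exact hle T' γ' hγ'
  rw [hcap]
  exact ⟨hm, hiso, 1, _, ⟨hx, fun T' γ' hγ' => hAx.trans_le (hle T' γ' hγ')⟩, hAx⟩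

theorem ehzCapacity_pos (hK : Convex ℝ K) (hKc : IsCompact K) (hi : (interior K).Nonempty) :
    0 < ehzCapacity K := (ehzCapacity_spec hK hKc hi).1

theorem four_mul_ehzCapacity_mul_action_le (hK : Convex ℝ K) (hKc : IsCompact K)
    (hi : (interior K).Nonempty) {T : ℝ} {γ v : ℝ → PhaseSpace n} (h : HasVelocity T γ v)
    (hc : γ 0 = γ T) : 4 * ehzCapacity K * action T γ ≤ supportLength K T v ^ 2 :=
  (ehzCapacity_spec hK hKc hi).2.1 T γ v h hc

theorem exists_isSystole (hK : Convex ℝ K) (hKc : IsCompact K) (hi : (interior K).Nonempty) :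
    ∃ T γ, IsSystole K T γ :=
  let ⟨T, γ, h, _⟩ := (ehzCapacity_spec hK hKc hi).2.2
  ⟨T, γ, h⟩

theorem IsSystole.action_eq {T : ℝ} {γ : ℝ → PhaseSpace n} (hK : Convex ℝ K) (hKc : IsCompact K)
    (hi : (interior K).Nonempty) (h : IsSystole K T γ) : action T γ = ehzCapacity K := by
  obtain ⟨T', γ', h', he⟩ := (ehzCapacity_spec hK hKc hi).2.2
  rw [← he]
  exact le_antisymm (h.2 _ _ h'.1) (h'.2 _ _ h.1)

theorem IsClosedCharacteristic.isSystole {T : ℝ} {γ : ℝ → PhaseSpace n} (hK : Convex ℝ K)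
    (hKc : IsCompact K) (hi : (interior K).Nonempty) (h : IsClosedCharacteristic K T γ)
    (hA : action T γ ≤ ehzCapacity K) : IsSystole K T γ := by
  obtain ⟨T', γ', h', he⟩ := (ehzCapacity_spec hK hKc hi).2.2
  exact ⟨h, fun T₁ γ₁ h₁ => hA.trans (he ▸ h'.2 _ _ h₁)⟩

/-- A closed curve that is extremal for the isoperimetric inequality is a systole, after a
translation. -/
theorem exists_translate_isSystole {T : ℝ} {γ v : ℝ → PhaseSpace n} (hK : Convex ℝ K)
    (hKc : IsCompact K) (hi : (interior K).Nonempty) (h : HasVelocity T γ v) (hc : γ 0 = γ T)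
    (hL : supportLength K T v ≤ 2 * ehzCapacity K) (hA : ehzCapacity K ≤ action T γ) :
    ∃ x, IsSystole K T (fun t => γ t + x) := by
  have hpos := ehzCapacity_pos hK hKc hi
  have h1 := four_mul_ehzCapacity_mul_action_le hK hKc hi h hc
  have h2 := pow_le_pow_left₀ (h.supportLength_nonneg hc hKc hi) hL 2
  have hA' : action T γ = ehzCapacity K := by
    refine le_antisymm ?_ hA
    nlinarith
  obtain ⟨x, hx⟩ := exists_translate_isClosedCharacteristic hpos hK hKc hi
    (ehzCapacity_spec hK hKc hi).2.1 h hc hL hA'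
  exact ⟨x, hx.isSystole hK hKc hi (by rw [h.action_add_const hc, hA'])⟩

end Capacity

/-! ### Restriction, concatenation and rotation of curves -/

section Concat

theorem measurePreserving_add_left_Icc (c a b : ℝ) :
    MeasurePreserving (fun x => c + x) (volume.restrict (Icc a b))
      (volume.restrict (Icc (c + a) (c + b))) := by
  have := (measurePreserving_add_left volume c).restrict_preimage
    (measurableSet_Icc (a := c + a) (b := c + b))
  rwa [preimage_const_add_Icc, add_sub_cancel_left, add_sub_cancel_left] at this

theorem ae_comp_add_left {T a b : ℝ} (ha : 0 ≤ a) (hb : b ≤ T) {P : ℝ → Prop}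
    (h : ∀ᵐ t ∂(volume.restrict (Icc 0 T)), P t) :
    ∀ᵐ r ∂(volume.restrict (Icc 0 (b - a))), P (a + r) := by
  have h1 : ∀ᵐ t ∂(volume.restrict (Icc (a + 0) (a + (b - a)))), P t :=
    ae_restrict_of_ae_restrict_of_subset (Icc_subset_Icc (by linarith) (by linarith)) h
  exact (measurePreserving_add_left_Icc a 0 (b - a)).quasiMeasurePreserving.ae h1

theorem ae_Icc_add {a b : ℝ} {P : ℝ → Prop}
    (h₁ : ∀ᵐ t ∂(volume.restrict (Icc 0 a)), P t)
    (h₂ : ∀ᵐ t ∂(volume.restrict (Icc 0 b)), P (a + t)) :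
    ∀ᵐ t ∂(volume.restrict (Icc 0 (a + b))), P t := by
  have h3 : ∀ᵐ t ∂(volume.restrict (Icc a (a + b))), P t := by
    have h4 := (measurePreserving_add_left_Icc (-a) a (a + b)).quasiMeasurePreserving.ae
      (p := fun t => P (a + t)) (by simpa using h₂)
    simpa using h4
  have h5 : Icc 0 (a + b) ⊆ Icc 0 a ∪ Icc a (a + b) := Icc_subset_Icc_union_Icc
  refine ae_restrict_of_ae_restrict_of_subset h5 ?_
  rw [ae_restrict_union_iff]
  exact ⟨h₁, h3⟩

theorem integral_eq_add_of_concat {E : Type*} [NormedAddCommGroup E] [NormedSpace ℝ E]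
    {H f g : ℝ → E} {a b : ℝ} (ha : 0 ≤ a) (hb : 0 ≤ b) (hf : IntervalIntegrable f volume 0 a)
    (hg : IntervalIntegrable g volume 0 b) (h₁ : ∀ s ≤ a, H s = f s)
    (h₂ : ∀ s, a < s → H s = g (s - a)) :
    ∫ t in (0 : ℝ)..(a + b), H t = (∫ t in (0 : ℝ)..a, f t) + ∫ t in (0 : ℝ)..b, g t := by
  have hg' : IntervalIntegrable (fun x => g (x - a)) volume a (a + b) := by
    have := hg.comp_sub_right a
    rwa [zero_add, add_comm] at this
  have e1 : ∀ᵐ t, t ∈ uIoc 0 a → f t = H t := Eventually.of_forall fun t ht => by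
    rw [uIoc_of_le ha] at ht
    exact (h₁ t ht.2).symm
  have e2 : ∀ᵐ t, t ∈ uIoc a (a + b) → g (t - a) = H t := Eventually.of_forall fun t ht => by
    rw [uIoc_of_le (by linarith)] at ht
    exact (h₂ t ht.1).symm
  have i1 : IntervalIntegrable H volume 0 a :=
    hf.congr_ae ((ae_restrict_iff' measurableSet_uIoc).2 e1)
  have i2 : IntervalIntegrable H volume a (a + b) :=
    hg'.congr_ae ((ae_restrict_iff' measurableSet_uIoc).2 e2)
  rw [← intervalIntegral.integral_add_adjacent_intervals i1 i2,
    ← intervalIntegral.integral_congr_ae e1, ← intervalIntegral.integral_congr_ae e2,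
    intervalIntegral.integral_comp_sub_right, sub_self, add_sub_cancel_left]

theorem concatAt_of_le {a s : ℝ} {α β : ℝ → PhaseSpace n} (h : s ≤ a) :
    concatAt a α β s = α s := if_pos h

theorem concatAt_of_lt {a s : ℝ} {α β : ℝ → PhaseSpace n} (h : a < s) :
    concatAt a α β s = β (s - a) := if_neg (not_le.2 h)

theorem concatAt_add {a s : ℝ} {α β : ℝ → PhaseSpace n} (hαβ : α a = β 0) (hs : 0 ≤ s) :
    concatAt a α β (a + s) = β s := by
  rcases hs.eq_or_lt with rfl | hs
  · rw [add_zero, concatAt_of_le le_rfl, hαβ]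
  · rw [concatAt_of_lt (by linarith), add_sub_cancel_left]

namespace HasVelocity

variable {K : Set (PhaseSpace n)} {T S S' : ℝ} {γ v α β v₁ v₂ : ℝ → PhaseSpace n}

theorem shift (h : HasVelocity T γ v) {a b : ℝ} (ha : 0 ≤ a) (hab : a ≤ b) (hb : b ≤ T) :
    HasVelocity (b - a) (fun r => γ (a + r)) (fun r => v (a + r)) := by
  refine ⟨sub_nonneg.2 hab, ?_, fun t ht => ?_⟩
  · have h1 : MemLp v 2 (volume.restrict (Icc (a + 0) (a + (b - a)))) :=
      h.memLp.mono_measure (Measure.restrict_mono (Icc_subset_Icc (by linarith) (by linarith)) le_rfl)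
    exact h1.comp_measurePreserving (measurePreserving_add_left_Icc a 0 (b - a))
  · simp only [add_zero]
    rw [intervalIntegral.integral_comp_add_left (f := v), add_zero,
      ← h.sub_eq ⟨ha, hab.trans hb⟩ ⟨by linarith [ht.1], by linarith [ht.2]⟩]
    abel

theorem mono (h : HasVelocity T γ v) (hS : 0 ≤ S) (hST : S ≤ T) : HasVelocity S γ v :=
  ⟨hS, h.memLp.mono_measure (Measure.restrict_mono (Icc_subset_Icc_right hST) le_rfl),
    fun t ht => h.eq_add t ⟨ht.1, ht.2.trans hST⟩⟩

theorem concat (h₁ : HasVelocity S α v₁) (h₂ : HasVelocity S' β v₂) (hαβ : α S = β 0) :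
    HasVelocity (S + S') (concatAt S α β) (concatAt S v₁ v₂) := by
  refine ⟨add_nonneg h₁.nonneg h₂.nonneg, ?_, fun t ht => ?_⟩
  · classical
    have e : concatAt S v₁ v₂ = (Iic S).piecewise v₁ (fun s => v₂ (s - S)) := by
      ext1 s
      simp [concatAt, piecewise]
    rw [e]
    refine MemLp.piecewise measurableSet_Iic ?_ ?_
    · rw [Measure.restrict_restrict measurableSet_Iic]
      refine h₁.memLp.mono_measure (Measure.restrict_mono ?_ le_rfl)
      rintro t ⟨ht1, ht2⟩
      exact ⟨ht2.1, ht1⟩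
    · rw [Measure.restrict_restrict measurableSet_Iic.compl]
      have h3 : MemLp v₂ 2 (volume.restrict (Icc (-S + S) (-S + (S + S')))) := by
        simpa using h₂.memLp
      have h4 := h3.comp_measurePreserving (measurePreserving_add_left_Icc (-S) S (S + S'))
      have e2 : (v₂ ∘ fun x => -S + x) = fun s => v₂ (s - S) := by
        ext1 s
        simp [sub_eq_neg_add]
      rw [e2] at h4
      refine h4.mono_measure (Measure.restrict_mono ?_ le_rfl)
      rintro t ⟨ht1, ht2⟩
      exact ⟨le_of_lt (by simpa using ht1), ht2.2⟩
  · have h0 : concatAt S α β 0 = α 0 := concatAt_of_le h₁.nonneg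
    rw [h0]
    rcases le_or_gt t S with hle | hlt
    · rw [concatAt_of_le hle, h₁.eq_add t ⟨ht.1, hle⟩]
      congr 1
      refine intervalIntegral.integral_congr fun r hr => ?_
      rw [uIcc_of_le ht.1] at hr
      simp only [concatAt_of_le (hr.2.trans hle)]
    · have hmem : t - S ∈ Icc 0 S' := ⟨by linarith, by linarith [ht.2]⟩
      have h5 := integral_eq_add_of_concat (H := concatAt S v₁ v₂) h₁.nonneg hmem.1
        h₁.intervalIntegrable (h₂.intervalIntegrable_sub ⟨le_rfl, h₂.nonneg⟩ hmem)
        (fun s hs => concatAt_of_le hs) (fun s hs => concatAt_of_lt hs)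
      rw [add_sub_cancel] at h5
      rw [h5, concatAt_of_lt hlt, h₂.eq_add _ hmem, ← hαβ,
        h₁.eq_add S ⟨h₁.nonneg, le_rfl⟩, add_assoc]

theorem integral_inner_concat (h₁ : HasVelocity S α v₁) (h₂ : HasVelocity S' β v₂) :
    ∫ t in (0 : ℝ)..(S + S'), ⟪-(stdJ n (concatAt S v₁ v₂ t)), concatAt S α β t⟫ =
      (∫ t in (0 : ℝ)..S, ⟪-(stdJ n (v₁ t)), α t⟫) +
        ∫ t in (0 : ℝ)..S', ⟪-(stdJ n (v₂ t)), β t⟫ :=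
  integral_eq_add_of_concat h₁.nonneg h₂.nonneg
    (h₁.intervalIntegrable_inner_curve h₁.continuousOn)
    (h₂.intervalIntegrable_inner_curve h₂.continuousOn)
    (fun s hs => by rw [concatAt_of_le hs, concatAt_of_le hs])
    (fun s hs => by rw [concatAt_of_lt hs, concatAt_of_lt hs])

theorem supportLength_concat (h₁ : HasVelocity S α v₁) (h₂ : HasVelocity S' β v₂)
    (hKc : IsCompact K) (hne : K.Nonempty) :
    supportLength K (S + S') (concatAt S v₁ v₂) =
      supportLength K S v₁ + supportLength K S' v₂ :=
  integral_eq_add_of_concat h₁.nonneg h₂.nonneg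
    (h₁.intervalIntegrable_supportFn hKc hne) (h₂.intervalIntegrable_supportFn hKc hne)
    (fun s hs => by rw [concatAt_of_le hs]) (fun s hs => by rw [concatAt_of_lt hs])

theorem segmentPath (x y : PhaseSpace n) : HasVelocity 1 (segmentPath x y) (fun _ => y - x) := by
  refine HasVelocity.of_hasDerivAt zero_le_one (fun t => ?_) continuous_const
  have := ((hasDerivAt_id t).smul_const (y - x)).const_add x
  rwa [one_smul] at this

theorem rotate (h : HasVelocity T γ v) (hc : γ 0 = γ T) {s r : ℝ} (hs : s ∈ Icc 0 T)
    (hr : r ∈ Icc 0 T) :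
    HasVelocity (T - s + r) (rotate T s γ) (concatAt (T - s) (fun t => v (s + t)) v) :=
  (h.shift hs.1 hs.2 le_rfl).concat (h.mono hr.1 hr.2) (by rw [add_sub_cancel, hc])

theorem integral_inner_rotate (h : HasVelocity T γ v) {s r : ℝ} (hs : s ∈ Icc 0 T)
    (hr : r ∈ Icc 0 T) :
    ∫ t in (0 : ℝ)..(T - s + r),
        ⟪-(stdJ n (concatAt (T - s) (fun t => v (s + t)) v t)), _root_.rotate T s γ t⟫ =
      (∫ t in s..T, ⟪-(stdJ n (v t)), γ t⟫) + ∫ t in (0 : ℝ)..r, ⟪-(stdJ n (v t)), γ t⟫ := by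
  rw [_root_.rotate, (h.shift hs.1 hs.2 le_rfl).integral_inner_concat (h.mono hr.1 hr.2),
    intervalIntegral.integral_comp_add_left (f := fun t => ⟪-(stdJ n (v t)), γ t⟫), add_zero,
    add_sub_cancel]

end HasVelocity

theorem rotate_zero {T s : ℝ} (γ : ℝ → PhaseSpace n) (hs : s ≤ T) : rotate T s γ 0 = γ s := by
  rw [rotate, concatAt_of_le (sub_nonneg.2 hs), add_zero]

theorem rotate_sub_add {T s r : ℝ} {γ : ℝ → PhaseSpace n} (hc : γ 0 = γ T) (hr : 0 ≤ r) :
    rotate T s γ (T - s + r) = γ r :=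
  concatAt_add (by rw [add_sub_cancel, hc]) hr

theorem forall_rotate {T s : ℝ} {γ : ℝ → PhaseSpace n} {Q : PhaseSpace n → Prop}
    (hs : s ∈ Icc 0 T) (h : ∀ t ∈ Icc 0 T, Q (γ t)) : ∀ t ∈ Icc 0 T, Q (rotate T s γ t) := by
  intro t ht
  rcases le_or_gt t (T - s) with hle | hlt
  · rw [rotate, concatAt_of_le hle]
    exact h _ ⟨by linarith [hs.1, ht.1], by linarith⟩
  · rw [rotate, concatAt_of_lt hlt]
    exact h _ ⟨by linarith, by linarith [hs.2, ht.2]⟩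

theorem IsClosedCharacteristic.of_hasVelocity {K : Set (PhaseSpace n)} {T : ℝ}
    {γ v : ℝ → PhaseSpace n} (hT : 0 < T) (h : HasVelocity T γ v) (hc : γ 0 = γ T)
    (hf : ∀ t ∈ Icc 0 T, γ t ∈ frontier K)
    (hv : ∀ᵐ t ∂(volume.restrict (Icc 0 T)), -(stdJ n (v t)) ∈ normalCone K (γ t))
    (hn : ∃ t ∈ Icc 0 T, γ t ≠ γ 0) : IsClosedCharacteristic K T γ :=
  ⟨hT, h.isW12, hc, hf, by filter_upwards [hv, h.ae_deriv_eq] with t h1 h2; rwa [h2], hn⟩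

theorem IsClosedCharacteristic.rotate {K : Set (PhaseSpace n)} {T s : ℝ} {γ : ℝ → PhaseSpace n}
    (h : IsClosedCharacteristic K T γ) (hs : s ∈ Icc 0 T) :
    IsClosedCharacteristic K T (rotate T s γ) := by
  have hv := h.hasVelocity.rotate h.closed hs hs
  rw [sub_add_cancel] at hv
  refine .of_hasVelocity h.period_pos hv ?_ (forall_rotate hs h.mem_frontier) ?_ ?_
  · rw [rotate_zero γ hs.2]
    have := rotate_sub_add (s := s) h.closed hs.1
    rw [sub_add_cancel] at this
    exact this.symm
  · have hab : ∀ᵐ t ∂(volume.restrict (Icc 0 (T - s + s))),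
        -(stdJ n (concatAt (T - s) (fun t => deriv γ (s + t)) (deriv γ) t)) ∈
          normalCone K (_root_.rotate T s γ t) := by
      refine ae_Icc_add ?_ ?_
      · filter_upwards [ae_comp_add_left hs.1 le_rfl h.velocity_mem,
          ae_restrict_mem measurableSet_Icc] with t ht htm
        rw [_root_.rotate, concatAt_of_le htm.2, concatAt_of_le htm.2]
        exact ht
      · have hne : ∀ᵐ t ∂(volume.restrict (Icc 0 s)), t ≠ 0 :=
          ae_restrict_of_ae (by simp [ae_iff, measure_singleton])
        filter_upwards [ae_restrict_of_ae_restrict_of_subset (Icc_subset_Icc_right hs.2)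
          h.velocity_mem, ae_restrict_mem measurableSet_Icc, hne] with t ht htm h0
        have hlt : T - s < T - s + t := by linarith [lt_of_le_of_ne htm.1 h0.symm]
        rw [_root_.rotate, concatAt_of_lt hlt, concatAt_of_lt hlt, add_sub_cancel_left]
        exact ht
    rwa [sub_add_cancel] at hab
  · by_contra hcon
    push Not at hcon
    obtain ⟨t, ht, hne⟩ := h.nonconstant
    rw [rotate_zero γ hs.2] at hcon
    have hall : ∀ r ∈ Icc 0 T, γ r = γ s := fun r hr => by
      rcases le_or_gt s r with hle | hlt
      · have := hcon (r - s) ⟨by linarith, by linarith [hr.2, hs.1]⟩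
        rwa [_root_.rotate, concatAt_of_le (by linarith [hr.2]), add_sub_cancel] at this
      · have := hcon (T - s + r) ⟨by linarith [hr.1, hs.2], by linarith⟩
        rwa [rotate_sub_add h.closed hr.1] at this
    exact hne ((hall t ht).trans (hall 0 ⟨le_rfl, h.period_pos.le⟩).symm)

theorem IsClosedCharacteristic.action_rotate {K : Set (PhaseSpace n)} {T s : ℝ}
    {γ : ℝ → PhaseSpace n} (h : IsClosedCharacteristic K T γ) (hs : s ∈ Icc 0 T) :
    action T (_root_.rotate T s γ) = action T γ := by
  have hv := h.hasVelocity.rotate h.closed hs hs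
  have hI := h.hasVelocity.integral_inner_rotate hs hs
  rw [sub_add_cancel] at hv hI
  have hi := h.hasVelocity.intervalIntegrable_inner_curve h.hasVelocity.continuousOn
  have hs' : s ∈ uIcc 0 T := by rwa [uIcc_of_le h.period_pos.le]
  rw [hv.action_eq, hI, add_comm, intervalIntegral.integral_add_adjacent_intervals
    (hi.mono_set (uIcc_subset_uIcc left_mem_uIcc hs'))
    (hi.mono_set (uIcc_subset_uIcc hs' right_mem_uIcc)), action]

end Concat

/-! ### The pieces of a cut body -/

section Pieces

variable {K : Set (PhaseSpace n)} {u : PhaseSpace n} {h : ℝ}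

theorem lowerPiece_eq_upperPiece (K : Set (PhaseSpace n)) (u : PhaseSpace n) (h : ℝ) :
    lowerPiece K u h = upperPiece K (-u) (-h) := by
  ext x
  simp [lowerPiece, upperPiece, inner_neg_left]

theorem hyperplane_neg (u : PhaseSpace n) (h : ℝ) : hyperplane (-u) (-h) = hyperplane u h := by
  ext x
  simp [hyperplane, inner_neg_left]

theorem neg_cut_nonempty (hcut : (interior K ∩ hyperplane u h).Nonempty) :
    (interior K ∩ hyperplane (-u) (-h)).Nonempty := by rwa [hyperplane_neg]

theorem upperPiece_subset : upperPiece K u h ⊆ K := inter_subset_left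

theorem convex_upperPiece (hK : Convex ℝ K) : Convex ℝ (upperPiece K u h) :=
  hK.inter (convex_halfSpace_ge (innerSL ℝ u).toLinearMap.isLinear h)

theorem isCompact_upperPiece (hKc : IsCompact K) : IsCompact (upperPiece K u h) :=
  hKc.inter_right (isClosed_le continuous_const (by fun_prop))

theorem interior_upperPiece_nonempty (hu : ‖u‖ = 1) (hcut : (interior K ∩ hyperplane u h).Nonempty) :
    (interior (upperPiece K u h)).Nonempty := by
  obtain ⟨p, hp, hpH⟩ := hcut
  obtain ⟨r, hr, hB⟩ := exists_closedBall_subset_of_mem_interior hp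
  have hopen : IsOpen (Metric.ball p r ∩ {x | h < ⟪u, x⟫}) :=
    Metric.isOpen_ball.inter (isOpen_lt continuous_const (by fun_prop))
  refine ⟨p + (r / 2) • u, interior_maximal ?_ hopen ⟨?_, ?_⟩⟩
  · rintro x ⟨hx, hxh⟩
    exact ⟨hB (Metric.ball_subset_closedBall hx), (show h < ⟪u, x⟫ from hxh).le⟩
  · rw [Metric.mem_ball, dist_eq_norm, add_sub_cancel_left, norm_smul, hu, Real.norm_eq_abs,
      abs_of_pos (by positivity)]
    linarith
  · change h < ⟪u, p + (r / 2) • u⟫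
    have hpH' : ⟪u, p⟫ = h := hpH
    rw [inner_add_right, real_inner_smul_right, real_inner_self_eq_norm_sq, hu, hpH']
    linarith

theorem normalCone_anti {K' : Set (PhaseSpace n)} (hs : K' ⊆ K) (x : PhaseSpace n) :
    normalCone K x ⊆ normalCone K' x := fun _ hv y hy => hv y (hs hy)

/-- The comparison of slopes on the two sides of the hyperplane. -/
theorem inner_div_le_inner_div_of_mem_normalCone_upperPiece (hK : Convex ℝ K)
    {x w y y' : PhaseSpace n}
    (hw : w ∈ normalCone (upperPiece K u h) x) (hy : y ∈ K) (hyh : ⟪u, y⟫ < h)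
    (hy' : y' ∈ K) (hyh' : h < ⟪u, y'⟫) :
    ⟪w, y - x⟫ / (h - ⟪u, y⟫) ≤ ⟪w, x - y'⟫ / (⟪u, y'⟫ - h) := by
  set δ := h - ⟪u, y⟫ with hδ
  set δ' := ⟪u, y'⟫ - h with hδ'
  have hpos : 0 < δ := sub_pos.2 hyh
  have hpos' : 0 < δ' := sub_pos.2 hyh'
  have hsum : 0 < δ' + δ := by positivity
  set m := (δ' / (δ' + δ)) • y + (δ / (δ' + δ)) • y' with hm
  have hmK : m ∈ K := hK hy hy' (by positivity) (by positivity) (by field_simp)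
  have hmh : ⟪u, m⟫ = h := by
    rw [hm, inner_add_right, real_inner_smul_right, real_inner_smul_right]
    have e1 : ⟪u, y⟫ = h - δ := by rw [hδ]; ring
    have e2 : ⟪u, y'⟫ = h + δ' := by rw [hδ']; ring
    rw [e1, e2]
    field_simp
    ring
  have h1 := hw m ⟨hmK, hmh.ge⟩
  rw [div_le_div_iff₀ hpos hpos']
  have e : (δ' + δ) * ⟪w, x - m⟫ = δ' * ⟪w, x - y⟫ + δ * ⟪w, x - y'⟫ := by
    rw [hm]
    simp only [inner_sub_right, inner_add_right, real_inner_smul_right]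
    field_simp
    ring
  have h2 := mul_nonneg hsum.le h1
  rw [e] at h2
  have e3 : ⟪w, y - x⟫ = -⟪w, x - y⟫ := by rw [← inner_neg_right, neg_sub]
  rw [e3]
  linarith

/-- The normal directions of the upper piece along a curve differ from normal directions of the
whole body by a measurable multiple of the direction of the cut. -/
theorem exists_stripping (hK : Convex ℝ K) (hKc : IsCompact K) (hu : ‖u‖ = 1)
    (hcut : (interior K ∩ hyperplane u h).Nonempty) {T : ℝ} {γ v : ℝ → PhaseSpace n}
    (hγ : HasVelocity T γ v) (hmem : ∀ t ∈ Icc 0 T, γ t ∈ upperPiece K u h)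
    (hv : ∀ᵐ t ∂(volume.restrict (Icc 0 T)),
      -(stdJ n (v t)) ∈ normalCone (upperPiece K u h) (γ t)) :
    ∃ α : ℝ → ℝ, (∀ t, 0 ≤ α t) ∧ MemLp α 2 (volume.restrict (Icc 0 T)) ∧
      (∀ t ∈ Icc 0 T, γ t ∉ hyperplane u h → α t = 0) ∧
      ∀ᵐ t ∂(volume.restrict (Icc 0 T)), -(stdJ n (v t)) + α t • u ∈ normalCone K (γ t) := by
  classical
  obtain ⟨p, hp, hpH⟩ := hcut
  have hpH' : ⟪u, p⟫ = h := hpH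
  obtain ⟨r, hr, hB⟩ := exists_closedBall_subset_of_mem_interior hp
  have huu : ⟪u, u⟫ = 1 := by rw [real_inner_self_eq_norm_sq, hu]; norm_num
  have hqmem : ∀ c : ℝ, |c| ≤ r → p + c • u ∈ K := fun c hc => hB (by
    rwa [Metric.mem_closedBall, dist_eq_norm, add_sub_cancel_left, norm_smul, hu, mul_one])
  set D : Set (PhaseSpace n) := K ∩ {y | ⟪u, y⟫ < h} with hD
  have hDne : D.Nonempty := ⟨p + (-r) • u, hqmem _ (by rw [abs_neg, abs_of_pos hr]), by
    change ⟪u, p + (-r) • u⟫ < h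
    rw [inner_add_right, real_inner_smul_right, huu, hpH']
    linarith⟩
  have : Nonempty D := hDne.to_subtype
  set Y : ℕ → D := TopologicalSpace.denseSeq D with hY
  set q := p + r • u with hq
  have hqK : q ∈ K := hqmem r (abs_of_pos hr).le
  have hqh : ⟪u, q⟫ = h + r := by
    rw [hq, inner_add_right, real_inner_smul_right, huu, hpH', mul_one]
  set w : ℝ → PhaseSpace n := fun t => -(stdJ n (v t)) with hwdef
  set a : ℝ → ℝ := fun t => ⨆ k, max 0 (⟪w t, (Y k : PhaseSpace n) - γ t⟫ /
    (h - ⟪u, (Y k : PhaseSpace n)⟫)) with ha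
  set s : Set ℝ := Icc 0 T ∩ γ ⁻¹' hyperplane u h with hs
  have hHclosed : IsClosed (hyperplane u h) :=
    isClosed_eq (f := fun x : PhaseSpace n => ⟪u, x⟫) (by fun_prop) continuous_const
  have hsm : MeasurableSet s :=
    (hγ.continuousOn.preimage_isClosed_of_isClosed isClosed_Icc hHclosed).measurableSet
  have ha0 : ∀ t, 0 ≤ a t := fun t => Real.iSup_nonneg fun k => le_max_left _ _
  obtain ⟨R, hR⟩ := hKc.exists_bound_of_continuousOn continuousOn_id
  have hbd : ∀ t ∈ s, w t ∈ normalCone (upperPiece K u h) (γ t) → ∀ y' ∈ K, h < ⟪u, y'⟫ → ∀ k,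
      max 0 (⟪w t, (Y k : PhaseSpace n) - γ t⟫ / (h - ⟪u, (Y k : PhaseSpace n)⟫)) ≤
        ⟪w t, γ t - y'⟫ / (⟪u, y'⟫ - h) := by
    intro t ht hwt y' hy' hyh' k
    refine max_le ?_ (inner_div_le_inner_div_of_mem_normalCone_upperPiece hK hwt (Y k).2.1
      (Y k).2.2 hy' hyh')
    exact div_nonneg (hwt y' ⟨hy', hyh'.le⟩) (sub_pos.2 hyh').le
  have hnormal : ∀ t ∈ s, w t ∈ normalCone (upperPiece K u h) (γ t) →
      w t + a t • u ∈ normalCone K (γ t) := by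
    intro t ht hwt y hy
    have hγh : ⟪u, γ t⟫ = h := ht.2
    have hbdd : BddAbove (range fun k => max 0 (⟪w t, (Y k : PhaseSpace n) - γ t⟫ /
        (h - ⟪u, (Y k : PhaseSpace n)⟫))) := by
      refine ⟨⟪w t, γ t - q⟫ / (⟪u, q⟫ - h), ?_⟩
      rintro _ ⟨k, rfl⟩
      exact hbd t ht hwt q hqK (by linarith) k
    have hexp : ∀ y, ⟪w t + a t • u, γ t - y⟫ = ⟪w t, γ t - y⟫ + a t * (h - ⟪u, y⟫) := fun y => by
      rw [inner_add_left, real_inner_smul_left, inner_sub_right u, hγh]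
    rcases lt_trichotomy ⟪u, y⟫ h with hlt | heq | hgt
    · have hcl : IsClosed {y : D | 0 ≤ ⟪w t + a t • u, γ t - (y : PhaseSpace n)⟫} :=
        isClosed_le continuous_const (by fun_prop)
      have hall : ∀ y : D, 0 ≤ ⟪w t + a t • u, γ t - (y : PhaseSpace n)⟫ := by
        refine isClosed_property (TopologicalSpace.denseRange_denseSeq D) hcl fun k => ?_
        rw [hexp]
        have hpos : 0 < h - ⟪u, (Y k : PhaseSpace n)⟫ := sub_pos.2 (Y k).2.2
        have h1 : ⟪w t, (Y k : PhaseSpace n) - γ t⟫ / (h - ⟪u, (Y k : PhaseSpace n)⟫) ≤ a t :=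
          (le_max_right _ _).trans (le_ciSup hbdd k)
        rw [div_le_iff₀ hpos] at h1
        have e3 : ⟪w t, γ t - (Y k : PhaseSpace n)⟫ = -⟪w t, (Y k : PhaseSpace n) - γ t⟫ := by
          rw [← inner_neg_right, neg_sub]
        rw [← hY, e3]
        linarith
      exact hall ⟨y, hy, hlt⟩
    · rw [hexp, heq, sub_self, mul_zero, add_zero]
      exact hwt y ⟨hy, heq.ge⟩
    · rw [hexp]
      have h1 : a t ≤ ⟪w t, γ t - y⟫ / (⟪u, y⟫ - h) := ciSup_le fun k => hbd t ht hwt y hy hgt k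
      rw [le_div_iff₀ (sub_pos.2 hgt)] at h1
      linarith
  refine ⟨s.indicator a, fun t => indicator_nonneg (fun t _ => ha0 t) t, ?_, ?_, ?_⟩
  · have hwm : AEMeasurable w (volume.restrict (Icc 0 T)) :=
      hγ.neg_stdJ_memLp.aestronglyMeasurable.aemeasurable
    have hγm : AEMeasurable γ (volume.restrict (Icc 0 T)) :=
      hγ.continuousOn.aemeasurable measurableSet_Icc
    have ham : AEMeasurable a (volume.restrict (Icc 0 T)) := by
      refine AEMeasurable.iSup fun k => ?_
      exact (aemeasurable_const (b := (0 : ℝ))).max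
        ((hwm.inner (aemeasurable_const.sub hγm)).div_const _)
    refine MemLp.of_le_mul (g := w) (c := (R + ‖q‖) / r) hγ.neg_stdJ_memLp
      (ham.indicator hsm).aestronglyMeasurable ?_
    filter_upwards [hv, ae_restrict_mem measurableSet_Icc] with t ht htm
    have hRq : 0 ≤ R + ‖q‖ := by
      have := (norm_nonneg _).trans (hR q hqK)
      positivity
    by_cases hts : t ∈ s
    · rw [indicator_of_mem hts, Real.norm_eq_abs, abs_of_nonneg (ha0 t)]
      have h1 : a t ≤ ⟪w t, γ t - q⟫ / (⟪u, q⟫ - h) :=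
        ciSup_le fun k => hbd t hts ht q hqK (by linarith) k
      rw [hqh, add_sub_cancel_left] at h1
      refine h1.trans ?_
      rw [div_mul_eq_mul_div]
      refine div_le_div_of_nonneg_right ?_ hr.le
      refine (real_inner_le_norm _ _).trans ?_
      rw [mul_comm]
      refine mul_le_mul_of_nonneg_right ((norm_sub_le _ _).trans ?_) (norm_nonneg _)
      exact add_le_add_left (hR _ (hmem t htm).1) _
    · rw [indicator_of_notMem hts, norm_zero]
      positivity
  · intro t _ htH
    exact indicator_of_notMem (fun hts => htH hts.2) _
  · filter_upwards [hv, ae_restrict_mem measurableSet_Icc] with t ht htm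
    by_cases hts : t ∈ s
    · rw [indicator_of_mem hts]
      exact hnormal t hts ht
    · rw [indicator_of_notMem hts, zero_smul, add_zero]
      have hγt := hmem t htm
      have hgt : h < ⟪u, γ t⟫ := lt_of_le_of_ne hγt.2 fun heq => hts ⟨htm, heq.symm⟩
      intro y hy
      rcases le_or_gt h ⟪u, y⟫ with hle | hlt
      · exact ht y ⟨hy, hle⟩
      · have h1 := inner_div_le_inner_div_of_mem_normalCone_upperPiece hK ht hy hlt hγt.1 hgt
        rw [sub_self, inner_zero_right, zero_div, div_le_iff₀ (sub_pos.2 hlt), zero_mul] at h1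
        rw [← neg_sub, inner_neg_right]
        linarith

end Pieces

/-! ### Gluing arcs -/

section Glue

variable {K : Set (PhaseSpace n)} {u : PhaseSpace n} {h : ℝ}

/-- A curve whose ends differ by `a • J u`, such that closing it by a chord in the hyperplane gives
a closed curve of action `A`, and whose length is the one of a characteristic. -/
structure IsBalancedArc (K : Set (PhaseSpace n)) (u : PhaseSpace n) (h S a A : ℝ)
    (ζ v : ℝ → PhaseSpace n) : Prop where
  hasVelocity : HasVelocity S ζ v
  nonneg : 0 ≤ a
  chord : ζ S - ζ 0 = a • stdJ n u
  mem_hyperplane : a ≠ 0 → ⟪u, ζ 0⟫ = h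
  length_eq : supportLength K S v = 2 * A + a * h
  integral_eq : ∫ t in (0 : ℝ)..S, ⟪-(stdJ n (v t)), ζ t⟫ = 2 * A + a * h

theorem ehzCapacity_le_of_loop [Nontrivial (PhaseSpace n)] (hK : Convex ℝ K) (hKc : IsCompact K)
    (hi : (interior K).Nonempty) {T A : ℝ} {γ v : ℝ → PhaseSpace n} (hγ : HasVelocity T γ v)
    (hc : γ 0 = γ T) (hA : 0 < A) (hL : supportLength K T v ≤ 2 * A) (hact : action T γ = A) :
    ehzCapacity K ≤ A := by
  have h1 := four_mul_ehzCapacity_mul_action_le hK hKc hi hγ hc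
  have h2 := pow_le_pow_left₀ (hγ.supportLength_nonneg hc hKc hi) hL 2
  rw [hact] at h1
  nlinarith

theorem IsBalancedArc.ehzCapacity_le [Nontrivial (PhaseSpace n)] (hK : Convex ℝ K)
    (hKc : IsCompact K) (hi : (interior K).Nonempty) {S A : ℝ} {ζ v : ℝ → PhaseSpace n}
    (hζ : IsBalancedArc K u h S 0 A ζ v) (hA : 0 < A) : ehzCapacity K ≤ A := by
  have hc := hζ.chord
  rw [zero_smul, sub_eq_zero] at hc
  refine ehzCapacity_le_of_loop hK hKc hi hζ.hasVelocity hc.symm hA ?_ ?_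
  · rw [hζ.length_eq]
    simp
  · rw [hζ.hasVelocity.action_eq, hζ.integral_eq]
    ring

theorem neg_stdJ_smul_stdJ (c : ℝ) (u : PhaseSpace n) : -(stdJ n (c • stdJ n u)) = c • u := by
  rw [map_smul, stdJ_stdJ, smul_neg, neg_neg]

theorem exists_glue [Nontrivial (PhaseSpace n)] (hK : Convex ℝ K) (hKc : IsCompact K)
    (hi : (interior K).Nonempty) {S₁ S₂ a₁ a₂ A₁ A₂ : ℝ}
    {ζ₁ v₁ ζ₂ v₂ : ℝ → PhaseSpace n} (h₁ : IsBalancedArc K u h S₁ a₁ A₁ ζ₁ v₁)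
    (h₂ : IsBalancedArc K (-u) (-h) S₂ a₂ A₂ ζ₂ v₂) (hA₁ : 0 < A₁) (hA₂ : 0 < A₂) :
    ehzCapacity K ≤ A₁ + A₂ ∧ (A₁ + A₂ ≤ ehzCapacity K →
      ∃ x₁ x₂ : PhaseSpace n,
        IsSystole K (S₁ + S₂) (concatAt S₁ (fun t => ζ₁ t + x₁) (fun t => ζ₂ t + x₂)) ∧
        SplitsAt u h (S₁ + S₂)
          (concatAt S₁ (fun t => ζ₁ t + x₁) (fun t => ζ₂ t + x₂)) 0 S₁) := by
  have hne : K.Nonempty := hi.mono interior_subset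
  rcases eq_or_ne a₁ 0 with rfl | ha₁
  · have := h₁.ehzCapacity_le hK hKc hi hA₁
    exact ⟨by linarith, fun hle => by linarith⟩
  rcases eq_or_ne a₂ 0 with rfl | ha₂
  · have := h₂.ehzCapacity_le hK hKc hi hA₂
    exact ⟨by linarith, fun hle => by linarith⟩
  have ha₁' : 0 < a₁ := lt_of_le_of_ne h₁.nonneg ha₁.symm
  have ha₂' : 0 < a₂ := lt_of_le_of_ne h₂.nonneg ha₂.symm
  have H₁ := h₁.mem_hyperplane ha₁
  have H₂ := h₂.mem_hyperplane ha₂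
  rw [inner_neg_left, neg_inj] at H₂
  have e₁ : ζ₁ S₁ = ζ₁ 0 + a₁ • stdJ n u := by rw [← h₁.chord]; abel
  have e₂ : ζ₂ S₂ = ζ₂ 0 - a₂ • stdJ n u := by
    have := h₂.chord
    rw [map_neg, smul_neg] at this
    rw [sub_eq_add_neg, ← this]; abel
  have v₁h := h₁.hasVelocity
  have v₂h := h₂.hasVelocity
  -- the closed curve that runs through `ζ₁` and a rescaled copy of `ζ₂`
  have hloop : ∀ c : ℝ, 0 < c → c * a₂ = a₁ → ∃ k : PhaseSpace n,
      HasVelocity (S₁ + S₂) (concatAt S₁ ζ₁ (fun t => c • ζ₂ t + k))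
        (concatAt S₁ v₁ (fun t => c • v₂ t)) ∧
      concatAt S₁ ζ₁ (fun t => c • ζ₂ t + k) 0 =
        concatAt S₁ ζ₁ (fun t => c • ζ₂ t + k) (S₁ + S₂) ∧
      supportLength K (S₁ + S₂) (concatAt S₁ v₁ (fun t => c • v₂ t)) ≤ 2 * (A₁ + c * A₂) ∧
      action (S₁ + S₂) (concatAt S₁ ζ₁ (fun t => c • ζ₂ t + k)) = A₁ + c ^ 2 * A₂ := by
    intro c hc hca
    set k := ζ₁ S₁ - c • ζ₂ 0 with hk
    have hv := (v₂h.const_smul c).add_const k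
    have hjoin : ζ₁ S₁ = (fun t => c • ζ₂ t + k) 0 := by simp [hk]
    have hcat := v₁h.concat hv hjoin
    refine ⟨k, hcat, ?_, ?_, ?_⟩
    · rw [concatAt_of_le v₁h.nonneg, concatAt_add hjoin v₂h.nonneg, hk, e₂, e₁, smul_sub,
        smul_smul, hca]
      abel
    · rw [v₁h.supportLength_concat hv hKc hne, h₁.length_eq]
      have := v₂h.supportLength_const_smul_le hKc hne hc.le
      rw [h₂.length_eq] at this
      have e : c * (2 * A₂ + a₂ * -h) = 2 * (c * A₂) - a₁ * h := by rw [← hca]; ring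
      rw [e] at this
      linarith
    · rw [hcat.action_eq, v₁h.integral_inner_concat hv, h₁.integral_eq]
      have e : ∀ t, ⟪-(stdJ n (c • v₂ t)), c • ζ₂ t + k⟫ =
          c ^ 2 * ⟪-(stdJ n (v₂ t)), ζ₂ t⟫ + c * ⟪-(stdJ n (v₂ t)), k⟫ := fun t => by
        rw [map_smul, ← smul_neg, real_inner_smul_left, inner_add_right, real_inner_smul_right]
        ring
      simp only [e]
      rw [intervalIntegral.integral_add
        ((v₂h.intervalIntegrable_inner_curve v₂h.continuousOn).const_mul _)
        ((v₂h.intervalIntegrable_inner_const k).const_mul _),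
        intervalIntegral.integral_const_mul, intervalIntegral.integral_const_mul,
        v₂h.integral_inner_const, h₂.integral_eq, h₂.chord, neg_stdJ_smul_stdJ,
        real_inner_smul_left, inner_neg_left, hk, e₁]
      simp only [inner_sub_right, inner_add_right, real_inner_smul_right, inner_self_stdJ, H₁, H₂]
      rw [← hca]
      ring
  have hratio := hloop (a₁ / a₂) (by positivity) (by field_simp)
  obtain ⟨k, hcat, hclosed, hlen, hact⟩ := hratio
  set c := a₁ / a₂ with hc
  have hcpos : 0 < c := by positivity
  have hiso := four_mul_ehzCapacity_mul_action_le hK hKc hi hcat hclosed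
  have hsq := pow_le_pow_left₀ (hcat.supportLength_nonneg hclosed hKc hi) hlen 2
  rw [hact] at hiso
  have hcs : (A₁ + c * A₂) ^ 2 = (A₁ + A₂) * (A₁ + c ^ 2 * A₂) - A₁ * A₂ * (1 - c) ^ 2 := by ring
  have hkey : ehzCapacity K * (A₁ + c ^ 2 * A₂) ≤
      (A₁ + A₂) * (A₁ + c ^ 2 * A₂) - A₁ * A₂ * (1 - c) ^ 2 := by
    rw [← hcs]
    nlinarith
  have hBpos : 0 < A₁ + c ^ 2 * A₂ := by positivity
  have hAA : 0 < A₁ * A₂ := by positivity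
  have hsubadd : ehzCapacity K ≤ A₁ + A₂ := by
    have : 0 ≤ A₁ * A₂ * (1 - c) ^ 2 := by positivity
    exact le_of_mul_le_mul_right (by linarith) hBpos
  refine ⟨hsubadd, fun hle => ?_⟩
  have hc1 : c = 1 := by
    have h3 := mul_le_mul_of_nonneg_right hle hBpos.le
    have h4 : A₁ * A₂ * (1 - c) ^ 2 ≤ 0 := by linarith
    have h5 : (1 - c) ^ 2 ≤ 0 := by
      by_contra hneg
      push Not at hneg
      linarith [mul_pos hAA hneg]
    nlinarith
  rw [hc1] at hcat hclosed hlen hact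
  obtain ⟨x, hx⟩ := exists_translate_isSystole hK hKc hi hcat hclosed (by linarith) (by linarith)
  have hfun : (fun t => concatAt S₁ ζ₁ (fun t => (1 : ℝ) • ζ₂ t + k) t + x) =
      concatAt S₁ (fun t => ζ₁ t + x) (fun t => ζ₂ t + (k + x)) := by
    ext1 t
    simp only [concatAt]
    split_ifs
    · rfl
    · rw [one_smul, add_assoc]
  have hxu : ⟪u, x⟫ = 0 := by
    have hv := (hcat.add_const x).ae_deriv_eq
    have hsub : Icc 0 S₁ ⊆ Icc 0 (S₁ + S₂) := Icc_subset_Icc_right (by linarith [v₂h.nonneg])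
    have hI : supportLength K S₁ v₁ = ∫ t in (0 : ℝ)..S₁, ⟪-(stdJ n (v₁ t)), ζ₁ t + x⟫ := by
      refine integral_congr_ae_Icc v₁h.nonneg ?_
      filter_upwards [ae_restrict_of_ae_restrict_of_subset hsub hv,
        ae_restrict_of_ae_restrict_of_subset hsub hx.1.velocity_mem,
        ae_restrict_mem measurableSet_Icc] with t h3 h4 h5
      have h6 := hx.1.mem hKc (hsub h5)
      rw [h3] at h4
      simp only [concatAt_of_le h5.2] at h4 h6
      exact supportFn_eq_of_mem_normalCone hKc h6 h4
    simp only [inner_add_right] at hI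
    rw [intervalIntegral.integral_add (v₁h.intervalIntegrable_inner_curve v₁h.continuousOn)
      (v₁h.intervalIntegrable_inner_const x), h₁.integral_eq, h₁.length_eq,
      v₁h.integral_inner_const, h₁.chord, neg_stdJ_smul_stdJ, real_inner_smul_left] at hI
    have : a₁ * ⟪u, x⟫ = 0 := by linarith
    exact (mul_eq_zero.1 this).resolve_left ha₁
  have hJu : stdJ n u ≠ 0 := by
    intro h0
    have hu0 : u = 0 := by
      rw [← norm_eq_zero, ← norm_stdJ, h0, norm_zero]
    have hca : ζ₁ 0 = ζ₁ S₁ := by rw [e₁, h0, smul_zero, add_zero]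
    have h7 := ehzCapacity_le_of_loop hK hKc hi v₁h hca hA₁ (by
      rw [h₁.length_eq, ← H₁, hu0]; simp) (by
      rw [v₁h.action_eq, h₁.integral_eq, ← H₁, hu0]
      simp)
    linarith
  have hS₁ : 0 < S₁ := by
    refine lt_of_le_of_ne v₁h.nonneg fun h0 => ?_
    have := h₁.chord
    rw [← h0, sub_self] at this
    exact (smul_ne_zero ha₁ hJu) this.symm
  rw [hfun] at hx
  refine ⟨x, k + x, hx, le_rfl, hS₁, by linarith [v₂h.nonneg], ?_, ?_, a₁, ha₁', ?_⟩
  · rw [concatAt_of_le v₁h.nonneg]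
    change ⟪u, ζ₁ 0 + x⟫ = h
    rw [inner_add_right, H₁, hxu, add_zero]
  · rw [concatAt_of_le le_rfl]
    change ⟪u, ζ₁ S₁ + x⟫ = h
    rw [e₁, inner_add_right, inner_add_right, H₁, hxu, real_inner_smul_right, inner_self_stdJ]
    ring
  · rw [concatAt_of_le v₁h.nonneg, concatAt_of_le le_rfl, add_sub_add_right_eq_sub, h₁.chord]

/-- Deleting the motion of a characteristic of the upper piece along the hyperplane. -/
theorem isBalancedArc_of_stripping {T : ℝ} {γ : ℝ → PhaseSpace n} {α : ℝ → ℝ} (hKc : IsCompact K)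
    (hγ : IsClosedCharacteristic (upperPiece K u h) T γ) (h0 : ⟪u, γ 0⟫ = h) (hα : ∀ t, 0 ≤ α t)
    (hαL : MemLp α 2 (volume.restrict (Icc 0 T)))
    (hαH : ∀ t ∈ Icc 0 T, γ t ∉ hyperplane u h → α t = 0)
    (hN : ∀ᵐ t ∂(volume.restrict (Icc 0 T)),
      -(stdJ n (deriv γ t)) + α t • u ∈ normalCone K (γ t)) :
    IsBalancedArc K u h T (∫ t in (0 : ℝ)..T, α t) (action T γ)
      (fun t => γ t + (∫ r in (0 : ℝ)..t, α r) • stdJ n u)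
      (fun t => deriv γ t + α t • stdJ n u) := by
  have hT := hγ.period_pos
  have hv := hγ.hasVelocity
  have hαi := intervalIntegrable_of_memLp hT.le hαL
  have hαvel : ∀ x : PhaseSpace n,
      HasVelocity T (fun t => (∫ r in (0 : ℝ)..t, α r) • x) (fun t => α t • x) := fun x => by
    refine ⟨hT.le, ?_, fun t _ => ?_⟩
    · exact (ContinuousLinearMap.smulRight (1 : ℝ →L[ℝ] ℝ) x).comp_memLp' hαL
    · rw [intervalIntegral.integral_smul_const]
      simp
  have hζ := hv.add (hαvel (stdJ n u))
  have hw : ∀ t, -(stdJ n (deriv γ t + α t • stdJ n u)) = -(stdJ n (deriv γ t)) + α t • u :=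
    fun t => by rw [map_add, neg_add, neg_stdJ_smul_stdJ]
  have hγK : ∀ t ∈ Icc 0 T, γ t ∈ K := fun t ht =>
    upperPiece_subset (hγ.mem (isCompact_upperPiece hKc) ht)
  have hαh : ∀ t ∈ Icc 0 T, α t * ⟪u, γ t⟫ = α t * h := fun t ht => by
    by_cases hH : γ t ∈ hyperplane u h
    · rw [show ⟪u, γ t⟫ = h from hH]
    · rw [hαH t ht hH, zero_mul, zero_mul]
  have hint : ∫ t in (0 : ℝ)..T, ⟪-(stdJ n (deriv γ t + α t • stdJ n u)), γ t⟫ =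
      2 * action T γ + (∫ t in (0 : ℝ)..T, α t) * h := by
    have e : ∫ t in (0 : ℝ)..T, ⟪-(stdJ n (deriv γ t + α t • stdJ n u)), γ t⟫ =
        ∫ t in (0 : ℝ)..T, (⟪-(stdJ n (deriv γ t)), γ t⟫ + α t * h) := by
      refine intervalIntegral.integral_congr fun t ht => ?_
      rw [uIcc_of_le hT.le] at ht
      simp only [hw]
      rw [inner_add_left, real_inner_smul_left, hαh t ht]
    rw [e, intervalIntegral.integral_add (hv.intervalIntegrable_inner_curve hv.continuousOn)
      (hαi.mul_const h), intervalIntegral.integral_mul_const, action]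
    ring
  refine ⟨hζ, intervalIntegral.integral_nonneg hT.le fun t _ => hα t, ?_, fun _ => ?_, ?_, ?_⟩
  · simp only [intervalIntegral.integral_same, zero_smul, add_zero]
    rw [← hγ.closed, add_sub_cancel_left]
  · simpa using h0
  · rw [← hint]
    refine integral_congr_ae_Icc hT.le ?_
    filter_upwards [hN, ae_restrict_mem measurableSet_Icc] with t h1 h2
    rw [hw]
    exact supportFn_eq_of_mem_normalCone hKc (hγK t h2) h1
  · have hparts := hv.integral_inner_add (hαvel u)
    have e1 : ∫ t in (0 : ℝ)..T, ⟪α t • u, γ t⟫ = (∫ t in (0 : ℝ)..T, α t) * h := by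
      rw [← intervalIntegral.integral_mul_const]
      refine intervalIntegral.integral_congr fun t ht => ?_
      rw [uIcc_of_le hT.le] at ht
      simp only [real_inner_smul_left]
      exact hαh t ht
    rw [e1, ← hγ.closed, real_inner_smul_right, real_inner_comm u, h0] at hparts
    simp only [intervalIntegral.integral_same, zero_smul, inner_zero_right, sub_zero] at hparts
    have e2 : ∀ t, ⟪-(stdJ n (deriv γ t + α t • stdJ n u)),
        γ t + (∫ r in (0 : ℝ)..t, α r) • stdJ n u⟫ =
        ⟪-(stdJ n (deriv γ t + α t • stdJ n u)), γ t⟫ -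
          ⟪deriv γ t, (∫ r in (0 : ℝ)..t, α r) • u⟫ := fun t => by
      have e3 : ⟪-(stdJ n (deriv γ t)) + α t • u, stdJ n u⟫ = -⟪deriv γ t, u⟫ := by
        rw [inner_add_left, inner_neg_left, inner_stdJ_stdJ, real_inner_smul_left,
          inner_self_stdJ, mul_zero, add_zero]
      rw [inner_add_right, hw, real_inner_smul_right, e3, real_inner_smul_right]
      ring
    simp only [e2]
    rw [intervalIntegral.integral_sub (hζ.intervalIntegrable_inner_curve hv.continuousOn)
      (HasVelocity.intervalIntegrable_inner hv.intervalIntegrable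
        (hαvel u).absolutelyContinuous.continuousOn), hint]
    linarith

/-- A characteristic of the upper piece that stays away from the hyperplane is a characteristic
of the whole body. -/
theorem ehzCapacity_le_of_forall_notMem [Nontrivial (PhaseSpace n)] (hK : Convex ℝ K)
    (hKc : IsCompact K) (hu : ‖u‖ = 1) (hcut : (interior K ∩ hyperplane u h).Nonempty) {T : ℝ}
    {γ : ℝ → PhaseSpace n} (hγ : IsClosedCharacteristic (upperPiece K u h) T γ)
    (hH : ∀ t ∈ Icc 0 T, γ t ∉ hyperplane u h) : ehzCapacity K ≤ action T γ := by
  have hi : (interior K).Nonempty := hcut.mono inter_subset_left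
  have hK₁c := isCompact_upperPiece (u := u) (h := h) hKc
  obtain ⟨α, -, -, hα, hN⟩ := exists_stripping hK hKc hu hcut hγ.hasVelocity
    (fun t ht => hγ.mem hK₁c ht) hγ.velocity_mem
  refine ehzCapacity_le_of_loop hK hKc hi hγ.hasVelocity hγ.closed
    (hγ.action_pos hK₁c (interior_upperPiece_nonempty hu hcut)) (le_of_eq ?_) rfl
  rw [action, ← mul_assoc]
  norm_num only [one_mul]
  refine integral_congr_ae_Icc hγ.period_pos.le ?_
  filter_upwards [hN, ae_restrict_mem measurableSet_Icc] with t h1 h2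
  rw [hα t h2 (hH t h2), zero_smul, add_zero] at h1
  exact supportFn_eq_of_mem_normalCone hKc (upperPiece_subset (hγ.mem hK₁c h2)) h1

/-- After rotation, a characteristic of the upper piece can be stripped of its motion along the
hyperplane. -/
theorem exists_stripsTo [Nontrivial (PhaseSpace n)] (hK : Convex ℝ K)
    (hKc : IsCompact K) (hu : ‖u‖ = 1) (hcut : (interior K ∩ hyperplane u h).Nonempty) {T : ℝ}
    {γ : ℝ → PhaseSpace n} (hγ : IsClosedCharacteristic (upperPiece K u h) T γ)
    (hA : action T γ < ehzCapacity K) :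
    ∃ s ∈ Icc 0 T, ∃ (a : ℝ) (ζ v : ℝ → PhaseSpace n), IsBalancedArc K u h T a (action T γ) ζ v ∧
      ∀ x, StripsTo K (hyperplane u h) u T (rotate T s γ) (fun t => ζ t + x) := by
  have hK₁c := isCompact_upperPiece (u := u) (h := h) hKc
  have hmeet : ∃ s ∈ Icc 0 T, γ s ∈ hyperplane u h := by
    by_contra hcon
    push Not at hcon
    exact absurd (ehzCapacity_le_of_forall_notMem hK hKc hu hcut hγ hcon) (not_le.2 hA)
  obtain ⟨s, hs, hsH⟩ := hmeet
  have hrot := hγ.rotate hs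
  obtain ⟨α, hα0, hαL, hα, hN⟩ := exists_stripping hK hKc hu hcut hrot.hasVelocity
    (fun t ht => hrot.mem hK₁c ht) hrot.velocity_mem
  have harc := isBalancedArc_of_stripping hKc hrot
    (by rw [rotate_zero γ hs.2]; exact hsH) hα0 hαL hα hN
  rw [hγ.action_rotate hs] at harc
  refine ⟨s, hs, _, _, _, harc, fun x => ⟨x, α, hα0,
    intervalIntegrable_of_memLp hγ.period_pos.le hαL, hα, hN, fun t _ => ?_⟩⟩
  beta_reduce
  abel

/-- The arc of a characteristic that is closed by a single chord. -/
theorem IsArcThenChord.exists_isBalancedArc {T a : ℝ} {γ : ℝ → PhaseSpace n} (hKc : IsCompact K)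
    (hu : ‖u‖ = 1) (hcut : (interior K ∩ hyperplane u h).Nonempty)
    (hγ : IsClosedCharacteristic (upperPiece K u h) T γ) (ha : IsArcThenChord K u T a γ) :
    ∃ c, IsBalancedArc K u h a c (action T γ) γ (deriv γ) := by
  obtain ⟨haT, hN, hchord⟩ := ha
  have hv := hγ.hasVelocity
  have hT := hγ.period_pos
  have hTT : T ∈ Icc 0 T := ⟨hT.le, le_rfl⟩
  have huu : ⟪u, u⟫ = 1 := by rw [real_inner_self_eq_norm_sq, hu]; norm_num
  obtain ⟨p, hp, hpH⟩ := hcut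
  have hpH' : ⟪u, p⟫ = h := hpH
  have hpK₁ : p ∈ upperPiece K u h := ⟨interior_subset hp, hpH'.ge⟩
  set c : ℝ → ℝ := fun t => -⟪deriv γ t, stdJ n u⟫ with hc
  have hcae : ∀ᵐ t ∂(volume.restrict (Icc a T)), 0 ≤ c t ∧ deriv γ t = -(c t • stdJ n u) := by
    filter_upwards [hchord] with t ht
    obtain ⟨b, hb, hbt⟩ := ht
    have : c t = b := by
      simp only [hc]
      rw [hbt, inner_neg_left, real_inner_smul_left, inner_stdJ_stdJ, huu]
      ring
    rw [this]
    exact ⟨hb, hbt⟩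
  have hvi := hv.intervalIntegrable_sub haT hTT
  have hci : IntervalIntegrable c volume a T :=
    (HasVelocity.intervalIntegrable_inner hvi continuousOn_const).neg
  have hIocIcc : uIoc a T ⊆ Icc a T := by rw [uIoc_of_le haT.2]; exact Ioc_subset_Icc_self
  have hvel : ∀ t ∈ Icc a T, γ T - γ t = -((∫ r in t..T, c r) • stdJ n u) := fun t ht => by
    have htT : t ∈ Icc 0 T := ⟨haT.1.trans ht.1, ht.2⟩
    rw [hv.sub_eq htT hTT, ← intervalIntegral.integral_smul_const, ← intervalIntegral.integral_neg]
    refine intervalIntegral.integral_congr_ae_restrict ?_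
    have hsub : uIoc t T ⊆ Icc a T := by
      rw [uIoc_of_le ht.2]
      exact fun r hr => ⟨ht.1.trans hr.1.le, hr.2⟩
    exact (ae_restrict_of_ae_restrict_of_subset hsub hcae).mono fun r hr => hr.2
  have hconst : ∀ t ∈ Icc a T, ⟪u, γ t⟫ = ⟪u, γ 0⟫ := fun t ht => by
    have := congrArg (fun x => ⟪u, x⟫) (hvel t ht)
    simp only [inner_sub_right, inner_neg_right, real_inner_smul_right, inner_self_stdJ,
      mul_zero, neg_zero] at this
    rw [hγ.closed]
    linarith
  set c₀ := ∫ t in a..T, c t with hc₀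
  have hc₀nn : 0 ≤ c₀ := intervalIntegral.integral_nonneg_of_ae_restrict haT.2
    (hcae.mono fun t ht => ht.1)
  have hH : c₀ ≠ 0 → ⟪u, γ 0⟫ = h := by
    intro hne
    have hex : ∃ t ∈ Icc a T, 0 < c t ∧ -(stdJ n (deriv γ t)) = -(c t • u) ∧
        -(stdJ n (deriv γ t)) ∈ normalCone (upperPiece K u h) (γ t) := by
      by_contra hcon
      push Not at hcon
      refine hne ?_
      rw [hc₀, intervalIntegral.integral_congr_ae_restrict (g := fun _ => 0),
        intervalIntegral.integral_zero]
      filter_upwards [ae_restrict_of_ae_restrict_of_subset hIocIcc hcae,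
        ae_restrict_of_ae_restrict_of_subset
          (hIocIcc.trans (Icc_subset_Icc_left haT.1)) hγ.velocity_mem,
        ae_restrict_mem measurableSet_uIoc] with t h1 h2 h3
      by_contra hct
      refine hcon t (hIocIcc h3) (lt_of_le_of_ne h1.1 (Ne.symm hct)) ?_ h2
      rw [h1.2, map_neg, neg_stdJ_smul_stdJ]
    obtain ⟨t, ht, hct, hJ, hnc⟩ := hex
    rw [← hconst t ht]
    refine le_antisymm ?_ (hγ.mem (isCompact_upperPiece hKc) ⟨haT.1.trans ht.1, ht.2⟩).2
    have h1 := hnc p hpK₁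
    rw [hJ, inner_neg_left, real_inner_smul_left, inner_sub_right, hpH'] at h1
    by_contra hlt
    push Not at hlt
    nlinarith
  have hint : ∫ t in (0 : ℝ)..a, ⟪-(stdJ n (deriv γ t)), γ t⟫ = 2 * action T γ + c₀ * h := by
    have hi := hv.intervalIntegrable_inner_curve hv.continuousOn
    have ha' : a ∈ uIcc 0 T := by rwa [uIcc_of_le hT.le]
    have hsplit := intervalIntegral.integral_add_adjacent_intervals
      (hi.mono_set (uIcc_subset_uIcc left_mem_uIcc ha'))
      (hi.mono_set (uIcc_subset_uIcc ha' right_mem_uIcc))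
    have hlast : ∫ t in a..T, ⟪-(stdJ n (deriv γ t)), γ t⟫ = -(c₀ * ⟪u, γ 0⟫) := by
      rw [hc₀, ← intervalIntegral.integral_mul_const, ← intervalIntegral.integral_neg]
      refine intervalIntegral.integral_congr_ae_restrict ?_
      filter_upwards [ae_restrict_of_ae_restrict_of_subset hIocIcc hcae,
        ae_restrict_mem measurableSet_uIoc] with t h1 h2
      rw [h1.2, map_neg, neg_stdJ_smul_stdJ, inner_neg_left, real_inner_smul_left,
        hconst t (hIocIcc h2)]
    have hc₀h : c₀ * ⟪u, γ 0⟫ = c₀ * h := by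
      rcases eq_or_ne c₀ 0 with h0 | h0
      · rw [h0, zero_mul, zero_mul]
      · rw [hH h0]
    rw [hlast, hc₀h] at hsplit
    rw [action]
    linarith
  refine ⟨c₀, hv.mono haT.1 haT.2, hc₀nn, ?_, hH, ?_, hint⟩
  · have := hvel a ⟨le_rfl, haT.2⟩
    rw [hγ.closed, ← neg_sub, this, neg_neg]
  · rw [← hint]
    refine integral_congr_ae_Icc haT.1 ?_
    filter_upwards [hN, ae_restrict_mem measurableSet_Icc] with t h1 h2
    exact supportFn_eq_of_mem_normalCone hKc (upperPiece_subset
      (hγ.mem (isCompact_upperPiece hKc) ⟨h2.1, h2.2.trans haT.2⟩)) h1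

end Glue

/-! ### Splitting a systole -/

section Split

variable {K : Set (PhaseSpace n)} {u : PhaseSpace n} {h T t₁ t₂ : ℝ} {γ : ℝ → PhaseSpace n}

theorem inner_segmentPath {x y : PhaseSpace n} (hx : ⟪u, x⟫ = h) (hy : ⟪u, y⟫ = h) (t : ℝ) :
    ⟪u, segmentPath x y t⟫ = h := by
  rw [segmentPath, inner_add_right, real_inner_smul_right, inner_sub_right, hx, hy]
  ring

theorem hasVelocity_innerLoop {v : ℝ → PhaseSpace n} (hγ : HasVelocity T γ v) (h0 : 0 ≤ t₁)
    (h12 : t₁ ≤ t₂) (h2 : t₂ ≤ T) :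
    HasVelocity (t₂ - t₁ + 1) (innerLoop γ t₁ t₂)
      (concatAt (t₂ - t₁) (fun r => v (t₁ + r)) (fun _ => γ t₁ - γ t₂)) :=
  (hγ.shift h0 h12 h2).concat (HasVelocity.segmentPath _ _) (by simp [segmentPath])

theorem innerLoop_closed (h12 : t₁ ≤ t₂) :
    innerLoop γ t₁ t₂ 0 = innerLoop γ t₁ t₂ (t₂ - t₁ + 1) := by
  rw [innerLoop, concatAt_of_le (sub_nonneg.2 h12), concatAt_add (by simp [segmentPath]) zero_le_one]
  simp [segmentPath]

theorem neg_stdJ_sub_of_sub_eq {x y : PhaseSpace n} {c : ℝ} (hc : y - x = c • stdJ n u) :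
    -(stdJ n (x - y)) = -(c • u) := by
  rw [← neg_sub y x, hc, map_neg, neg_stdJ_smul_stdJ]

theorem action_innerLoop {v : ℝ → PhaseSpace n} (hγ : HasVelocity T γ v) (h0 : 0 ≤ t₁)
    (h12 : t₁ ≤ t₂) (h2 : t₂ ≤ T) (hH₁ : ⟪u, γ t₁⟫ = h) (hH₂ : ⟪u, γ t₂⟫ = h) {c : ℝ}
    (hc : γ t₂ - γ t₁ = c • stdJ n u) :
    action (t₂ - t₁ + 1) (innerLoop γ t₁ t₂) =
      1 / 2 * ((∫ t in t₁..t₂, ⟪-(stdJ n (v t)), γ t⟫) - c * h) := by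
  rw [(hasVelocity_innerLoop hγ h0 h12 h2).action_eq, innerLoop,
    (hγ.shift h0 h12 h2).integral_inner_concat (HasVelocity.segmentPath _ _),
    intervalIntegral.integral_comp_add_left (f := fun t => ⟪-(stdJ n (v t)), γ t⟫), add_zero,
    add_sub_cancel]
  simp only [neg_stdJ_sub_of_sub_eq hc, inner_neg_left, real_inner_smul_left,
    inner_segmentPath hH₂ hH₁]
  simp
  ring

theorem innerLoop_spec [Nontrivial (PhaseSpace n)] (hK : Convex ℝ K) (hKc : IsCompact K)
    (hu : ‖u‖ = 1) (hcut : (interior K ∩ hyperplane u h).Nonempty)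
    (hγ : IsClosedCharacteristic K T γ) (hs : SplitsAt u h T γ t₁ t₂) :
    ehzCapacity (upperPiece K u h) ≤ action (t₂ - t₁ + 1) (innerLoop γ t₁ t₂) ∧
      (action (t₂ - t₁ + 1) (innerLoop γ t₁ t₂) ≤ ehzCapacity (upperPiece K u h) →
        IsSystole (upperPiece K u h) (t₂ - t₁ + 1) (innerLoop γ t₁ t₂)) := by
  obtain ⟨h0, h12, h2, hH₁, hH₂, c, hc, hchord⟩ := hs
  have hH₁' : ⟪u, γ t₁⟫ = h := hH₁
  have hH₂' : ⟪u, γ t₂⟫ = h := hH₂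
  have hu0 : u ≠ 0 := fun h0 => by simp [h0] at hu
  have hJu : stdJ n u ≠ 0 := fun h0 => hu0 (by rw [← norm_eq_zero, ← norm_stdJ, h0, norm_zero])
  have hv := hγ.hasVelocity
  have hloop := hasVelocity_innerLoop hv h0 h12.le h2
  have hclosed := innerLoop_closed (γ := γ) h12.le
  have hi := hcut.mono inter_subset_left
  have hne : K.Nonempty := hi.mono interior_subset
  have hK₁ := convex_upperPiece (u := u) (h := h) hK
  have hK₁c := isCompact_upperPiece (u := u) (h := h) hKc
  have hK₁i := interior_upperPiece_nonempty hu hcut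
  have hK₁ne : (upperPiece K u h).Nonempty := hK₁i.mono interior_subset
  have hact := action_innerLoop hv h0 h12.le h2 hH₁' hH₂' hchord
  have hJc := neg_stdJ_sub_of_sub_eq hchord
  have hS : 0 ≤ t₂ - t₁ := sub_nonneg.2 h12.le
  have hsubI : ∀ r ∈ Icc 0 (t₂ - t₁), t₁ + r ∈ Icc 0 T := fun r hr =>
    ⟨by linarith [hr.1], by linarith [hr.2]⟩
  have hlen : supportLength (upperPiece K u h) (t₂ - t₁ + 1)
      (concatAt (t₂ - t₁) (fun r => deriv γ (t₁ + r)) (fun _ => γ t₁ - γ t₂)) ≤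
        2 * action (t₂ - t₁ + 1) (innerLoop γ t₁ t₂) := by
    have hsh := hv.shift h0 h12.le h2
    have hseg := HasVelocity.segmentPath (γ t₂) (γ t₁)
    rw [hsh.supportLength_concat hseg hK₁c hK₁ne, hact]
    have l1 : supportLength (upperPiece K u h) (t₂ - t₁) (fun r => deriv γ (t₁ + r)) ≤
        ∫ t in t₁..t₂, ⟪-(stdJ n (deriv γ t)), γ t⟫ := by
      have e := intervalIntegral.integral_comp_add_left (a := 0) (b := t₂ - t₁)
        (fun t => ⟪-(stdJ n (deriv γ t)), γ t⟫) t₁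
      rw [add_zero, add_sub_cancel] at e
      rw [← e]
      refine intervalIntegral.integral_mono_ae_restrict hS
        (hsh.intervalIntegrable_supportFn hK₁c hK₁ne)
        (hsh.intervalIntegrable_inner_curve hsh.continuousOn) ?_
      filter_upwards [ae_comp_add_left h0 h2 hγ.velocity_mem,
        ae_restrict_mem measurableSet_Icc] with r h3 h4
      rw [← supportFn_eq_of_mem_normalCone hKc (hγ.mem hKc (hsubI r h4)) h3]
      exact supportFn_mono hKc hK₁ne upperPiece_subset _
    have l2 : supportLength (upperPiece K u h) 1 (fun _ => γ t₁ - γ t₂) ≤ -(c * h) := by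
      simp only [supportLength, hJc]
      rw [intervalIntegral.integral_const, sub_zero, one_smul]
      refine supportFn_le hK₁ne fun y hy => ?_
      rw [inner_neg_left, real_inner_smul_left, neg_le_neg_iff]
      exact mul_le_mul_of_nonneg_left hy.2 hc.le
    linarith
  have hinner0 : innerLoop γ t₁ t₂ 0 = γ t₁ := by
    rw [innerLoop, concatAt_of_le hS, add_zero]
  have hinnerS : innerLoop γ t₁ t₂ (t₂ - t₁) = γ t₂ := by
    rw [innerLoop, concatAt_of_le le_rfl, add_sub_cancel]
  have hnc : ∃ t ∈ Icc 0 (t₂ - t₁ + 1), innerLoop γ t₁ t₂ t ≠ innerLoop γ t₁ t₂ 0 := by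
    refine ⟨t₂ - t₁, ⟨hS, by linarith⟩, fun heq => ?_⟩
    rw [hinner0, hinnerS, ← sub_eq_zero, hchord] at heq
    exact smul_ne_zero hc.ne' hJu heq
  have hLpos := hloop.supportLength_pos hclosed hK₁c hK₁i hnc
  have hAle := ehzCapacity_le_of_loop hK₁ hK₁c hK₁i hloop hclosed (by linarith) hlen rfl
  refine ⟨hAle, fun hle => ?_⟩
  obtain ⟨x, hx⟩ := exists_translate_isSystole hK₁ hK₁c hK₁i hloop hclosed (by linarith) hAle
  have hloopseg : ∀ t, 0 ≤ t → innerLoop γ t₁ t₂ (t₂ - t₁ + t) = segmentPath (γ t₂) (γ t₁) t :=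
    fun t ht => concatAt_add (by simp [segmentPath]) ht
  obtain ⟨p, hp, hpH⟩ := hcut
  have hpH' : ⟪u, p⟫ = h := hpH
  -- the chord forces the translation to be parallel to the hyperplane
  have hxu : ⟪u, x⟫ = 0 := by
    have h3 : ∀ᵐ t ∂(volume.restrict (Icc (0 : ℝ) (t₂ - t₁ + 1 - (t₂ - t₁)))), 0 < t →
        -(c • u) ∈ normalCone (upperPiece K u h) (innerLoop γ t₁ t₂ (t₂ - t₁ + t) + x) := by
      filter_upwards [ae_comp_add_left hS le_rfl hx.1.velocity_mem,
        ae_comp_add_left hS le_rfl (hloop.add_const x).ae_deriv_eq] with t h3 h4 h5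
      rw [h4, concatAt_of_lt (by linarith), hJc] at h3
      exact h3
    rw [add_sub_cancel_left] at h3
    have h3' : ∀ᵐ t ∂(volume.restrict (Ioo (0 : ℝ) 1)), t ∈ Ioo (0 : ℝ) 1 ∧
        -(c • u) ∈ normalCone (upperPiece K u h) (innerLoop γ t₁ t₂ (t₂ - t₁ + t) + x) := by
      filter_upwards [ae_restrict_of_ae_restrict_of_subset Ioo_subset_Icc_self h3,
        ae_restrict_mem measurableSet_Ioo] with t h4 h5
      exact ⟨h5, h4 h5.1⟩
    have : (ae (volume.restrict (Ioo (0 : ℝ) 1))).NeBot := by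
      rw [ae_neBot]
      intro h6
      have := congrArg (fun μ : Measure ℝ => μ univ) h6
      simp at this
    obtain ⟨t, ht, hnorm⟩ := h3'.exists
    have hmem := (hx.1.mem hK₁c (t := t₂ - t₁ + t) ⟨by linarith [ht.1], by linarith [ht.2]⟩).2
    have hm1 : h ≤ ⟪u, innerLoop γ t₁ t₂ (t₂ - t₁ + t) + x⟫ := hmem
    have hm2 := hnorm p ⟨interior_subset hp, hpH'.ge⟩
    rw [hloopseg t ht.1.le, inner_add_right, inner_segmentPath hH₂' hH₁'] at hm1
    rw [hloopseg t ht.1.le, inner_neg_left, real_inner_smul_left, inner_sub_right, inner_add_right,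
      inner_segmentPath hH₂' hH₁', hpH'] at hm2
    refine le_antisymm ?_ (by linarith)
    by_contra hpos
    push Not at hpos
    nlinarith
  have hmem : ∀ t ∈ Icc 0 (t₂ - t₁ + 1), innerLoop γ t₁ t₂ t ∈ upperPiece K u h := by
    intro t ht
    rcases le_or_gt t (t₂ - t₁) with hle' | hlt
    · have h3 : h ≤ ⟪u, innerLoop γ t₁ t₂ t + x⟫ := (hx.1.mem hK₁c ht).2
      rw [inner_add_right, hxu, add_zero] at h3
      refine ⟨?_, h3⟩
      rw [innerLoop, concatAt_of_le hle']
      exact hγ.mem hKc (hsubI t ⟨ht.1, hle'⟩)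
    · rw [innerLoop, concatAt_of_lt hlt]
      refine ⟨?_, (inner_segmentPath hH₂' hH₁' _).ge⟩
      have h4 : t - (t₂ - t₁) ∈ Icc (0 : ℝ) 1 := ⟨by linarith, by linarith [ht.2]⟩
      exact hK.add_smul_sub_mem (hγ.mem hKc ⟨by linarith, h2⟩)
        (hγ.mem hKc ⟨h0, by linarith⟩) h4
  have hcone : ∀ y : PhaseSpace n, ⟪u, y⟫ = h → -(c • u) ∈ normalCone (upperPiece K u h) y := by
    intro y hy y' hy'
    rw [inner_neg_left, real_inner_smul_left, inner_sub_right, hy]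
    have : h ≤ ⟪u, y'⟫ := hy'.2
    nlinarith
  refine IsClosedCharacteristic.isSystole hK₁ hK₁c hK₁i
    (.of_hasVelocity (by linarith) hloop hclosed (fun t ht => ?_) ?_ hnc) hle
  · refine ⟨subset_closure (hmem t ht), fun hint => ?_⟩
    rcases le_or_gt t (t₂ - t₁) with hle' | hlt
    · have h3 : innerLoop γ t₁ t₂ t ∈ frontier K := by
        rw [innerLoop, concatAt_of_le hle']
        exact hγ.mem_frontier _ (hsubI t ⟨ht.1, hle'⟩)
      exact h3.2 (interior_mono upperPiece_subset hint)
    · have h4 := eq_zero_of_mem_normalCone_of_mem_interior hint (hcone _ (by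
        rw [innerLoop, concatAt_of_lt hlt]
        exact inner_segmentPath hH₂' hH₁' _))
      rw [neg_eq_zero] at h4
      exact smul_ne_zero hc.ne' hu0 h4
  · refine ae_Icc_add ?_ ?_
    · filter_upwards [ae_comp_add_left h0 h2 hγ.velocity_mem,
        ae_restrict_mem measurableSet_Icc] with t h3 h4
      rw [innerLoop, concatAt_of_le h4.2, concatAt_of_le h4.2]
      exact normalCone_anti upperPiece_subset _ h3
    · have hne0 : ∀ᵐ t ∂(volume.restrict (Icc (0 : ℝ) 1)), t ≠ 0 :=
        ae_restrict_of_ae (by simp [ae_iff, measure_singleton])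
      filter_upwards [ae_restrict_mem measurableSet_Icc, hne0] with t h3 h4
      rw [hloopseg t h3.1, concatAt_of_lt (by linarith [lt_of_le_of_ne h3.1 h4.symm]), hJc]
      exact hcone _ (inner_segmentPath hH₂' hH₁' _)

theorem outerLoop_eq_innerLoop (hc : γ 0 = γ T) (h1 : 0 ≤ t₁) (h2 : t₂ ≤ T) :
    outerLoop T γ t₁ t₂ = innerLoop (rotate T t₂ γ) 0 (T - t₂ + t₁) := by
  simp only [outerLoop, innerLoop, rotate_sub_add hc h1, rotate_zero γ h2, zero_add, sub_zero]

theorem SplitsAt.rotate (hu : ‖u‖ = 1) (hγ : IsClosedCharacteristic K T γ)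
    (hs : SplitsAt u h T γ t₁ t₂) :
    SplitsAt (-u) (-h) T (rotate T t₂ γ) 0 (T - t₂ + t₁) := by
  obtain ⟨h0, h12, h2, hH₁, hH₂, c, hc, hchord⟩ := hs
  refine ⟨le_rfl, ?_, by linarith, ?_, ?_, c, hc, ?_⟩
  · refine lt_of_le_of_ne (by linarith) fun heq => ?_
    have e1 : t₁ = 0 := by linarith
    have e2 : t₂ = T := by linarith
    rw [e1, e2, hγ.closed, sub_self] at hchord
    have h3 := congrArg norm hchord
    rw [norm_zero, norm_smul, norm_stdJ, hu, mul_one, Real.norm_eq_abs, abs_of_pos hc] at h3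
    exact hc.ne h3
  · rw [hyperplane_neg, rotate_zero γ h2]
    exact hH₂
  · rw [hyperplane_neg, rotate_sub_add hγ.closed h0]
    exact hH₁
  · rw [rotate_zero γ h2, rotate_sub_add hγ.closed h0, map_neg, smul_neg, ← hchord, neg_sub]

theorem action_innerLoop_add_action_outerLoop (hu : ‖u‖ = 1) (hγ : IsClosedCharacteristic K T γ)
    (hs : SplitsAt u h T γ t₁ t₂) :
    action (t₂ - t₁ + 1) (innerLoop γ t₁ t₂) +
      action (T - t₂ + t₁ + 1) (outerLoop T γ t₁ t₂) = action T γ := by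
  have hs' := hs.rotate hu hγ
  obtain ⟨h0, h12, h2, hH₁, hH₂, c, hc, hchord⟩ := hs
  obtain ⟨-, h12', h2', -⟩ := hs'
  have hv := hγ.hasVelocity
  have m1 : t₁ ∈ Icc 0 T := ⟨h0, by linarith⟩
  have m2 : t₂ ∈ Icc 0 T := ⟨by linarith, h2⟩
  have hrot := hv.rotate hγ.closed m2 m1
  have a1 := action_innerLoop hv h0 h12.le h2 hH₁ hH₂ hchord
  have a2 := action_innerLoop hrot le_rfl h12'.le le_rfl
    (u := -u) (h := -h) (c := c)
    (by rw [rotate_zero γ h2, inner_neg_left, show ⟪u, γ t₂⟫ = h from hH₂])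
    (by rw [rotate_sub_add hγ.closed h0, inner_neg_left, show ⟪u, γ t₁⟫ = h from hH₁])
    (by rw [rotate_zero γ h2, rotate_sub_add hγ.closed h0, map_neg, smul_neg, ← hchord, neg_sub])
  rw [hv.integral_inner_rotate m2 m1, ← outerLoop_eq_innerLoop hγ.closed h0 h2, sub_zero] at a2
  have hi := hv.intervalIntegrable_inner_curve hv.continuousOn
  have u1 : t₁ ∈ uIcc 0 T := by rwa [uIcc_of_le hγ.period_pos.le]
  have u2 : t₂ ∈ uIcc 0 T := by rwa [uIcc_of_le hγ.period_pos.le]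
  have s1 := intervalIntegral.integral_add_adjacent_intervals
    (hi.mono_set (uIcc_subset_uIcc left_mem_uIcc u1)) (hi.mono_set (uIcc_subset_uIcc u1 u2))
  have s2 := intervalIntegral.integral_add_adjacent_intervals
    (hi.mono_set (uIcc_subset_uIcc left_mem_uIcc u2))
    (hi.mono_set (uIcc_subset_uIcc u2 right_mem_uIcc))
  rw [a1, a2, action]
  linarith

end Split

/-! ### Additive cuts -/

section Additive

variable {K : Set (PhaseSpace n)} {u : PhaseSpace n} {h : ℝ} [Nontrivial (PhaseSpace n)]

/-- Two characteristics of the pieces of small action give rise to a closed curve on the whole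
body; if their total action is the capacity, they glue to a systole. -/
theorem exists_glue_of_isClosedCharacteristic (hK : Convex ℝ K) (hKc : IsCompact K)
    (hu : ‖u‖ = 1) (hcut : (interior K ∩ hyperplane u h).Nonempty)
    {T₁ T₂ : ℝ} {γ₁ γ₂ : ℝ → PhaseSpace n}
    (h₁ : IsClosedCharacteristic (upperPiece K u h) T₁ γ₁)
    (h₂ : IsClosedCharacteristic (lowerPiece K u h) T₂ γ₂) :
    ehzCapacity K ≤ action T₁ γ₁ + action T₂ γ₂ ∧
      (action T₁ γ₁ + action T₂ γ₂ ≤ ehzCapacity K →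
        ∃ s₁ ∈ Icc 0 T₁, ∃ s₂ ∈ Icc 0 T₂, ∃ η₁ η₂ : ℝ → PhaseSpace n,
          StripsTo K (hyperplane u h) u T₁ (rotate T₁ s₁ γ₁) η₁ ∧
          StripsTo K (hyperplane u h) (-u) T₂ (rotate T₂ s₂ γ₂) η₂ ∧
          IsSystole K (T₁ + T₂) (concatAt T₁ η₁ η₂) ∧
          SplitsAt u h (T₁ + T₂) (concatAt T₁ η₁ η₂) 0 T₁) := by
  have hi : (interior K).Nonempty := hcut.mono inter_subset_left
  have hu' : ‖-u‖ = 1 := by rwa [norm_neg]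
  have hcut' := neg_cut_nonempty hcut
  rw [lowerPiece_eq_upperPiece] at h₂
  have hA₁ := h₁.action_pos (isCompact_upperPiece hKc) (interior_upperPiece_nonempty hu hcut)
  have hA₂ := h₂.action_pos (isCompact_upperPiece hKc) (interior_upperPiece_nonempty hu' hcut')
  rcases le_or_gt (ehzCapacity K) (action T₁ γ₁) with hle | hlt₁
  · exact ⟨by linarith, fun hle' => by linarith⟩
  rcases le_or_gt (ehzCapacity K) (action T₂ γ₂) with hle | hlt₂
  · exact ⟨by linarith, fun hle' => by linarith⟩
  obtain ⟨s₁, hs₁, a₁, ζ₁, v₁, hζ₁, hst₁⟩ := exists_stripsTo hK hKc hu hcut h₁ hlt₁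
  obtain ⟨s₂, hs₂, a₂, ζ₂, v₂, hζ₂, hst₂⟩ := exists_stripsTo hK hKc hu' hcut' h₂ hlt₂
  rw [hyperplane_neg] at hst₂
  obtain ⟨hle, hglue⟩ := exists_glue hK hKc hi hζ₁ hζ₂ hA₁ hA₂
  refine ⟨hle, fun hge => ?_⟩
  obtain ⟨x₁, x₂, hsys, hsplit⟩ := hglue hge
  exact ⟨s₁, hs₁, s₂, hs₂, _, _, hst₁ x₁, hst₂ x₂, hsys, hsplit⟩

/-- Subadditivity of the capacity for hyperplane cuts. -/
theorem ehzCapacity_le_add (hK : Convex ℝ K) (hKc : IsCompact K) (hu : ‖u‖ = 1)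
    (hcut : (interior K ∩ hyperplane u h).Nonempty) :
    ehzCapacity K ≤ ehzCapacity (upperPiece K u h) + ehzCapacity (upperPiece K (-u) (-h)) := by
  have hi₁ := interior_upperPiece_nonempty hu hcut
  have hi₂ := interior_upperPiece_nonempty (u := -u) (by rwa [norm_neg]) (neg_cut_nonempty hcut)
  obtain ⟨T₁, γ₁, h₁⟩ := exists_isSystole (convex_upperPiece hK) (isCompact_upperPiece hKc) hi₁
  obtain ⟨T₂, γ₂, h₂⟩ := exists_isSystole (convex_upperPiece hK) (isCompact_upperPiece hKc) hi₂
  rw [← h₁.action_eq (convex_upperPiece hK) (isCompact_upperPiece hKc) hi₁,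
    ← h₂.action_eq (convex_upperPiece hK) (isCompact_upperPiece hKc) hi₂]
  exact (exists_glue_of_isClosedCharacteristic hK hKc hu hcut h₁.1
    (by rw [lowerPiece_eq_upperPiece]; exact h₂.1)).1

theorem IsSystole.split (hK : Convex ℝ K) (hKc : IsCompact K) (hu : ‖u‖ = 1)
    (hcut : (interior K ∩ hyperplane u h).Nonempty) {T t₁ t₂ : ℝ} {γ : ℝ → PhaseSpace n}
    (hγ : IsSystole K T γ) (hs : SplitsAt u h T γ t₁ t₂) :
    IsSystole (upperPiece K u h) ((t₂ - t₁) + 1) (innerLoop γ t₁ t₂) ∧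
      IsSystole (lowerPiece K u h) ((T - t₂ + t₁) + 1) (outerLoop T γ t₁ t₂) := by
  have hi : (interior K).Nonempty := hcut.mono inter_subset_left
  have hu' : ‖-u‖ = 1 := by rwa [norm_neg]
  have m2 : t₂ ∈ Icc 0 T := ⟨by linarith [hs.1, hs.2.1], hs.2.2.1⟩
  obtain ⟨i1, i2⟩ := innerLoop_spec hK hKc hu hcut hγ.1 hs
  obtain ⟨o1, o2⟩ := innerLoop_spec hK hKc hu' (neg_cut_nonempty hcut) (hγ.1.rotate m2)
    (hs.rotate hu hγ.1)
  rw [← outerLoop_eq_innerLoop hγ.1.closed hs.1 hs.2.2.1, sub_zero] at o1 o2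
  have hsum := action_innerLoop_add_action_outerLoop hu hγ.1 hs
  rw [hγ.action_eq hK hKc hi] at hsum
  have hsub := ehzCapacity_le_add hK hKc hu hcut
  rw [lowerPiece_eq_upperPiece]
  exact ⟨i2 (by linarith), o2 (by linarith)⟩

end Additive

end

theorem mainTheorem3 (n : ℕ) (K : Set (PhaseSpace n)) (hK : Convex ℝ K) (hKc : IsCompact K)
    (u : PhaseSpace n) (hu : ‖u‖ = 1) (h : ℝ)
    (hcut : (interior K ∩ hyperplane u h).Nonempty) :
    -- additivity is equivalent to the existence of a systole that splits along the hyperplane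
    (IsAdditiveCut K u h ↔
      ∃ (T : ℝ) (γ : ℝ → PhaseSpace n) (t₁ t₂ : ℝ),
        IsSystole K T γ ∧ SplitsAt u h T γ t₁ t₂) ∧
    -- each such systole splits into systoles of the two pieces
    (∀ (T : ℝ) (γ : ℝ → PhaseSpace n) (t₁ t₂ : ℝ),
      IsSystole K T γ → SplitsAt u h T γ t₁ t₂ →
        IsSystole (upperPiece K u h) ((t₂ - t₁) + 1) (innerLoop γ t₁ t₂) ∧
        IsSystole (lowerPiece K u h) ((T - t₂ + t₁) + 1) (outerLoop T γ t₁ t₂)) ∧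
    -- for an additive cut, each pair of systoles of the two pieces can be glued
    (IsAdditiveCut K u h →
      ∀ (T₁ T₂ : ℝ) (γ₁ γ₂ : ℝ → PhaseSpace n),
        IsSystole (upperPiece K u h) T₁ γ₁ → IsSystole (lowerPiece K u h) T₂ γ₂ →
        -- after a choice of starting points, delete the motions of the two systoles along the
        -- hyperplane in the directions `∓ J u`, translate, and concatenate
        (∃ s₁ ∈ Icc 0 T₁, ∃ s₂ ∈ Icc 0 T₂, ∃ η₁ η₂ : ℝ → PhaseSpace n,
          StripsTo K (hyperplane u h) u T₁ (rotate T₁ s₁ γ₁) η₁ ∧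
          StripsTo K (hyperplane u h) (-u) T₂ (rotate T₂ s₂ γ₂) η₂ ∧
          IsSystole K (T₁ + T₂) (concatAt T₁ η₁ η₂) ∧
          SplitsAt u h (T₁ + T₂) (concatAt T₁ η₁ η₂) 0 T₁) ∧
        -- if the motion along the hyperplane is a single chord for each of the two systoles, then
        -- their remaining arcs, each translated as a whole, concatenate to a systole
        (∀ a₁ a₂ : ℝ, IsArcThenChord K u T₁ a₁ γ₁ → IsArcThenChord K (-u) T₂ a₂ γ₂ →
          ∃ x₁ x₂ : PhaseSpace n,
            IsSystole K (a₁ + a₂) (concatAt a₁ (fun t => γ₁ t + x₁) (fun t => γ₂ t + x₂)) ∧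
            SplitsAt u h (a₁ + a₂)
              (concatAt a₁ (fun t => γ₁ t + x₁) (fun t => γ₂ t + x₂)) 0 a₁)) := by
  have : Nontrivial (PhaseSpace n) := ⟨u, 0, fun h0 => by simp [h0] at hu⟩
  have hi : (interior K).Nonempty := hcut.mono inter_subset_left
  have hu' : ‖-u‖ = 1 := by rwa [norm_neg]
  have hcut' := neg_cut_nonempty hcut
  have hi₁ := interior_upperPiece_nonempty hu hcut
  have hi₂ := interior_upperPiece_nonempty hu' hcut'
  have hK₁ := convex_upperPiece (u := u) (h := h) hK
  have hK₂ := convex_upperPiece (u := -u) (h := -h) hK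
  have hK₁c := isCompact_upperPiece (u := u) (h := h) hKc
  have hK₂c := isCompact_upperPiece (u := -u) (h := -h) hKc
  rw [← lowerPiece_eq_upperPiece] at hi₂ hK₂ hK₂c
  have hglue : IsAdditiveCut K u h → ∀ (T₁ T₂ : ℝ) (γ₁ γ₂ : ℝ → PhaseSpace n),
      IsSystole (upperPiece K u h) T₁ γ₁ → IsSystole (lowerPiece K u h) T₂ γ₂ →
      ∃ s₁ ∈ Icc 0 T₁, ∃ s₂ ∈ Icc 0 T₂, ∃ η₁ η₂ : ℝ → PhaseSpace n,
        StripsTo K (hyperplane u h) u T₁ (rotate T₁ s₁ γ₁) η₁ ∧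
        StripsTo K (hyperplane u h) (-u) T₂ (rotate T₂ s₂ γ₂) η₂ ∧
        IsSystole K (T₁ + T₂) (concatAt T₁ η₁ η₂) ∧
        SplitsAt u h (T₁ + T₂) (concatAt T₁ η₁ η₂) 0 T₁ := by
    intro hadd T₁ T₂ γ₁ γ₂ h₁ h₂
    refine (exists_glue_of_isClosedCharacteristic hK hKc hu hcut h₁.1 h₂.1).2 ?_
    rw [h₁.action_eq hK₁ hK₁c hi₁, h₂.action_eq hK₂ hK₂c hi₂]
    exact hadd.ge
  refine ⟨⟨fun hadd => ?_, ?_⟩, fun T γ t₁ t₂ hγ hs => hγ.split hK hKc hu hcut hs,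
    fun hadd T₁ T₂ γ₁ γ₂ h₁ h₂ => ⟨hglue hadd T₁ T₂ γ₁ γ₂ h₁ h₂, fun a₁ a₂ ha₁ ha₂ => ?_⟩⟩
  · obtain ⟨T₁, γ₁, h₁⟩ := exists_isSystole hK₁ hK₁c hi₁
    obtain ⟨T₂, γ₂, h₂⟩ := exists_isSystole hK₂ hK₂c hi₂
    obtain ⟨-, -, -, -, η₁, η₂, -, -, hsys, hsplit⟩ := hglue hadd T₁ T₂ γ₁ γ₂ h₁ h₂
    exact ⟨_, _, _, _, hsys, hsplit⟩
  · rintro ⟨T, γ, t₁, t₂, hγ, hs⟩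
    obtain ⟨hin, hout⟩ := hγ.split hK hKc hu hcut hs
    rw [IsAdditiveCut, ← hγ.action_eq hK hKc hi, ← hin.action_eq hK₁ hK₁c hi₁,
      ← hout.action_eq hK₂ hK₂c hi₂]
    exact (action_innerLoop_add_action_outerLoop hu hγ.1 hs).symm
  · have hA₁ := h₁.1.action_pos hK₁c hi₁
    have hA₂ := h₂.1.action_pos hK₂c hi₂
    obtain ⟨c₁, hζ₁⟩ := ha₁.exists_isBalancedArc hKc hu hcut h₁.1
    have h₂' := h₂.1
    rw [lowerPiece_eq_upperPiece] at h₂'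
    obtain ⟨c₂, hζ₂⟩ := ha₂.exists_isBalancedArc hKc hu' hcut' h₂'
    refine (exists_glue hK hKc hi hζ₁ hζ₂ hA₁ hA₂).2 ?_
    rw [h₁.action_eq hK₁ hK₁c hi₁, h₂.action_eq hK₂ hK₂c hi₂]
    exact hadd.ge
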